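/- Let $X$ be a smooth ($C^\infty$) manifold of dimension $n$ and $q, r \ge 0$ integers. Let $\Pi_q \subseteq J_q(X\times X)$ be the full jet groupoid, i.e. the set of $q$-jets $j_x^q f$ of local diffeomorphisms $f$ of $X$, with source $s(j_x^q f)=x$, target $t(j_x^q f)=f(x)$ and multiplication $(j^q_{f(x)}g)(j_x^q f)=j_x^q(g\circ f)$. A natural bundle of order $q$ is a smooth fibre bundle $\pi:\mathcal F\to X$ together with a smooth right action of $\Pi_q$, that is, a smooth map $\{(u,g)\in\mathcal F\times\Pi_q : \pi(u)=t(g)\}\to\mathcal F$, $(u,g)\mapsto ug$, with $\pi(ug)=s(g)$, $u\,1_{\pi(u)}=u$ and $u(ab)=(ua)b$ whenever these are defined. For a section $\omega$ of a natural bundle $\mathcal F$ of order $q$, its symmetry groupoid is $$\mathrm{Stab}^q_{\mathcal F}(\omega)=\{g\in\Pi_q : \omega(t(g))\,g=\omega(s(g))\}.$$ For a subset $\mathcal R\subseteq\Pi_q$, its $r$-th prolongation is $J_r(\mathcal R)\cap J_{q+r}(X\times X)$, where $J_r(\mathcal R)$ is the set of $r$-jets of local smooth sections of $s:\mathcal R\to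 X$ and $J_{q+r}(X\times X)$ is embedded in $J_r(J_q(X\times X))$ by $j_x^{q+r}f\mapsto j_x^r(z\mapsto j_z^q f)$. Let $\mathcal F$ be a natural bundle of order $q$. Then: 1. The bundle $J_r(\mathcal F)$ of $r$-jets of local sections of $\mathcal F$ is a natural bundle of order $q+r$, with the smooth action of $\Pi_{q+r}$ given by $$(j^r_{f(x)}\sigma)\,(j^{q+r}_x f)=j^r_x\bigl(z\mapsto \sigma(f(z))\,(j^q_z f)\bigr)$$ for local sections $\sigma$ of $\mathcal F$ and local diffeomorphisms $f$ of $X$. 2. Let $\omega$ be a smooth section of $\mathcal F$. Then $j_r(\omega)$ is a smooth section of $J_r(\mathcal F)$. Suppose moreover that the fibres of $\mathcal F$ are homogeneous, i.e. that $\Pi_q(y,y)=\{g\in\Pi_q : s(g)=t(g)=y\}$ acts transitively on $\mathcal F_y=\pi^{-1}(y)$ for every $y\in X$. Let $\mathcal R_q(\omega)=\mathrm{Stab}^q_{\mathcal F}(\omega)$ and let $\mathcal R_{q+r}(\omega)$ be its $r$-th prolongation. Then $$\mathcal R_{q+r}(\omega)\cap\Pi_{q+r}=\mathrm{Stab}^{q+r}_{J_r(\mathcal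 F)}(j_r(\omega)),$$ and if $q\ge 1$, then $\mathcal R_{q+r}(\omega)\subseteq\Pi_{q+r}$, so that $\mathcal R_{q+r}(\omega)=\mathrm{Stab}^{q+r}_{J_r(\mathcal F)}(j_r(\omega))$. -/

import Mathlib

open scoped Manifold ContDiff Topology
open Set Filter

universe u

noncomputable section

namespace JetBundles

section SymmetricMaps

/-- The space of symmetric `k`-linear maps `E × ⋯ × E → V`. -/
def SymMap (k : ℕ) (E V : Type*) [NormedAddCommGroup E] [NormedSpace ℝ E]
    [NormedAddCommGroup V] [NormedSpace ℝ V] : Submodule ℝ (E [×k]→L[ℝ] V) where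
  carrier := {m | ∀ (σ : Equiv.Perm (Fin k)) (v : Fin k → E), m (fun i => v (σ i)) = m v}
  add_mem' ha hb σ v := by simp [ha σ v, hb σ v]
  zero_mem' σ v := by simp
  smul_mem' c m hm σ v := by simp [hm σ v]

variable {E V : Type*} [NormedAddCommGroup E] [NormedSpace ℝ E]
  [NormedAddCommGroup V] [NormedSpace ℝ V]

/-- The average of a multilinear map over all permutations of its arguments, as an operator. -/
def symmetrizer (k : ℕ) : (E [×k]→L[ℝ] V) →L[ℝ] (E [×k]→L[ℝ] V) :=
  (k.factorial : ℝ)⁻¹ • ∑ σ : Equiv.Perm (Fin k),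
    ((ContinuousMultilinearMap.domDomCongrₗᵢ ℝ E V σ).toContinuousLinearEquiv :
      (E [×k]→L[ℝ] V) →L[ℝ] (E [×k]→L[ℝ] V))

theorem symmetrizer_apply (k : ℕ) (m : E [×k]→L[ℝ] V) (v : Fin k → E) :
    symmetrizer k m v
      = (k.factorial : ℝ)⁻¹ • ∑ σ : Equiv.Perm (Fin k), m (fun i => v (σ i)) := by
  simp only [symmetrizer, smul_apply, sum_apply]
  rfl

theorem symmetrizer_mem (k : ℕ) (m : E [×k]→L[ℝ] V) : symmetrizer k m ∈ SymMap k E V := by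
  intro τ v
  rw [symmetrizer_apply, symmetrizer_apply]
  congr 1
  exact Fintype.sum_equiv (Equiv.mulLeft τ) _ _ (fun σ => rfl)

/-- Symmetrization of multilinear maps: a projection onto the symmetric ones. -/
def symmetrize (k : ℕ) : (E [×k]→L[ℝ] V) →L[ℝ] SymMap k E V :=
  ContinuousLinearMap.codRestrict (symmetrizer k) (SymMap k E V) (symmetrizer_mem k)

theorem symmetrize_of_mem {k : ℕ} {m : E [×k]→L[ℝ] V} (hm : m ∈ SymMap k E V) :
    (symmetrize k m : E [×k]→L[ℝ] V) = m := by
  ext v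
  change symmetrizer k m v = m v
  have h : ∀ σ : Equiv.Perm (Fin k), m (fun i => v (σ i)) = m v := fun σ => hm σ v
  rw [symmetrizer_apply]
  simp only [h, Finset.sum_const, Finset.card_univ, Fintype.card_perm, Fintype.card_fin]
  rw [← Nat.cast_smul_eq_nsmul ℝ, smul_smul, inv_mul_cancel₀ (by positivity), one_smul]

theorem fderiv_multilinear_apply {W : Type*} [NormedAddCommGroup W] [NormedSpace ℝ W] {k : ℕ}
    {g : W → (E [×k]→L[ℝ] V)} {x : W} (hg : DifferentiableAt ℝ g x) (u : W) (w : Fin k → E) :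
    fderiv ℝ (fun y => g y w) x u = fderiv ℝ g x u w := by
  have h3 := ((ContinuousMultilinearMap.apply ℝ (fun _ : Fin k => E) V w).hasFDerivAt.comp x
    hg.hasFDerivAt).fderiv
  have h4 : (fun y => g y w)
    = (ContinuousMultilinearMap.apply ℝ (fun _ : Fin k => E) V w) ∘ g := rfl
  rw [h4, h3]
  rfl

theorem fderiv_clm_apply_const {W : Type*} [NormedAddCommGroup W] [NormedSpace ℝ W]
    {g : E → (E →L[ℝ] W)} {x : E} (hg : DifferentiableAt ℝ g x) (u v : E) :
    fderiv ℝ (fun y => g y v) x u = fderiv ℝ g x u v := by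
  have h3 := (hg.hasFDerivAt.clm_apply (hasFDerivAt_const v x)).fderiv
  rw [h3]
  simp

theorem symm_iteratedFDeriv {f : E → V} {x : E} (hf : ∀ᶠ y in 𝓝 x, ContDiffAt ℝ ∞ f y) (k : ℕ) :
    iteratedFDeriv ℝ k f x ∈ SymMap k E V := by
  induction k generalizing x with
  | zero => intro σ v; congr 1; ext i; exact i.elim0
  | succ k ih =>
    have hS : ∀ s : Submonoid (Equiv.Perm (Fin (k+1))),
        s = ⊤ → (∀ σ ∈ s, ∀ v : Fin (k+1) → E, iteratedFDeriv ℝ (k+1) f x (fun i => v (σ i)) = iteratedFDeriv ℝ (k+1) f x v) → iteratedFDeriv ℝ (k+1) f x ∈ SymMap (k+1) E V := by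
      intro s hs h σ v
      exact h σ (by rw [hs]; trivial) v
    refine hS _ (Equiv.Perm.mclosure_swap_castSucc_succ k) ?_
    intro σ hσ
    induction hσ using Submonoid.closure_induction with
    | one => intro v; rfl
    | mul a b _ _ ha hb =>
      intro v
      have := hb (fun i => v (a i))
      rw [ha v] at this
      exact this
    | mem σ hσ =>
      obtain ⟨i, rfl⟩ := hσ
      have hd : ∀ k : ℕ, DifferentiableAt ℝ (iteratedFDeriv ℝ k f) x := by
        intro k
        exact (hf.self_of_nhds.iteratedFDeriv_right (m := 1) (i := k) (by exact_mod_cast le_top)).differentiableAt (by simp)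
      have e1 : ∀ (k : ℕ) (u : E) (w : Fin k → E), fderiv ℝ (iteratedFDeriv ℝ k f) x u w
          = fderiv ℝ (fun y => iteratedFDeriv ℝ k f y w) x u := by
        intro k u w
        exact (fderiv_multilinear_apply (hd k) u w).symm
      cases k with
      | zero => exact i.elim0
      | succ k =>
      refine Fin.cases ?_ (fun i => ?_) i
      · intro v
        have hc : ∀ᶠ y in 𝓝 x, ContDiffAt ℝ 2 (iteratedFDeriv ℝ k f) y := by
          filter_upwards [hf] with y hy
          exact hy.iteratedFDeriv_right (m := 2) (i := k) (by
            rw [show (2 : WithTop ℕ∞) + k = ((2 + k : ℕ) : WithTop ℕ∞) by push_cast; rfl]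
            exact WithTop.coe_le_coe.2 (le_top : (((2 + k : ℕ)) : ℕ∞) ≤ ⊤))
        have hsym : IsSymmSndFDerivAt ℝ (iteratedFDeriv ℝ k f) x :=
          hc.self_of_nhds.isSymmSndFDerivAt (by simp)
        have key : ∀ w : Fin (k+2) → E, iteratedFDeriv ℝ (k+2) f x w =
            (fderiv ℝ (fderiv ℝ (iteratedFDeriv ℝ k f)) x (w 0) (w 1)) (fun j => w j.succ.succ) := by
          intro w
          rw [iteratedFDeriv_succ_apply_left]
          rw [e1 (k+1) (w 0) (Fin.tail w)]
          have h2 : DifferentiableAt ℝ (fderiv ℝ (iteratedFDeriv ℝ k f)) x :=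
            (hc.self_of_nhds.fderiv_right (m := 1) (by norm_num)).differentiableAt (by simp)
          have h3 : (fun y => iteratedFDeriv ℝ (k+1) f y (Fin.tail w)) =
              fun y => (fderiv ℝ (iteratedFDeriv ℝ k f) y (w 1)) (fun j => w j.succ.succ) := rfl
          rw [h3, fderiv_multilinear_apply (h2.clm_apply (differentiableAt_const _)),
            fderiv_clm_apply_const h2]
        rw [key, key]
        simp only [Fin.castSucc_zero, Fin.succ_zero_eq_one, Equiv.swap_apply_left, Equiv.swap_apply_right]
        rw [hsym.eq (v 1) (v 0)]
        congr 1
      · intro v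
        rw [iteratedFDeriv_succ_apply_left, iteratedFDeriv_succ_apply_left]
        have h0 : (Equiv.swap i.succ.castSucc i.succ.succ) 0 = 0 :=
          Equiv.swap_apply_of_ne_of_ne (by simp [Fin.ext_iff]) (by simp [Fin.ext_iff])
        have hs : ∀ j : Fin (k+1), (Equiv.swap i.succ.castSucc i.succ.succ) j.succ = (Equiv.swap i.castSucc i.succ j).succ := by
          intro j
          rw [← Fin.succ_castSucc]
          exact (Fin.succ_injective _).swap_apply _ _ _
        rw [h0]
        rw [e1 (k+1), e1 (k+1)]
        have : (fun y => iteratedFDeriv ℝ (k+1) f y (Fin.tail fun i_1 => v ((Equiv.swap i.succ.castSucc i.succ.succ) i_1))) =ᶠ[𝓝 x] (fun y => iteratedFDeriv ℝ (k+1) f y (Fin.tail v)) := by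
          filter_upwards [hf.eventually_nhds] with y hy
          have := ih hy (Equiv.swap i.castSucc i.succ) (Fin.tail v)
          rw [← this]
          congr 1
          ext j
          simp only [Fin.tail, hs]
        rw [this.fderiv_eq]

/-- The fibre coordinates of `r`-jets: one symmetric `k`-linear map for each `k ≤ r`. -/
def JetCoeff (r : ℕ) (E V : Type*) [NormedAddCommGroup E] [NormedSpace ℝ E]
    [NormedAddCommGroup V] [NormedSpace ℝ V] : Type _ := (k : Fin (r + 1)) → SymMap k E V

instance (r : ℕ) : NormedAddCommGroup (JetCoeff r E V) :=
  inferInstanceAs (NormedAddCommGroup ((k : Fin (r + 1)) → SymMap k E V))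

instance (r : ℕ) : NormedSpace ℝ (JetCoeff r E V) := Pi.normedSpace

theorem contDiff_jetCoeff_apply {r : ℕ} (k : Fin (r + 1)) :
    ContDiff ℝ ∞ (fun c : JetCoeff r E V => c k) :=
  contDiff_pi.1 contDiff_id k

/-- The model space of the manifold of `r`-jets of maps from a manifold modelled on `E` to a
manifold modelled on `V`. -/
abbrev JetModel (r : ℕ) (E V : Type*) [NormedAddCommGroup E] [NormedSpace ℝ E]
    [NormedAddCommGroup V] [NormedSpace ℝ V] : Type _ := E × JetCoeff r E V

/-- The polynomial map `v ↦ ∑_{k ≤ r} c_k(v, …, v) / k!`. -/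
def taylorPoly {r : ℕ} (c : JetCoeff r E V) (v : E) : V :=
  ∑ k : Fin (r + 1), ((k : ℕ).factorial : ℝ)⁻¹ • (c k : E [×k]→L[ℝ] V) (fun _ => v)

theorem analyticAt_taylorPoly {r : ℕ} (c : JetCoeff r E V) (v : E) :
    AnalyticAt ℝ (taylorPoly c) v := by
  unfold taylorPoly
  apply Finset.analyticAt_fun_sum
  intro k _
  apply AnalyticAt.const_smul
  exact ((c k : E [×k]→L[ℝ] V).analyticAt (x := fun _ => v)).comp
    (AnalyticAt.pi fun _ => analyticAt_id)

/-- The polynomial map depends smoothly on its coefficients and its argument jointly. -/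
theorem contDiff_taylorPoly {r : ℕ} : ContDiff ℝ ∞
    (fun z : JetCoeff r E V × E => taylorPoly z.1 z.2) := by
  unfold taylorPoly
  apply ContDiff.sum
  intro k _
  apply ContDiff.const_smul
  rw [contDiff_iff_contDiffAt]
  intro z
  have h := ((ContinuousLinearMap.id ℝ (E [×k]→L[ℝ] V)).cpolynomialAt_uncurry_of_multilinear
    (x := ((z.1 k : E [×k]→L[ℝ] V), fun _ => z.2))).contDiffAt (n := ∞)
  have h3 : ContDiff ℝ ∞ (fun m : SymMap (k : ℕ) E V => (m : E [×k]→L[ℝ] V)) :=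
    IsBoundedLinearMap.contDiff ⟨⟨fun _ _ => rfl, fun _ _ => rfl⟩, 1, one_pos,
      fun m => by simp⟩
  have h2 : ContDiff ℝ ∞ (fun z : JetCoeff r E V × E =>
      (((z.1 k : E [×k]→L[ℝ] V), fun _ => z.2) : (E [×k]→L[ℝ] V) × (Fin k → E))) :=
    (h3.comp ((contDiff_jetCoeff_apply k).comp contDiff_fst)).prodMk
      (contDiff_pi.2 fun _ => contDiff_snd)
  exact h.comp z h2.contDiffAt

theorem iteratedFDeriv_taylorPoly {r : ℕ} (c : JetCoeff r E V)
    (k : Fin (r + 1)) :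
    iteratedFDeriv ℝ k (taylorPoly c) 0 = (c k : E [×k]→L[ℝ] V) := by
  let p : FormalMultilinearSeries ℝ E V := fun k =>
    if h : k < r + 1 then (k.factorial : ℝ)⁻¹ • (c ⟨k, h⟩ : E [×k]→L[ℝ] V) else 0
  have hp0 : ∀ k, r + 1 ≤ k → p k = 0 := fun k hk => dif_neg (by omega)
  have hp : HasFPowerSeriesOnBall (taylorPoly c) p 0 ⊤ := by
    refine ⟨?_, by simp, ?_⟩
    · rw [FormalMultilinearSeries.radius_eq_top_of_eventually_eq_zero]
      filter_upwards [eventually_ge_atTop (r + 1)] with k hk using hp0 k hk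
    · intro y _
      have h1 : HasSum (fun k => p k fun _ => y) (∑ k ∈ Finset.range (r + 1), p k fun _ => y) := by
        apply hasSum_sum_of_ne_finset_zero
        intro k hk
        rw [hp0 k (by simpa using hk)]
        rfl
      convert h1 using 1
      rw [zero_add, taylorPoly, Finset.sum_range]
      refine Finset.sum_congr rfl fun i _ => ?_
      have : p i = ((i : ℕ).factorial : ℝ)⁻¹ • (c i : E [×i]→L[ℝ] V) := dif_pos i.2
      rw [this]
      rfl
  ext v
  rw [hp.iteratedFDeriv_eq_sum (fun x _ => (analyticAt_taylorPoly c x).analyticWithinAt) v]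
  have h1 : p k = ((k : ℕ).factorial : ℝ)⁻¹ • (c k : E [×k]→L[ℝ] V) := dif_pos k.2
  rw [h1]
  have h2 : ∀ σ : Equiv.Perm (Fin k), (((k : ℕ).factorial : ℝ)⁻¹ • (c k : E [×k]→L[ℝ] V))
      (fun i => v (σ i)) = ((k : ℕ).factorial : ℝ)⁻¹ • (c k : E [×k]→L[ℝ] V) v := by
    intro σ
    exact congrArg (((k : ℕ).factorial : ℝ)⁻¹ • ·) ((c k).2 σ v)
  simp only [h2, Finset.sum_const, Finset.card_univ, Fintype.card_perm, Fintype.card_fin]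
  rw [← Nat.cast_smul_eq_nsmul ℝ, smul_smul, mul_inv_cancel₀ (by positivity), one_smul]

/-- The derivatives of a smooth family, evaluated along the family, are smooth. -/
theorem contDiffAt_iteratedFDeriv_param {P : Type*} [NormedAddCommGroup P] [NormedSpace ℝ P]
    {G : P → E → V} {a : P} {b : E} (hG : ContDiffAt ℝ ∞ (Function.uncurry G) (a, b)) (k : ℕ) :
    ContDiffAt ℝ ∞ (fun z : P × E => iteratedFDeriv ℝ k (G z.1) z.2) (a, b) := by
  induction k with
  | zero =>
    exact ((continuousMultilinearCurryFin0 ℝ E V).symm.toContinuousLinearEquiv.contDiff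
      (n := ∞)).contDiffAt.comp (a, b) hG
  | succ k ih =>
    have h : ContDiffAt ℝ ∞ (fun z : P × E => fderiv ℝ (fun y => iteratedFDeriv ℝ k (G z.1) y) z.2)
        (a, b) := by
      refine ContDiffAt.fderiv (n := ∞) (f := fun (z : P × E) y => iteratedFDeriv ℝ k (G z.1) y)
        (g := Prod.snd) ?_ contDiffAt_snd (by rfl)
      exact ContDiffAt.comp (f := fun q : (P × E) × E => (q.1.1, q.2)) ((a, b), b)
        ih (by fun_prop)
    exact ((continuousMultilinearCurryLeftEquiv ℝ (fun _ : Fin (k + 1) => E) V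
      ).symm.toContinuousLinearEquiv.contDiff (n := ∞)).contDiffAt.comp (a, b) h

/-- The derivatives of a composition up to order `r` depend only on those of its factors. -/
theorem iteratedFDeriv_comp_congr {D : Type*} [NormedAddCommGroup D] [NormedSpace ℝ D] {r : ℕ}
    {f₁ f₂ : D → E} {g₁ g₂ : E → V} {x : D}
    (hf₁ : ContDiffAt ℝ ∞ f₁ x) (hf₂ : ContDiffAt ℝ ∞ f₂ x)
    (hg₁ : ContDiffAt ℝ ∞ g₁ (f₁ x)) (hg₂ : ContDiffAt ℝ ∞ g₂ (f₁ x)) (h0 : f₁ x = f₂ x)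
    (hf : ∀ k ≤ r, iteratedFDeriv ℝ k f₁ x = iteratedFDeriv ℝ k f₂ x)
    (hg : ∀ k ≤ r, iteratedFDeriv ℝ k g₁ (f₁ x) = iteratedFDeriv ℝ k g₂ (f₁ x)) :
    ∀ k ≤ r, iteratedFDeriv ℝ k (g₁ ∘ f₁) x = iteratedFDeriv ℝ k (g₂ ∘ f₂) x := by
  intro k hk
  rw [iteratedFDeriv_comp (n := ∞) hg₁ hf₁ (by exact_mod_cast le_top),
    iteratedFDeriv_comp (n := ∞) (h0 ▸ hg₂) hf₂ (by exact_mod_cast le_top)]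
  refine Finset.sum_congr rfl fun c _ => ?_
  change c.compAlongOrderedFinpartition (iteratedFDeriv ℝ c.length g₁ (f₁ x)) _ =
    c.compAlongOrderedFinpartition (iteratedFDeriv ℝ c.length g₂ (f₂ x)) _
  rw [hg _ (c.length_le.trans hk), h0]
  congr 1
  ext1 m
  exact hf _ ((c.partSize_le m).trans hk)

theorem contDiff_symmetrize (k : ℕ) :
    ContDiff ℝ ∞ (fun m : E [×k]→L[ℝ] V => symmetrize k m) :=
  IsBoundedLinearMap.contDiff ⟨⟨fun _ _ => map_add _ _ _, fun _ _ => map_smul _ _ _⟩,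
    ‖symmetrizer (E := E) (V := V) k‖ + 1, by positivity, fun m =>
      ((symmetrizer k).le_opNorm m).trans (by gcongr; linarith)⟩

end SymmetricMaps

section Jets

set_option linter.unusedSectionVars false

variable (E E' : Type*) [NormedAddCommGroup E] [NormedSpace ℝ E]
  [NormedAddCommGroup E'] [NormedSpace ℝ E']
  {X Y : Type*} [TopologicalSpace X] [ChartedSpace E X] [TopologicalSpace Y] [ChartedSpace E' Y]

/-- `f` is smooth in a neighbourhood of `x`. -/
def SmoothNear (f : X → Y) (x : X) : Prop :=
  ∀ᶠ y in 𝓝 x, ContMDiffAt 𝓘(ℝ, E) 𝓘(ℝ, E') ∞ f y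

variable (X Y) in
/-- A map from `X` to `Y` that is smooth near a base point. Only its germ at the base point
matters; the values away from the base point are irrelevant. -/
structure LocalMap where
  base : X
  map : X → Y
  smooth : SmoothNear E E' map base

variable {E E'}

/-- The expression of `f` in the charts `φ` and `ψ`. -/
def localRep (φ : OpenPartialHomeomorph X E) (ψ : OpenPartialHomeomorph Y E') (f : X → Y) :
    E → E' :=
  fun v => ψ (f (φ.symm v))

/-- Two local maps have the same `r`-jet if they have the same base point and the same value there
and their expressions in the charts around these points have the same derivatives up to order `r`
at the base point. -/
def SameJet (r : ℕ) (a b : LocalMap E E' X Y) : Prop :=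
  a.base = b.base ∧ a.map a.base = b.map b.base ∧
    ∀ k ≤ r,
      iteratedFDeriv ℝ k (localRep (chartAt E a.base) (chartAt E' (a.map a.base)) a.map)
          (chartAt E a.base a.base) =
        iteratedFDeriv ℝ k (localRep (chartAt E b.base) (chartAt E' (b.map b.base)) b.map)
          (chartAt E b.base b.base)

variable (E E' X Y) in
def jetSetoid (r : ℕ) : Setoid (LocalMap E E' X Y) where
  r := SameJet r
  iseqv :=
    { refl := fun _ => ⟨rfl, rfl, fun _ _ => rfl⟩
      symm := fun h => ⟨h.1.symm, h.2.1.symm, fun k hk => (h.2.2 k hk).symm⟩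
      trans := fun h h' => ⟨h.1.trans h'.1, h.2.1.trans h'.2.1,
        fun k hk => (h.2.2 k hk).trans (h'.2.2 k hk)⟩ }

variable (E E' X Y) in
/-- The space `J_r(X × Y)` of `r`-jets of local smooth maps `X → Y`. -/
def Jet (r : ℕ) : Type _ := Quotient (jetSetoid E E' X Y r)

namespace Jet

variable {r : ℕ}

/-- The `r`-jet of a local map at its base point. -/
def mk (r : ℕ) (a : LocalMap E E' X Y) : Jet E E' X Y r := Quotient.mk (jetSetoid E E' X Y r) a

/-- A representative of a jet. -/
def rep (j : Jet E E' X Y r) : LocalMap E E' X Y := Quotient.out j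

/-- The source of `j_x^r f` is `x`. -/
def source (j : Jet E E' X Y r) : X := Quotient.lift LocalMap.base (fun a b (h : SameJet r a b) => h.1) j

/-- The target of `j_x^r f` is `f x`. -/
def target (j : Jet E E' X Y r) : Y :=
  Quotient.lift (fun a => a.map a.base) (fun a b (h : SameJet r a b) => h.2.1) j

@[simp] theorem mk_rep (j : Jet E E' X Y r) : mk r j.rep = j := Quotient.out_eq j

theorem mk_eq_mk {a b : LocalMap E E' X Y} : mk r a = mk r b ↔ SameJet r a b := Quotient.eq

@[simp] theorem source_mk (a : LocalMap E E' X Y) : (mk r a).source = a.base := rfl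

@[simp] theorem target_mk (a : LocalMap E E' X Y) : (mk r a).target = a.map a.base := rfl

@[simp] theorem rep_base (j : Jet E E' X Y r) : j.rep.base = j.source := by
  conv_rhs => rw [← mk_rep j]
  rfl

@[simp] theorem rep_map (j : Jet E E' X Y r) : j.rep.map j.source = j.target := by
  conv_rhs => rw [← mk_rep j]
  rw [target_mk, rep_base]

end Jet

section Charts

theorem localRep_eventuallyEq {φ φ' : OpenPartialHomeomorph X E}
    {ψ ψ' : OpenPartialHomeomorph Y E'} {f : X → Y} {x : X} (hf : ContinuousAt f x)
    (hx : x ∈ φ.source) (hx' : x ∈ φ'.source) (hy : f x ∈ ψ.source) :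
    localRep φ' ψ' f =ᶠ[𝓝 (φ' x)]
      (fun w => ψ' (ψ.symm w)) ∘ localRep φ ψ f ∘ (fun w => φ (φ'.symm w)) := by
  have hc : ContinuousAt φ'.symm (φ' x) := φ'.continuousAt_symm (φ'.map_source hx')
  have h1 : ∀ᶠ w in 𝓝 (φ' x), φ'.symm w ∈ φ.source := by
    apply hc.eventually
    rw [φ'.left_inv hx']
    exact φ.open_source.mem_nhds hx
  have h2 : ∀ᶠ w in 𝓝 (φ' x), f (φ'.symm w) ∈ ψ.source := by
    apply hc.eventually (p := fun z => f z ∈ ψ.source)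
    rw [φ'.left_inv hx']
    exact hf.eventually (ψ.open_source.mem_nhds hy)
  filter_upwards [h1, h2] with w hw1 hw2
  simp [localRep, φ.left_inv hw1, ψ.left_inv hw2]

variable [IsManifold 𝓘(ℝ, E) ∞ X] [IsManifold 𝓘(ℝ, E') ∞ Y]

theorem contDiffAt_transition {φ φ' : OpenPartialHomeomorph X E} (hφ : φ ∈ atlas E X)
    (hφ' : φ' ∈ atlas E X) {v : E} (hv : v ∈ φ.target) (hv' : φ.symm v ∈ φ'.source) :
    ContDiffAt ℝ ∞ (fun w => φ' (φ.symm w)) v := by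
  rw [← contMDiffAt_iff_contDiffAt]
  have h1 := contMDiffAt_symm_of_mem_maximalAtlas (I := 𝓘(ℝ, E)) (n := ∞)
    (IsManifold.subset_maximalAtlas hφ) hv
  have h2 := contMDiffAt_of_mem_maximalAtlas (I := 𝓘(ℝ, E)) (n := ∞)
    (IsManifold.subset_maximalAtlas hφ') hv'
  exact ContMDiffAt.comp v h2 h1

theorem contDiffAt_localRep {φ : OpenPartialHomeomorph X E} {ψ : OpenPartialHomeomorph Y E'}
    (hφ : φ ∈ atlas E X) (hψ : ψ ∈ atlas E' Y) {f : X → Y} {v : E} (hv : v ∈ φ.target)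
    (hf : ContMDiffAt 𝓘(ℝ, E) 𝓘(ℝ, E') ∞ f (φ.symm v)) (hfv : f (φ.symm v) ∈ ψ.source) :
    ContDiffAt ℝ ∞ (localRep φ ψ f) v := by
  rw [← contMDiffAt_iff_contDiffAt]
  have h1 := contMDiffAt_symm_of_mem_maximalAtlas (I := 𝓘(ℝ, E)) (n := ∞)
    (IsManifold.subset_maximalAtlas hφ) hv
  have h2 := contMDiffAt_of_mem_maximalAtlas (I := 𝓘(ℝ, E')) (n := ∞)
    (IsManifold.subset_maximalAtlas hψ) hfv
  exact ContMDiffAt.comp v h2 (ContMDiffAt.comp v hf h1)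

/-- Equality of the derivatives up to order `r` does not depend on the charts. -/
theorem iteratedFDeriv_localRep_congr {r : ℕ} {φ φ' : OpenPartialHomeomorph X E}
    {ψ ψ' : OpenPartialHomeomorph Y E'} (hφ : φ ∈ atlas E X) (hφ' : φ' ∈ atlas E X)
    (hψ : ψ ∈ atlas E' Y) (hψ' : ψ' ∈ atlas E' Y) {f g : X → Y} {x : X}
    (hf : ContMDiffAt 𝓘(ℝ, E) 𝓘(ℝ, E') ∞ f x) (hg : ContMDiffAt 𝓘(ℝ, E) 𝓘(ℝ, E') ∞ g x)
    (hx : x ∈ φ.source) (hx' : x ∈ φ'.source) (hy : f x ∈ ψ.source) (hy' : f x ∈ ψ'.source)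
    (hfg : f x = g x)
    (h : ∀ k ≤ r, iteratedFDeriv ℝ k (localRep φ ψ f) (φ x) =
      iteratedFDeriv ℝ k (localRep φ ψ g) (φ x)) :
    ∀ k ≤ r, iteratedFDeriv ℝ k (localRep φ' ψ' f) (φ' x) =
      iteratedFDeriv ℝ k (localRep φ' ψ' g) (φ' x) := by
  have e : φ (φ'.symm (φ' x)) = φ x := by rw [φ'.left_inv hx']
  have ef : localRep φ ψ f (φ x) = ψ (f x) := by simp [localRep, φ.left_inv hx]
  have eg : localRep φ ψ g (φ x) = ψ (f x) := by simp [localRep, φ.left_inv hx, hfg]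
  have hχ : ContDiffAt ℝ ∞ (fun w => φ (φ'.symm w)) (φ' x) :=
    contDiffAt_transition hφ' hφ (φ'.map_source hx') (by rwa [φ'.left_inv hx'])
  have hτ : ContDiffAt ℝ ∞ (fun w => ψ' (ψ.symm w)) (ψ (f x)) :=
    contDiffAt_transition hψ hψ' (ψ.map_source hy) (by rwa [ψ.left_inv hy])
  have hF : ContDiffAt ℝ ∞ (localRep φ ψ f) (φ x) :=
    contDiffAt_localRep hφ hψ (φ.map_source hx) (by rwa [φ.left_inv hx]) (by rwa [φ.left_inv hx])
  have hG : ContDiffAt ℝ ∞ (localRep φ ψ g) (φ x) :=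
    contDiffAt_localRep hφ hψ (φ.map_source hx) (by rwa [φ.left_inv hx])
      (by rwa [φ.left_inv hx, ← hfg])
  intro k hk
  rw [((localRep_eventuallyEq (ψ' := ψ') hf.continuousAt hx hx' hy).iteratedFDeriv ℝ k).eq_of_nhds,
    ((localRep_eventuallyEq (ψ' := ψ') hg.continuousAt hx hx' (hfg ▸ hy)).iteratedFDeriv
      ℝ k).eq_of_nhds]
  have hF' : ContDiffAt ℝ ∞ (localRep φ ψ f) (φ (φ'.symm (φ' x))) := by rwa [e]
  have hG' : ContDiffAt ℝ ∞ (localRep φ ψ g) (φ (φ'.symm (φ' x))) := by rwa [e]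
  have hF'' : ContDiffAt ℝ ∞ (localRep φ ψ f ∘ fun w => φ (φ'.symm w)) (φ' x) :=
    ContDiffAt.comp (f := fun w => φ (φ'.symm w)) _ hF' hχ
  have hG'' : ContDiffAt ℝ ∞ (localRep φ ψ g ∘ fun w => φ (φ'.symm w)) (φ' x) :=
    ContDiffAt.comp (f := fun w => φ (φ'.symm w)) _ hG' hχ
  have h' : ∀ k ≤ r, iteratedFDeriv ℝ k (localRep φ ψ f ∘ fun w => φ (φ'.symm w)) (φ' x) =
      iteratedFDeriv ℝ k (localRep φ ψ g ∘ fun w => φ (φ'.symm w)) (φ' x) :=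
    iteratedFDeriv_comp_congr (f₁ := fun w => φ (φ'.symm w)) (f₂ := fun w => φ (φ'.symm w))
      hχ hχ hF' hG' rfl (fun _ _ => rfl) (by simpa only [e] using h)
  have hτ' : ContDiffAt ℝ ∞ (fun w => ψ' (ψ.symm w))
      ((localRep φ ψ f ∘ fun w => φ (φ'.symm w)) (φ' x)) := by
    simpa only [Function.comp_apply, e, ef] using hτ
  exact iteratedFDeriv_comp_congr hF'' hG'' hτ' hτ'
    (by simp only [Function.comp_apply, e, ef, eg]) h' (fun _ _ => rfl) k hk

/-- The `r`-jets of two local maps agree as soon as their derivatives agree in some charts. -/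
theorem sameJet_iff {r : ℕ} {φ : OpenPartialHomeomorph X E} {ψ : OpenPartialHomeomorph Y E'}
    (hφ : φ ∈ atlas E X) (hψ : ψ ∈ atlas E' Y) {a b : LocalMap E E' X Y}
    (hx : a.base ∈ φ.source) (hy : a.map a.base ∈ ψ.source) :
    SameJet r a b ↔ a.base = b.base ∧ a.map a.base = b.map b.base ∧
      ∀ k ≤ r, iteratedFDeriv ℝ k (localRep φ ψ a.map) (φ a.base) =
        iteratedFDeriv ℝ k (localRep φ ψ b.map) (φ b.base) := by
  obtain ⟨x, f, hf⟩ := a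
  obtain ⟨x', g, hg⟩ := b
  constructor
  · rintro ⟨h1, h2, h3⟩
    dsimp only at h1 h2 h3 hx hy ⊢
    subst h1
    refine ⟨rfl, h2, ?_⟩
    rw [← h2] at h3
    exact iteratedFDeriv_localRep_congr (chart_mem_atlas E x) hφ (chart_mem_atlas E' (f x)) hψ
      hf.self_of_nhds hg.self_of_nhds (mem_chart_source E x) hx (mem_chart_source E' (f x)) hy h2 h3
  · rintro ⟨h1, h2, h3⟩
    dsimp only at h1 h2 h3 hx hy ⊢
    subst h1
    refine ⟨rfl, h2, ?_⟩
    dsimp only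
    rw [← h2]
    exact iteratedFDeriv_localRep_congr hφ (chart_mem_atlas E x) hψ (chart_mem_atlas E' (f x))
      hf.self_of_nhds hg.self_of_nhds hx (mem_chart_source E x) hy (mem_chart_source E' (f x)) h2 h3

/-- The coordinates of a jet with respect to a chart `φ` of the source and a chart `ψ` of the
target manifold: the coordinates of the source and the derivatives of the local expression.
(On the domain of the charts these are symmetric, so that `symmetrize` does not change them.) -/
def jetCoord {r : ℕ} (φ : OpenPartialHomeomorph X E) (ψ : OpenPartialHomeomorph Y E')
    (j : Jet E E' X Y r) : JetModel r E E' :=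
  (φ j.source, fun k => symmetrize k (iteratedFDeriv ℝ k (localRep φ ψ j.rep.map) (φ j.source)))

theorem jetCoord_mk {r : ℕ} {φ : OpenPartialHomeomorph X E} {ψ : OpenPartialHomeomorph Y E'}
    (hφ : φ ∈ atlas E X) (hψ : ψ ∈ atlas E' Y) (a : LocalMap E E' X Y)
    (hx : a.base ∈ φ.source) (hy : a.map a.base ∈ ψ.source) :
    jetCoord φ ψ (Jet.mk r a) = (φ a.base, fun k : Fin (r + 1) =>
      symmetrize k (iteratedFDeriv ℝ k (localRep φ ψ a.map) (φ a.base))) := by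
  have h : SameJet r a (Jet.mk r a).rep := by
    rw [← Jet.mk_eq_mk, Jet.mk_rep]
  have h3 := ((sameJet_iff hφ hψ hx hy).1 h).2.2
  rw [Jet.rep_base, Jet.source_mk] at h3
  refine Prod.ext rfl (funext fun k : Fin (r + 1) => ?_)
  change symmetrize (k : ℕ) (iteratedFDeriv ℝ k (localRep φ ψ (Jet.mk r a).rep.map) (φ a.base)) = _
  rw [← h3 k (Nat.lt_succ_iff.1 k.2)]

theorem symm_iteratedFDeriv_localRep {φ : OpenPartialHomeomorph X E}
    {ψ : OpenPartialHomeomorph Y E'} (hφ : φ ∈ atlas E X) (hψ : ψ ∈ atlas E' Y)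
    {f : X → Y} {x : X} (hf : SmoothNear E E' f x) (hx : x ∈ φ.source) (hy : f x ∈ ψ.source)
    (k : ℕ) : iteratedFDeriv ℝ k (localRep φ ψ f) (φ x) ∈ SymMap k E E' := by
  apply symm_iteratedFDeriv
  have hc : ContinuousAt φ.symm (φ x) := φ.continuousAt_symm (φ.map_source hx)
  have h1 : ∀ᶠ v in 𝓝 (φ x), ContMDiffAt 𝓘(ℝ, E) 𝓘(ℝ, E') ∞ f (φ.symm v) := by
    apply hc.eventually (p := fun z => ContMDiffAt 𝓘(ℝ, E) 𝓘(ℝ, E') ∞ f z)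
    rwa [φ.left_inv hx]
  have h2 : ∀ᶠ v in 𝓝 (φ x), f (φ.symm v) ∈ ψ.source := by
    apply hc.eventually (p := fun z => f z ∈ ψ.source)
    rw [φ.left_inv hx]
    exact hf.self_of_nhds.continuousAt.eventually (ψ.open_source.mem_nhds hy)
  filter_upwards [h1, h2, φ.open_target.mem_nhds (φ.map_source hx)] with v hv1 hv2 hv
  exact contDiffAt_localRep hφ hψ hv hv1 hv2

/-- The map whose expression in the charts `φ` and `ψ` is the polynomial with coefficients
`z.2` centred at `z.1`. -/
def polyMap {r : ℕ} (φ : OpenPartialHomeomorph X E) (ψ : OpenPartialHomeomorph Y E')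
    (z : JetModel r E E') : X → Y :=
  fun y => ψ.symm (taylorPoly z.2 (φ y - z.1))

/-- The set of jet coordinates that are attained in the charts `φ` and `ψ`. -/
def jetTarget (r : ℕ) (φ : OpenPartialHomeomorph X E) (ψ : OpenPartialHomeomorph Y E') :
    Set (JetModel r E E') :=
  {z | z.1 ∈ φ.target ∧ taylorPoly z.2 0 ∈ ψ.target}

theorem smoothNear_polyMap {r : ℕ} {φ : OpenPartialHomeomorph X E}
    {ψ : OpenPartialHomeomorph Y E'} (hφ : φ ∈ atlas E X) (hψ : ψ ∈ atlas E' Y)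
    {z : JetModel r E E'} (hz : z ∈ jetTarget r φ ψ) :
    SmoothNear E E' (polyMap φ ψ z) (φ.symm z.1) := by
  have hx : φ.symm z.1 ∈ φ.source := φ.map_target hz.1
  have hP : ContDiff ℝ ∞ (fun v : E => taylorPoly z.2 (v - z.1)) :=
    contDiff_taylorPoly.comp (contDiff_const.prodMk (contDiff_id.sub contDiff_const))
  have hc : ContinuousAt (fun y => taylorPoly z.2 (φ y - z.1)) (φ.symm z.1) :=
    ContinuousAt.comp (f := φ) (g := fun v : E => taylorPoly z.2 (v - z.1))
      hP.continuous.continuousAt (φ.continuousAt hx)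
  have h1 : ∀ᶠ y in 𝓝 (φ.symm z.1), taylorPoly z.2 (φ y - z.1) ∈ ψ.target := by
    apply hc.eventually (ψ.open_target.mem_nhds _)
    simpa only [φ.right_inv hz.1, sub_self] using hz.2
  filter_upwards [h1, φ.open_source.mem_nhds hx] with y hy1 hy2
  have e1 := contMDiffAt_of_mem_maximalAtlas (I := 𝓘(ℝ, E)) (n := ∞)
    (IsManifold.subset_maximalAtlas hφ) hy2
  have e2 := contMDiffAt_symm_of_mem_maximalAtlas (I := 𝓘(ℝ, E')) (n := ∞)
    (IsManifold.subset_maximalAtlas hψ) hy1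
  have e3 : ContMDiffAt 𝓘(ℝ, E) 𝓘(ℝ, E') ∞ (fun y => taylorPoly z.2 (φ y - z.1)) y :=
    ContMDiffAt.comp (g := fun v : E => taylorPoly z.2 (v - z.1)) (f := φ) y
      hP.contMDiff.contMDiffAt e1
  exact ContMDiffAt.comp (g := ψ.symm) (f := fun y => taylorPoly z.2 (φ y - z.1)) y e2 e3

theorem polyMap_apply {r : ℕ} {φ : OpenPartialHomeomorph X E} {ψ : OpenPartialHomeomorph Y E'}
    {z : JetModel r E E'} (hz : z ∈ jetTarget r φ ψ) :
    polyMap φ ψ z (φ.symm z.1) = ψ.symm (taylorPoly z.2 0) := by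
  rw [polyMap, φ.right_inv hz.1, sub_self]

theorem taylorPoly_zero {r : ℕ} (c : JetCoeff r E E') :
    taylorPoly c 0 = (c 0).1 (fun _ => 0) := by
  have h := iteratedFDeriv_taylorPoly c 0
  exact congrArg (fun m : E [×0]→L[ℝ] E' => m (fun _ => 0)) h

theorem iteratedFDeriv_polyMap {r : ℕ} {φ : OpenPartialHomeomorph X E}
    {ψ : OpenPartialHomeomorph Y E'} {z : JetModel r E E'} (hz : z ∈ jetTarget r φ ψ)
    (k : Fin (r + 1)) :
    iteratedFDeriv ℝ k (localRep φ ψ (polyMap φ ψ z)) z.1 = (z.2 k : E [×k]→L[ℝ] E') := by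
  have hP : Continuous (fun v : E => taylorPoly z.2 (v - z.1)) :=
    (contDiff_taylorPoly.comp (contDiff_const.prodMk
      (contDiff_id.sub contDiff_const))).continuous
  have h1 : ∀ᶠ v in 𝓝 z.1, taylorPoly z.2 (v - z.1) ∈ ψ.target := by
    apply hP.continuousAt.eventually (ψ.open_target.mem_nhds _)
    simpa only [sub_self] using hz.2
  have h : localRep φ ψ (polyMap φ ψ z) =ᶠ[𝓝 z.1] fun v => taylorPoly z.2 (v - z.1) := by
    filter_upwards [h1, φ.open_target.mem_nhds hz.1] with v hv1 hv2
    simp [localRep, polyMap, φ.right_inv hv2, ψ.right_inv hv1]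
  rw [(h.iteratedFDeriv ℝ k).eq_of_nhds, iteratedFDeriv_comp_sub]
  simp only [sub_self]
  exact iteratedFDeriv_taylorPoly z.2 k

theorem taylorPoly_jetCoord {r : ℕ} {φ : OpenPartialHomeomorph X E}
    {ψ : OpenPartialHomeomorph Y E'} (hφ : φ ∈ atlas E X) (hψ : ψ ∈ atlas E' Y)
    {j : Jet E E' X Y r} (hx : j.source ∈ φ.source) (hy : j.target ∈ ψ.source) :
    taylorPoly (jetCoord φ ψ j).2 0 = ψ j.target := by
  rw [taylorPoly_zero]
  have h := symmetrize_of_mem (symm_iteratedFDeriv_localRep hφ hψ j.rep.smooth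
    (by simpa using hx) (by simpa using hy) 0)
  rw [Jet.rep_base] at h
  change (symmetrize 0 (iteratedFDeriv ℝ 0 (localRep φ ψ j.rep.map) (φ j.source)) :
    E [×0]→L[ℝ] E') (fun _ => 0) = ψ j.target
  rw [h, iteratedFDeriv_zero_apply, localRep, φ.left_inv hx, Jet.rep_map]

theorem jetCoord_mem {r : ℕ} {φ : OpenPartialHomeomorph X E}
    {ψ : OpenPartialHomeomorph Y E'} (hφ : φ ∈ atlas E X) (hψ : ψ ∈ atlas E' Y)
    {j : Jet E E' X Y r} (hx : j.source ∈ φ.source) (hy : j.target ∈ ψ.source) :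
    jetCoord φ ψ j ∈ jetTarget r φ ψ := by
  refine ⟨φ.map_source hx, ?_⟩
  rw [taylorPoly_jetCoord hφ hψ hx hy]
  exact ψ.map_source hy

open Classical in
/-- The chart of the space of jets determined by charts of the source and the target manifold.
The last argument is the irrelevant value of the inverse outside its domain. -/
def jetChartOf {r : ℕ} {φ : OpenPartialHomeomorph X E} {ψ : OpenPartialHomeomorph Y E'}
    (hφ : φ ∈ atlas E X) (hψ : ψ ∈ atlas E' Y) (j₀ : Jet E E' X Y r) :
    PartialEquiv (Jet E E' X Y r) (JetModel r E E') where
  toFun := jetCoord φ ψ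
  invFun z := if hz : z ∈ jetTarget r φ ψ then
    Jet.mk r ⟨φ.symm z.1, polyMap φ ψ z, smoothNear_polyMap hφ hψ hz⟩ else j₀
  source := {j | j.source ∈ φ.source ∧ j.target ∈ ψ.source}
  target := jetTarget r φ ψ
  map_source' j hj := jetCoord_mem hφ hψ hj.1 hj.2
  map_target' z hz := by
    rw [dif_pos hz]
    refine ⟨φ.map_target hz.1, ?_⟩
    rw [Jet.target_mk]
    simpa only [polyMap_apply hz] using ψ.map_target hz.2
  left_inv' j hj := by
    have hz : jetCoord φ ψ j ∈ jetTarget r φ ψ := jetCoord_mem hφ hψ hj.1 hj.2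
    have e0 : φ.symm (jetCoord φ ψ j).1 = j.source := φ.left_inv hj.1
    have e1 : polyMap φ ψ (jetCoord φ ψ j) (φ.symm (jetCoord φ ψ j).1) = j.target := by
      rw [polyMap_apply hz, taylorPoly_jetCoord hφ hψ hj.1 hj.2, ψ.left_inv hj.2]
    rw [dif_pos hz]
    conv_rhs => rw [← Jet.mk_rep j]
    rw [Jet.mk_eq_mk, sameJet_iff hφ hψ (by simpa only [e0] using hj.1)
      (by simpa only [e1] using hj.2)]
    refine ⟨by simpa using e0, by simpa using e1, fun k hk => ?_⟩
    have e2 : φ (φ.symm (jetCoord φ ψ j).1) = (jetCoord φ ψ j).1 := φ.right_inv hz.1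
    simp only [e2, Jet.rep_base]
    rw [iteratedFDeriv_polyMap hz ⟨k, Nat.lt_succ_iff.2 hk⟩]
    have h := symmetrize_of_mem (symm_iteratedFDeriv_localRep hφ hψ j.rep.smooth
      (by simpa using hj.1) (by simpa using hj.2) k)
    rw [Jet.rep_base] at h
    exact h
  right_inv' z hz := by
    rw [dif_pos hz, jetCoord_mk hφ hψ _ (φ.map_target hz.1)
      (by simpa only [polyMap_apply hz] using ψ.map_target hz.2)]
    refine Prod.ext (φ.right_inv hz.1) (funext fun k : Fin (r + 1) => Subtype.ext ?_)
    simp only [φ.right_inv hz.1]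
    rw [iteratedFDeriv_polyMap hz, symmetrize_of_mem (z.2 k).2]

theorem jetChartOf_trans_source {r : ℕ} {φ φ' : OpenPartialHomeomorph X E}
    {ψ ψ' : OpenPartialHomeomorph Y E'} (hφ : φ ∈ atlas E X) (hψ : ψ ∈ atlas E' Y)
    (hφ' : φ' ∈ atlas E X) (hψ' : ψ' ∈ atlas E' Y) (j₀ j₁ : Jet E E' X Y r) :
    ((jetChartOf hφ hψ j₀).symm.trans (jetChartOf hφ' hψ' j₁)).source =
      {z | z.1 ∈ (φ.symm.trans φ').source ∧ taylorPoly z.2 0 ∈ (ψ.symm.trans ψ').source} := by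
  ext z
  have key : ∀ hz : z ∈ jetTarget r φ ψ, (jetChartOf hφ hψ j₀).symm z =
      Jet.mk r ⟨φ.symm z.1, polyMap φ ψ z, smoothNear_polyMap hφ hψ hz⟩ := fun hz => dif_pos hz
  have e1 : z ∈ ((jetChartOf hφ hψ j₀).symm.trans (jetChartOf hφ' hψ' j₁)).source ↔
      z ∈ jetTarget r φ ψ ∧ ((jetChartOf hφ hψ j₀).symm z).source ∈ φ'.source ∧
        ((jetChartOf hφ hψ j₀).symm z).target ∈ ψ'.source := Iff.rfl
  have e2 : z ∈ {z : JetModel r E E' | z.1 ∈ (φ.symm.trans φ').source ∧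
        taylorPoly z.2 0 ∈ (ψ.symm.trans ψ').source} ↔
      (z.1 ∈ φ.target ∧ φ.symm z.1 ∈ φ'.source) ∧
        (taylorPoly z.2 0 ∈ ψ.target ∧ ψ.symm (taylorPoly z.2 0) ∈ ψ'.source) := by
    simp
  rw [e1, e2]
  constructor
  · rintro ⟨hz, h1, h2⟩
    rw [key hz, Jet.source_mk] at h1
    rw [key hz, Jet.target_mk] at h2
    simp only [polyMap_apply hz] at h2
    exact ⟨⟨hz.1, h1⟩, hz.2, h2⟩
  · rintro ⟨⟨h1, h2⟩, h3, h4⟩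
    have hz : z ∈ jetTarget r φ ψ := ⟨h1, h3⟩
    refine ⟨hz, ?_, ?_⟩
    · rwa [key hz]
    · rw [key hz, Jet.target_mk]
      simpa only [polyMap_apply hz] using h4

theorem isOpen_jetChartOf {r : ℕ} {φ φ' : OpenPartialHomeomorph X E}
    {ψ ψ' : OpenPartialHomeomorph Y E'} (hφ : φ ∈ atlas E X) (hψ : ψ ∈ atlas E' Y)
    (hφ' : φ' ∈ atlas E X) (hψ' : ψ' ∈ atlas E' Y) (j₀ j₁ : Jet E E' X Y r) :
    IsOpen ((jetChartOf hφ hψ j₀).symm.trans (jetChartOf hφ' hψ' j₁)).source := by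
  rw [jetChartOf_trans_source]
  have hP : Continuous (fun z : JetModel r E E' => taylorPoly z.2 0) :=
    (contDiff_taylorPoly.comp (contDiff_snd.prodMk contDiff_const)).continuous
  exact ((φ.symm.trans φ').open_source.preimage continuous_fst).inter
    ((ψ.symm.trans ψ').open_source.preimage hP)

theorem contDiffOn_jetChartOf {r : ℕ} {φ φ' : OpenPartialHomeomorph X E}
    {ψ ψ' : OpenPartialHomeomorph Y E'} (hφ : φ ∈ atlas E X) (hψ : ψ ∈ atlas E' Y)
    (hφ' : φ' ∈ atlas E X) (hψ' : ψ' ∈ atlas E' Y) (j₀ j₁ : Jet E E' X Y r) :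
    ContDiffOn ℝ ∞ ((jetChartOf hφ hψ j₀).symm.trans (jetChartOf hφ' hψ' j₁))
      ((jetChartOf hφ hψ j₀).symm.trans (jetChartOf hφ' hψ' j₁)).source := by
  rw [jetChartOf_trans_source]
  have mem : ∀ z ∈ {z : JetModel r E E' | z.1 ∈ (φ.symm.trans φ').source ∧
        taylorPoly z.2 0 ∈ (ψ.symm.trans ψ').source},
      (z.1 ∈ φ.target ∧ φ.symm z.1 ∈ φ'.source) ∧
        (taylorPoly z.2 0 ∈ ψ.target ∧ ψ.symm (taylorPoly z.2 0) ∈ ψ'.source) := by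
    intro z hz
    simpa using hz
  let G : JetModel r E E' → E → E' := fun z w =>
    ψ' (ψ.symm (taylorPoly z.2 (φ (φ'.symm w) - z.1)))
  have heq : EqOn ((jetChartOf hφ hψ j₀).symm.trans (jetChartOf hφ' hψ' j₁))
      (fun z => ((φ' (φ.symm z.1), fun k : Fin (r + 1) => symmetrize (k : ℕ)
        (iteratedFDeriv ℝ k (G z) (φ' (φ.symm z.1)))) : JetModel r E E'))
      {z : JetModel r E E' | z.1 ∈ (φ.symm.trans φ').source ∧
        taylorPoly z.2 0 ∈ (ψ.symm.trans ψ').source} := by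
    intro z hz
    obtain ⟨⟨h1, h2⟩, h3, h4⟩ := mem z hz
    have hz : z ∈ jetTarget r φ ψ := ⟨h1, h3⟩
    have key : (jetChartOf hφ hψ j₀).symm z =
      Jet.mk r ⟨φ.symm z.1, polyMap φ ψ z, smoothNear_polyMap hφ hψ hz⟩ := dif_pos hz
    change jetCoord φ' ψ' ((jetChartOf hφ hψ j₀).symm z) = _
    rw [key, jetCoord_mk hφ' hψ' _ h2 (by simpa only [polyMap_apply hz] using h4)]
    rfl
  refine ContDiffOn.congr (fun z hz => ContDiffAt.contDiffWithinAt ?_) heq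
  obtain ⟨⟨h1, h2⟩, h3, h4⟩ := mem z hz
  have hχ : ContDiffAt ℝ ∞ (fun z : JetModel r E E' => φ' (φ.symm z.1)) z :=
    ContDiffAt.comp (f := Prod.fst) (g := fun v => φ' (φ.symm v)) z
      (contDiffAt_transition hφ hφ' h1 h2) contDiffAt_fst
  have e0 : φ'.symm (φ' (φ.symm z.1)) = φ.symm z.1 := φ'.left_inv h2
  have e1 : φ (φ'.symm (φ' (φ.symm z.1))) - z.1 = 0 := by
    rw [e0, φ.right_inv h1, sub_self]
  have hχ' : ContDiffAt ℝ ∞ (fun w => φ (φ'.symm w)) (φ' (φ.symm z.1)) :=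
    contDiffAt_transition hφ' hφ (φ'.map_source h2) (by rw [e0]; exact φ.map_target h1)
  have hG : ContDiffAt ℝ ∞ (Function.uncurry G) (z, φ' (φ.symm z.1)) := by
    have a1 : ContDiffAt ℝ ∞ (fun q : JetModel r E E' × E => φ (φ'.symm q.2) - q.1.1)
        (z, φ' (φ.symm z.1)) :=
      (ContDiffAt.comp (f := Prod.snd) (g := fun w => φ (φ'.symm w)) (z, φ' (φ.symm z.1))
        hχ' contDiffAt_snd).sub (contDiffAt_fst.fst)
    have a2 : ContDiffAt ℝ ∞ (fun q : JetModel r E E' × E =>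
        taylorPoly q.1.2 (φ (φ'.symm q.2) - q.1.1)) (z, φ' (φ.symm z.1)) :=
      ContDiffAt.comp (f := fun q : JetModel r E E' × E => (q.1.2, φ (φ'.symm q.2) - q.1.1))
        (z, φ' (φ.symm z.1)) contDiff_taylorPoly.contDiffAt
        ((contDiffAt_fst.snd).prodMk a1)
    refine ContDiffAt.comp (f := fun q : JetModel r E E' × E =>
        taylorPoly q.1.2 (φ (φ'.symm q.2) - q.1.1)) (g := fun v => ψ' (ψ.symm v))
        (z, φ' (φ.symm z.1)) ?_ a2
    simp only [e1]
    exact contDiffAt_transition hψ hψ' h3 h4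
  refine hχ.prodMk (contDiffAt_pi.2 fun k => ?_)
  have h5 : ContDiffAt ℝ ∞ (fun z : JetModel r E E' =>
      iteratedFDeriv ℝ k (G z) (φ' (φ.symm z.1))) z :=
    ContDiffAt.comp (f := fun z : JetModel r E E' => (z, φ' (φ.symm z.1)))
      (g := fun q : JetModel r E E' × E => iteratedFDeriv ℝ k (G q.1) q.2) z
      (contDiffAt_iteratedFDeriv_param hG k) (contDiffAt_id.prodMk hχ)
  exact (contDiff_symmetrize (k : ℕ)).contDiffAt.comp z h5

variable (E E' X Y) in
/-- The charts on the space of jets that come from the preferred charts of the two manifolds. -/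
def jetCore (r : ℕ) : ChartedSpaceCore (JetModel r E E') (Jet E E' X Y r) where
  atlas := Set.range fun j : Jet E E' X Y r =>
    jetChartOf (chart_mem_atlas E j.source) (chart_mem_atlas E' j.target) j
  chartAt j := jetChartOf (chart_mem_atlas E j.source) (chart_mem_atlas E' j.target) j
  mem_chart_source j := ⟨mem_chart_source E j.source, mem_chart_source E' j.target⟩
  chart_mem_atlas j := ⟨j, rfl⟩
  open_source := by
    rintro _ _ ⟨j, rfl⟩ ⟨j', rfl⟩
    exact isOpen_jetChartOf _ _ _ _ _ _
  continuousOn_toFun := by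
    rintro _ _ ⟨j, rfl⟩ ⟨j', rfl⟩
    exact (contDiffOn_jetChartOf _ _ _ _ _ _).continuousOn

instance (r : ℕ) : TopologicalSpace (Jet E E' X Y r) := (jetCore E E' X Y r).toTopologicalSpace

instance (r : ℕ) : ChartedSpace (JetModel r E E') (Jet E E' X Y r) :=
  (jetCore E E' X Y r).toChartedSpace

/-- The space of `r`-jets is a smooth manifold. -/
instance (r : ℕ) : IsManifold 𝓘(ℝ, JetModel r E E') ∞ (Jet E E' X Y r) := by
  apply isManifold_of_contDiffOn
  intro e e' he he'
  obtain ⟨_, ⟨c, rfl⟩, he⟩ := he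
  obtain ⟨_, ⟨⟨j, rfl⟩, rfl⟩, he⟩ := he
  obtain ⟨_, ⟨c', rfl⟩, he'⟩ := he'
  obtain ⟨_, ⟨⟨j', rfl⟩, rfl⟩, he'⟩ := he'
  rw [mem_singleton_iff] at he he'
  subst he he'
  have h := contDiffOn_jetChartOf (chart_mem_atlas E j.source) (chart_mem_atlas E' j.target)
    (chart_mem_atlas E j'.source) (chart_mem_atlas E' j'.target) j j'
  simp only [modelWithCornersSelf_coe, modelWithCornersSelf_coe_symm, range_id, inter_univ,
    preimage_id, Function.id_comp, Function.comp_id]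
  exact h

end Charts

end Jets

section JetGroupoids

variable (E E' : Type*) [NormedAddCommGroup E] [NormedSpace ℝ E]
  [NormedAddCommGroup E'] [NormedSpace ℝ E']
  {X Y : Type*} [TopologicalSpace X] [ChartedSpace E X] [TopologicalSpace Y] [ChartedSpace E' Y]

open Classical in
/-- The `r`-jet `j_x^r f` of a map `f` that is smooth near `x`. If `f` is not smooth near `x` the
value is irrelevant (it is the jet of a constant map). -/
def jet (r : ℕ) (f : X → Y) (x : X) : Jet E E' X Y r :=
  if h : SmoothNear E E' f x then Jet.mk r ⟨x, f, h⟩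
  else Jet.mk r ⟨x, fun _ => f x, Eventually.of_forall fun _ => contMDiffAt_const⟩

variable {E E'}

theorem jet_of_smoothNear {r : ℕ} {f : X → Y} {x : X} (h : SmoothNear E E' f x) :
    jet E E' r f x = Jet.mk r ⟨x, f, h⟩ := dif_pos h

theorem Jet.eq_jet_rep {r : ℕ} (j : Jet E E' X Y r) : j = jet E E' r j.rep.map j.source := by
  have h : SmoothNear E E' j.rep.map j.source := by
    simpa using j.rep.smooth
  conv_lhs => rw [← Jet.mk_rep j]
  rw [jet_of_smoothNear h, Jet.mk_eq_mk]
  exact ⟨by simp, by simp, fun k _ => by simp⟩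

/-- Composition of jets. It is meaningful if the source of `a` is the target of `b`; then it does
not depend on the representatives, see `Jet.comp_jet`. -/
def Jet.comp {E'' W : Type*} [NormedAddCommGroup E''] [NormedSpace ℝ E''] [TopologicalSpace W]
    [ChartedSpace E'' W] {r : ℕ} (a : Jet E' E'' Y W r) (b : Jet E E' X Y r) :
    Jet E E'' X W r :=
  jet E E'' r (a.rep.map ∘ b.rep.map) b.source

theorem SmoothNear.comp {E'' W : Type*} [NormedAddCommGroup E''] [NormedSpace ℝ E'']
    [TopologicalSpace W] [ChartedSpace E'' W] {g : Y → W} {f : X → Y} {x : X}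
    (hg : SmoothNear E' E'' g (f x)) (hf : SmoothNear E E' f x) :
    SmoothNear E E'' (g ∘ f) x := by
  filter_upwards [hf, hf.self_of_nhds.continuousAt.eventually hg] with y h1 h2
  exact ContMDiffAt.comp y h2 h1

/-- Jets are composed by composing representatives. -/
theorem Jet.comp_jet {E'' W : Type*} [NormedAddCommGroup E''] [NormedSpace ℝ E'']
    [TopologicalSpace W] [ChartedSpace E'' W] [IsManifold 𝓘(ℝ, E) ∞ X] [IsManifold 𝓘(ℝ, E') ∞ Y]
    [IsManifold 𝓘(ℝ, E'') ∞ W] {r : ℕ} {g : Y → W} {f : X → Y} {x : X}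
    (hg : SmoothNear E' E'' g (f x)) (hf : SmoothNear E E' f x) :
    (jet E' E'' r g (f x)).comp (jet E E' r f x) = jet E E'' r (g ∘ f) x := by
  rw [jet_of_smoothNear hg, jet_of_smoothNear hf, Jet.comp, jet_of_smoothNear (hg.comp hf)]
  generalize hb : (Jet.mk r (⟨x, f, hf⟩ : LocalMap E E' X Y)).rep = b
  generalize ha : (Jet.mk r (⟨f x, g, hg⟩ : LocalMap E' E'' Y W)).rep = a
  have sb : SameJet r ⟨x, f, hf⟩ b := by rw [← Jet.mk_eq_mk, ← hb, Jet.mk_rep]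
  have sa : SameJet r ⟨f x, g, hg⟩ a := by rw [← Jet.mk_eq_mk, ← ha, Jet.mk_rep]
  obtain ⟨x', f', hf'⟩ := b
  obtain ⟨y', g', hg'⟩ := a
  obtain ⟨rfl, h2, h3⟩ := sb
  obtain ⟨h1', h2', h3'⟩ := sa
  dsimp only at h2 h3 h1' h2' h3'
  subst h1'
  change jet E E'' r (g' ∘ f') x = _
  have hg'f : SmoothNear E' E'' g' (f' x) := h2 ▸ hg'
  rw [jet_of_smoothNear (hg'f.comp hf'), Jet.mk_eq_mk]
  refine ⟨rfl, by simp [← h2, h2'], ?_⟩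
  rw [← h2] at h3
  rw [← h2'] at h3'
  intro k hk
  simp only [Function.comp_apply, ← h2, ← h2']
  have e : ∀ (u : X → Y) (v : Y → W), ContinuousAt u x → u x = f x →
      localRep (chartAt E x) (chartAt E'' (g (f x))) (v ∘ u) =ᶠ[𝓝 (chartAt E x x)]
        localRep (chartAt E' (f x)) (chartAt E'' (g (f x))) v ∘
          localRep (chartAt E x) (chartAt E' (f x)) u := by
    intro u v hu hux
    have hc : ContinuousAt (chartAt E x).symm (chartAt E x x) :=
      (chartAt E x).continuousAt_symm ((chartAt E x).map_source (mem_chart_source E x))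
    have : ∀ᶠ w in 𝓝 (chartAt E x x), u ((chartAt E x).symm w) ∈ (chartAt E' (f x)).source := by
      apply hc.eventually (p := fun z => u z ∈ (chartAt E' (f x)).source)
      rw [(chartAt E x).left_inv (mem_chart_source E x)]
      apply hu.eventually ((chartAt E' (f x)).open_source.mem_nhds _)
      rw [hux]
      exact mem_chart_source E' (f x)
    filter_upwards [this] with w hw
    simp [localRep, (chartAt E' (f x)).left_inv hw]
  rw [((e f' g' hf'.self_of_nhds.continuousAt h2.symm).iteratedFDeriv ℝ k).eq_of_nhds,
    ((e f g hf.self_of_nhds.continuousAt rfl).iteratedFDeriv ℝ k).eq_of_nhds]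
  have x0 : (chartAt E x).symm (chartAt E x x) = x :=
    (chartAt E x).left_inv (mem_chart_source E x)
  have y0 : (chartAt E' (f x)).symm (chartAt E' (f x) (f x)) = f x :=
    (chartAt E' (f x)).left_inv (mem_chart_source E' (f x))
  have v1 : localRep (chartAt E x) (chartAt E' (f x)) f' (chartAt E x x) =
      chartAt E' (f x) (f x) := by rw [localRep, x0, ← h2]
  have v2 : localRep (chartAt E x) (chartAt E' (f x)) f (chartAt E x x) =
      chartAt E' (f x) (f x) := by rw [localRep, x0]
  have mx := (chartAt E x).map_source (mem_chart_source E x)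
  have my := (chartAt E' (f x)).map_source (mem_chart_source E' (f x))
  have s1 := contDiffAt_localRep (chart_mem_atlas E x) (chart_mem_atlas E' (f x)) (f := f') mx
    (by rw [x0]; exact hf'.self_of_nhds) (by rw [x0, ← h2]; exact mem_chart_source E' (f x))
  have s2 := contDiffAt_localRep (chart_mem_atlas E x) (chart_mem_atlas E' (f x)) (f := f) mx
    (by rw [x0]; exact hf.self_of_nhds) (by rw [x0]; exact mem_chart_source E' (f x))
  have s3 := contDiffAt_localRep (chart_mem_atlas E' (f x)) (chart_mem_atlas E'' (g (f x)))
    (f := g') my (by rw [y0]; exact hg'.self_of_nhds)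
    (by rw [y0, ← h2']; exact mem_chart_source E'' (g (f x)))
  have s4 := contDiffAt_localRep (chart_mem_atlas E' (f x)) (chart_mem_atlas E'' (g (f x)))
    (f := g) my (by rw [y0]; exact hg.self_of_nhds)
    (by rw [y0]; exact mem_chart_source E'' (g (f x)))
  exact iteratedFDeriv_comp_congr s1 s2 (by rwa [v1]) (by rwa [v1]) (v1.trans v2.symm)
    (fun k hk => (h3 k hk).symm) (fun k hk => by rw [v1]; exact (h3' k hk).symm) k hk

variable (E X) in
/-- The full jet groupoid `Π_q` of `X`: the set of invertible `q`-jets, that is, the `q`-jets of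
local diffeomorphisms of `X`, as a subset of the manifold `J_q(X × X)`. Its source and target maps
are `Jet.source` and `Jet.target`, its multiplication is `Jet.comp`, its units are the jets of the
identity map. -/
def fullJetGroupoid (q : ℕ) : Set (Jet E E X X q) :=
  {g | ∃ (f : X → X) (x : X), IsLocalDiffeomorphAt 𝓘(ℝ, E) 𝓘(ℝ, E) ∞ f x ∧ g = jet E E q f x}

end JetGroupoids

section NaturalBundles

variable (E EM : Type*) [NormedAddCommGroup E] [NormedSpace ℝ E]
  [NormedAddCommGroup EM] [NormedSpace ℝ EM]
  {X : Type*} {M : Type u} [TopologicalSpace X] [ChartedSpace E X]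
  [TopologicalSpace M] [ChartedSpace EM M]

/-- The subset `S` of the manifold `M` is, with the projection `p`, a smooth fibre bundle over `X`
whose typical fibre is a finite-dimensional manifold `F`. Over a neighbourhood `U` of each point
there is a trivialization: a smooth map `Φ` on the part of `S` over `U` (the fibre component) and
a smooth map `Ψ` on `U × F` such that `u ↦ (p u, Φ u)` and `Ψ` are inverse to each other. In
particular `S` is an embedded submanifold of `M`, and smoothness of maps on `S` in the sense of
`ContMDiffOn` is smoothness for its manifold structure. For `S = univ` this is the usual notion of
a smooth fibre bundle with total space `M`. -/
structure IsSmoothFiberBundle (p : M → X) (S : Set M) : Prop where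
  contMDiffOn_proj : ContMDiffOn 𝓘(ℝ, EM) 𝓘(ℝ, E) ∞ p S
  locally_trivial : ∃ (V : Type) (_ : NormedAddCommGroup V) (_ : NormedSpace ℝ V)
    (_ : FiniteDimensional ℝ V) (F : Type u) (_ : TopologicalSpace F) (_ : ChartedSpace V F)
    (_ : IsManifold 𝓘(ℝ, V) ∞ F),
    ∀ x : X, ∃ U : Set X, IsOpen U ∧ x ∈ U ∧ ∃ (Φ : M → F) (Ψ : X × F → M),
      ContMDiffOn 𝓘(ℝ, EM) 𝓘(ℝ, V) ∞ Φ (S ∩ p ⁻¹' U) ∧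
      ContMDiffOn (𝓘(ℝ, E).prod 𝓘(ℝ, V)) 𝓘(ℝ, EM) ∞ Ψ (U ×ˢ univ) ∧
      (∀ y ∈ U, ∀ c : F, Ψ (y, c) ∈ S ∧ p (Ψ (y, c)) = y ∧ Φ (Ψ (y, c)) = c) ∧
      (∀ u ∈ S, p u ∈ U → Ψ (p u, Φ u) = u)

/-- `act` is a smooth right action of the groupoid `Π_q` on the bundle `p : S → X`. The product
`act u g` is relevant only for `u ∈ S` and `g ∈ Π_q` with `p u = t(g)`. -/
structure IsGroupoidAction [IsManifold 𝓘(ℝ, E) ∞ X] (q : ℕ) (p : M → X) (S : Set M)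
    (act : M → Jet E E X X q → M) : Prop where
  contMDiffOn_act : ContMDiffOn (𝓘(ℝ, EM).prod 𝓘(ℝ, JetModel q E E)) 𝓘(ℝ, EM) ∞
    (fun w : M × Jet E E X X q => act w.1 w.2)
    {w | w.1 ∈ S ∧ w.2 ∈ fullJetGroupoid E X q ∧ p w.1 = w.2.target}
  act_mem : ∀ u ∈ S, ∀ g ∈ fullJetGroupoid E X q, p u = g.target →
    act u g ∈ S ∧ p (act u g) = g.source
  act_one : ∀ u ∈ S, act u (jet E E q id (p u)) = u
  act_comp : ∀ u ∈ S, ∀ a ∈ fullJetGroupoid E X q, ∀ b ∈ fullJetGroupoid E X q,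
    p u = a.target → a.source = b.target → act u (a.comp b) = act (act u a) b

/-- A natural bundle of order `q` over `X`: a smooth fibre bundle with an action of `Π_q`. -/
structure IsNaturalBundle [IsManifold 𝓘(ℝ, E) ∞ X] (q : ℕ) (p : M → X) (S : Set M)
    (act : M → Jet E E X X q → M) : Prop where
  isSmoothFiberBundle : IsSmoothFiberBundle E EM p S
  isGroupoidAction : IsGroupoidAction E EM q p S act

/-- A smooth section of the bundle `p : S → X`. -/
structure IsSmoothSection (p : M → X) (S : Set M) (ω₀ : X → M) : Prop where
  contMDiff : ContMDiff 𝓘(ℝ, E) 𝓘(ℝ, EM) ∞ ω₀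
  mem : ∀ x, ω₀ x ∈ S
  proj : ∀ x, p (ω₀ x) = x

variable {E EM}

/-- The fibres of `p : S → X` are homogeneous spaces: for each `y`, the isotropy group
`Π_q(y, y) ≅ GL_q` acts transitively on the fibre over `y`. -/
def HasHomogeneousFibers {q : ℕ} (p : M → X) (S : Set M) (act : M → Jet E E X X q → M) : Prop :=
  ∀ u ∈ S, ∀ v ∈ S, p u = p v →
    ∃ g ∈ fullJetGroupoid E X q, g.source = p u ∧ g.target = p u ∧ act u g = v

/-- The symmetry groupoid of a section `ω₀` of a natural bundle of order `q`: the set of those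
`g : x → y` in `Π_q` that satisfy `ω₀(y) g = ω₀(x)`. -/
def symmetryGroupoid {q : ℕ} (act : M → Jet E E X X q → M) (ω₀ : X → M) : Set (Jet E E X X q) :=
  {g | g ∈ fullJetGroupoid E X q ∧ act (ω₀ g.target) g = ω₀ g.source}

/-- The bundle `J_r(S)`: the `r`-jets of local smooth sections of `p : S → X`, as a subset of the
manifold of `r`-jets of maps `X → M`. Its projection to `X` is `Jet.source`. -/
def jetBundle (r : ℕ) (p : M → X) (S : Set M) : Set (Jet E EM X M r) :=
  {j | ∃ (σ : X → M) (x : X), SmoothNear E EM σ x ∧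
    (∀ᶠ y in 𝓝 x, σ y ∈ S ∧ p (σ y) = y) ∧ j = jet E EM r σ x}

/-- The `r`-th prolongation `J_r(R) ∩ J_{q+r}(X × X)` of a system `R ⊆ J_q(X × X)`. Here
`J_{q+r}(X × X)` is embedded in `J_r(J_q(X × X))` by `j_x^{q+r} f ↦ j_x^r (j^q f)`. -/
def prolongation {q : ℕ} [IsManifold 𝓘(ℝ, E) ∞ X] (r : ℕ) (R : Set (Jet E E X X q)) :
    Set (Jet E E X X (q + r)) :=
  {g | ∃ (f : X → X) (x : X), SmoothNear E E f x ∧ g = jet E E (q + r) f x ∧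
    jet E (JetModel q E E) r (fun y => jet E E q f y) x ∈ jetBundle r Jet.source R}

/-- `act'` is the operation of `Π_{q+r}` on `J_r(M)` induced by the operation `act` of `Π_q` on
the bundle `p : M → X`: one has `(j_y^r σ) (j_x^{q+r} f) = j_x^r (z ↦ σ(f(z)) (j_z^q f))` for all
local sections `σ` of `M` and all `f` with invertible jet and `f(x) = y`. -/
def IsInducedAction {q : ℕ} (r : ℕ) (p : M → X) (act : M → Jet E E X X q → M)
    (act' : Jet E EM X M r → Jet E E X X (q + r) → Jet E EM X M r) : Prop :=
  ∀ (σ : X → M) (f : X → X) (x : X), SmoothNear E E f x →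
    jet E E (q + r) f x ∈ fullJetGroupoid E X (q + r) →
    SmoothNear E EM σ (f x) → (∀ᶠ y in 𝓝 (f x), p (σ y) = y) →
    act' (jet E EM r σ (f x)) (jet E E (q + r) f x) =
      jet E EM r (fun z => act (σ (f z)) (jet E E q f z)) x

end NaturalBundles

end JetBundles

end

/-! The product `(j^r σ)(j^{q+r} f)` is well defined by the chain rule. In charts the coordinates of
`j_z^q f` are derivatives of `f` of order at most `q`, so the `r`-jet of `z ↦ j_z^q f` depends only
on `j^{q+r} f` (`jet_jet_congr`), and the `r`-jet of a smooth expression in several maps depends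
only on their `r`-jets (`jet_family_congr`). The action is defined only on the fibre product of
pairs `(u, g)` with `π u = t(g)`; a trivialization of the bundle extends it locally to a smooth map
on an open set (`exists_act_extension`), to which the chain rule applies. Smoothness of the induced
action follows by representing nearby jets by polynomial maps depending smoothly on the jet
(`exists_smooth_representatives`) and by the fact that jets of smooth families form smooth families
(`smoothAround_jet`). A trivialization of the bundle with fibre `F` and a chart of the base
trivialize the jet bundle, with the jets at the origin of maps `E → F` as typical fibre.

For the symmetry groupoid, put `β(z) = ω(f(z)) j_z^q f`; then `j_x^{q+r} f` preserves `j_r(ω)`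
exactly if `β` and `ω` have the same `r`-jet at `x`. If `z ↦ j_z^q f` agrees to order `r` with a
local section of the symmetry groupoid, applying the smooth map `h ↦ ω(t(h)) h` to both shows that
`β` agrees with `ω` to order `r`. This inclusion does not need homogeneous fibres.

For the converse, homogeneity provides isotropy jets `c(z, u, v)` at `z`, smooth in all variables,
with `u c(z, u, v) = v` and `c(z, u, u) = 1` for `u`, `v` in the fibre over `z`
(`exists_smooth_isotropy`). Then `τ(z) = (j_z^q f) c(z, β(z), ω(z))` satisfies `ω(f(z)) τ(z) =
ω(z)`, so it is a local section of the symmetry groupoid. Since `β` and `ω` agree to order `r` at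
`x`, the section `τ` agrees to order `r` with `(j_z^q f) c(z, ω(z), ω(z)) = j_z^q f`.

The jets `c` come from the implicit function theorem, once the orbit map of the isotropy group on a
fibre is known to be a submersion. By equivariance this map has constant rank. If the rank were
smaller than the dimension of the fibre, the image would be locally, hence globally, a null set; but
transitivity makes the image contain a chart domain.

For `q ≥ 1` a `q`-jet contains the first derivative, so by the inverse function theorem its
invertibility already makes `f` a local diffeomorphism. This gives the last inclusion. -/

noncomputable section

namespace JetBundles

/-! ### Maps that are smooth in a neighbourhood of a point. -/

section SmoothAround

variable {E₁ H₁ E₂ H₂ E₃ H₃ : Type*}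
  [NormedAddCommGroup E₁] [NormedSpace ℝ E₁] [TopologicalSpace H₁]
  [NormedAddCommGroup E₂] [NormedSpace ℝ E₂] [TopologicalSpace H₂]
  [NormedAddCommGroup E₃] [NormedSpace ℝ E₃] [TopologicalSpace H₃]
  {I₁ : ModelWithCorners ℝ E₁ H₁} {I₂ : ModelWithCorners ℝ E₂ H₂} {I₃ : ModelWithCorners ℝ E₃ H₃}
  {M₁ M₂ M₃ : Type*} [TopologicalSpace M₁] [ChartedSpace H₁ M₁]
  [TopologicalSpace M₂] [ChartedSpace H₂ M₂] [TopologicalSpace M₃] [ChartedSpace H₃ M₃]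

variable (I₁ I₂) in
/-- `f` is smooth in a neighbourhood of `x`. This is `SmoothNear` for arbitrary model spaces. -/
def SmoothAround (f : M₁ → M₂) (x : M₁) : Prop := ∀ᶠ y in 𝓝 x, ContMDiffAt I₁ I₂ ∞ f y

namespace SmoothAround

theorem contMDiffAt {f : M₁ → M₂} {x : M₁} (hf : SmoothAround I₁ I₂ f x) :
    ContMDiffAt I₁ I₂ ∞ f x := hf.self_of_nhds

theorem continuousAt {f : M₁ → M₂} {x : M₁} (hf : SmoothAround I₁ I₂ f x) :
    ContinuousAt f x := hf.contMDiffAt.continuousAt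

/-- `ContMDiffAt` at order `∞` lacks this property: the neighbourhood on which the map is `C^n` may
shrink as `n` grows. -/
theorem eventually {f : M₁ → M₂} {x : M₁} (hf : SmoothAround I₁ I₂ f x) :
    ∀ᶠ y in 𝓝 x, SmoothAround I₁ I₂ f y := eventually_eventually_nhds.2 hf

theorem comp_of_eq {g : M₂ → M₃} {f : M₁ → M₂} {x : M₁} {y : M₂} (hg : SmoothAround I₂ I₃ g y)
    (hf : SmoothAround I₁ I₂ f x) (h : f x = y) : SmoothAround I₁ I₃ (fun z => g (f z)) x := by
  subst h
  filter_upwards [hf, hf.continuousAt.eventually hg] with z h1 h2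
  exact ContMDiffAt.comp z h2 h1

theorem comp {g : M₂ → M₃} {f : M₁ → M₂} {x : M₁} (hg : SmoothAround I₂ I₃ g (f x))
    (hf : SmoothAround I₁ I₂ f x) : SmoothAround I₁ I₃ (fun z => g (f z)) x :=
  hg.comp_of_eq hf rfl

theorem prodMk {f : M₁ → M₂} {g : M₁ → M₃} {x : M₁} (hf : SmoothAround I₁ I₂ f x)
    (hg : SmoothAround I₁ I₃ g x) : SmoothAround I₁ (I₂.prod I₃) (fun z => (f z, g z)) x := by
  filter_upwards [hf, hg] with z h1 h2
  exact h1.prodMk h2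

theorem prodMk_space {f : M₁ → E₂} {g : M₁ → E₃} {x : M₁} (hf : SmoothAround I₁ 𝓘(ℝ, E₂) f x)
    (hg : SmoothAround I₁ 𝓘(ℝ, E₃) g x) :
    SmoothAround I₁ 𝓘(ℝ, E₂ × E₃) (fun z => (f z, g z)) x := by
  filter_upwards [hf, hg] with z h1 h2
  exact h1.prodMk_space h2

theorem _root_.ContDiff.smoothAround {f : E₁ → E₂} (hf : ContDiff ℝ ∞ f) (x : E₁) :
    SmoothAround 𝓘(ℝ, E₁) 𝓘(ℝ, E₂) f x := Eventually.of_forall hf.contMDiff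

theorem congr {f g : M₁ → M₂} {x : M₁} (hf : SmoothAround I₁ I₂ f x) (h : g =ᶠ[𝓝 x] f) :
    SmoothAround I₁ I₂ g x := by
  filter_upwards [hf, h.eventually_nhds] with z h1 h2
  exact h1.congr_of_eventuallyEq h2

theorem of_contMDiff {f : M₁ → M₂} (hf : ContMDiff I₁ I₂ ∞ f) (x : M₁) : SmoothAround I₁ I₂ f x :=
  Eventually.of_forall hf

theorem of_contMDiffOn {f : M₁ → M₂} {s : Set M₁} {x : M₁} (hf : ContMDiffOn I₁ I₂ ∞ f s)
    (hs : s ∈ 𝓝 x) : SmoothAround I₁ I₂ f x := by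
  filter_upwards [eventually_mem_nhds_iff.2 hs] with y hy
  exact hf.contMDiffAt hy

theorem id (x : M₁) : SmoothAround I₁ I₁ (fun y => y) x := of_contMDiff contMDiff_id x

theorem const (c : M₂) (x : M₁) : SmoothAround I₁ I₂ (fun _ => c) x := of_contMDiff contMDiff_const x

theorem fst (x : M₁ × M₂) : SmoothAround (I₁.prod I₂) I₁ Prod.fst x := of_contMDiff contMDiff_fst x

theorem snd (x : M₁ × M₂) : SmoothAround (I₁.prod I₂) I₂ Prod.snd x := of_contMDiff contMDiff_snd x

theorem left {f : M₁ → M₂ → M₃} {x : M₁} {y : M₂}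
    (hf : SmoothAround (I₁.prod I₂) I₃ (fun w : M₁ × M₂ => f w.1 w.2) (x, y)) :
    SmoothAround I₂ I₃ (f x) y :=
  SmoothAround.comp (g := fun w : M₁ × M₂ => f w.1 w.2) (f := fun z => (x, z)) hf
    ((const x y).prodMk (id y))

/-- A map that is smooth on a set `s` becomes smooth when composed with a map into `s`. -/
theorem contMDiffOn_comp {g : M₂ → M₃} {s : Set M₂} (hg : ContMDiffOn I₂ I₃ ∞ g s) {f : M₁ → M₂}
    {x : M₁} (hf : SmoothAround I₁ I₂ f x) (hs : ∀ᶠ y in 𝓝 x, f y ∈ s) :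
    SmoothAround I₁ I₃ (fun z => g (f z)) x := by
  filter_upwards [hf, hs.eventually_nhds] with z h1 h2
  have h3 : ContMDiffWithinAt I₁ I₃ ∞ (g ∘ f) (f ⁻¹' s) z :=
    (hg (f z) h2.self_of_nhds).comp z h1.contMDiffWithinAt fun _ hy => hy
  exact h3.contMDiffAt h2

end SmoothAround

end SmoothAround

/-! ### Agreement of derivatives up to a given order. -/

section EqToOrder

variable {E V W : Type*} [NormedAddCommGroup E] [NormedSpace ℝ E]
  [NormedAddCommGroup V] [NormedSpace ℝ V] [NormedAddCommGroup W] [NormedSpace ℝ W]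

/-- The derivatives of two maps at a point agree up to order `n`. -/
def EqToOrder (n : ℕ) (F G : E → V) (x : E) : Prop :=
  ∀ k ≤ n, iteratedFDeriv ℝ k F x = iteratedFDeriv ℝ k G x

namespace EqToOrder

variable {n : ℕ} {F G : E → V} {x : E}

theorem eq (h : EqToOrder n F G x) : F x = G x := by
  simpa using congrArg (fun m => m (fun _ => 0)) (h 0 (Nat.zero_le n))

theorem mono (h : EqToOrder n F G x) {m : ℕ} (hm : m ≤ n) : EqToOrder m F G x :=
  fun k hk => h k (hk.trans hm)

theorem congr {F' G' : E → V} (h : EqToOrder n F G x) (hF : F' =ᶠ[𝓝 x] F) (hG : G' =ᶠ[𝓝 x] G) :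
    EqToOrder n F' G' x := fun k hk => by
  rw [(hF.iteratedFDeriv ℝ k).eq_of_nhds, (hG.iteratedFDeriv ℝ k).eq_of_nhds, h k hk]

theorem prodMk {F' G' : E → W} (h : EqToOrder n F G x) (h' : EqToOrder n F' G' x)
    (hF : ContDiffAt ℝ ∞ F x) (hG : ContDiffAt ℝ ∞ G x) (hF' : ContDiffAt ℝ ∞ F' x)
    (hG' : ContDiffAt ℝ ∞ G' x) :
    EqToOrder n (fun v => (F v, F' v)) (fun v => (G v, G' v)) x := fun k hk => by
  rw [iteratedFDeriv_prodMk hF hF' (by exact_mod_cast le_top),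
    iteratedFDeriv_prodMk hG hG' (by exact_mod_cast le_top), h k hk, h' k hk]

theorem comp {H : V → W} (h : EqToOrder n F G x) (hF : ContDiffAt ℝ ∞ F x)
    (hG : ContDiffAt ℝ ∞ G x) (hH : ContDiffAt ℝ ∞ H (F x)) :
    EqToOrder n (fun v => H (F v)) (fun v => H (G v)) x :=
  iteratedFDeriv_comp_congr hF hG hH hH h.eq h fun _ _ => rfl

/-- Derivatives commute with continuous linear maps, so a separating family of such maps detects
equality of derivatives. It serves for the projections of the product of spaces of symmetric maps.
-/
theorem of_clm {ι : Type*} {V' : ι → Type*} [∀ i, NormedAddCommGroup (V' i)]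
    [∀ i, NormedSpace ℝ (V' i)] (L : ∀ i, V →L[ℝ] V' i)
    (hL : ∀ v w, (∀ i, L i v = L i w) → v = w) (hF : ContDiffAt ℝ ∞ F x)
    (hG : ContDiffAt ℝ ∞ G x) (h : ∀ i, EqToOrder n (L i ∘ F) (L i ∘ G) x) :
    EqToOrder n F G x := fun k hk => by
  ext v
  apply hL
  intro i
  have h1 := h i k hk
  rw [(L i).iteratedFDeriv_comp_left hF (by exact_mod_cast le_top),
    (L i).iteratedFDeriv_comp_left hG (by exact_mod_cast le_top)] at h1
  exact congrArg (fun m => m v) h1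

theorem linearIsometryEquiv_comp (L : V ≃ₗᵢ[ℝ] W) (h : EqToOrder n F G x) :
    EqToOrder n (L ∘ F) (L ∘ G) x := fun k hk => by
  have e : ∀ F : E → V, iteratedFDeriv ℝ k (L ∘ F) x =
      (L : V →L[ℝ] W).compContinuousMultilinearMap (iteratedFDeriv ℝ k F x) := fun F =>
    L.toContinuousLinearEquiv.iteratedFDeriv_comp_left
  rw [e, e, h k hk]

theorem fderiv (h : EqToOrder (n + 1) F G x) : EqToOrder n (fderiv ℝ F) (fderiv ℝ G) x :=
  fun k hk => by
  have h1 := h (k + 1) (by omega)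
  rw [iteratedFDeriv_succ_eq_comp_right, iteratedFDeriv_succ_eq_comp_right] at h1
  exact (LinearIsometryEquiv.injective _) h1

/-- Each derivative uses up one order of agreement. This is the source of the order `q + r`: the
coordinates of `j^q f` are derivatives of order at most `q`. -/
theorem iteratedFDeriv {k : ℕ} (h : EqToOrder (k + n) F G x) :
    EqToOrder n (iteratedFDeriv ℝ k F) (iteratedFDeriv ℝ k G) x := by
  induction k generalizing n with
  | zero =>
    rw [Nat.zero_add] at h
    rw [iteratedFDeriv_zero_eq_comp, iteratedFDeriv_zero_eq_comp]
    exact h.linearIsometryEquiv_comp _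
  | succ k ih =>
    rw [iteratedFDeriv_succ_eq_comp_left, iteratedFDeriv_succ_eq_comp_left]
    exact (ih (n := n + 1) (by rwa [show k + (n + 1) = k + 1 + n by omega])
      ).fderiv.linearIsometryEquiv_comp _

end EqToOrder

end EqToOrder

/-! ### Jets depend on germs, and the chain rule for jets. -/

section JetCalculus

set_option linter.unusedSectionVars false

variable {E E' : Type*} [NormedAddCommGroup E] [NormedSpace ℝ E]
  [NormedAddCommGroup E'] [NormedSpace ℝ E']
  {X Y : Type*} [TopologicalSpace X] [ChartedSpace E X] [TopologicalSpace Y] [ChartedSpace E' Y]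
  {r : ℕ}

@[simp] theorem source_jet (f : X → Y) (x : X) : (jet E E' r f x).source = x := by
  unfold jet; split_ifs <;> rfl

@[simp] theorem target_jet (f : X → Y) (x : X) : (jet E E' r f x).target = f x := by
  unfold jet; split_ifs <;> rfl

theorem jet_congr {f g : X → Y} {x : X} (h : f =ᶠ[𝓝 x] g) :
    jet E E' r f x = jet E E' r g x := by
  have hiff : SmoothNear E E' f x ↔ SmoothNear E E' g x :=
    ⟨fun hf => SmoothAround.congr hf h.symm, fun hg => SmoothAround.congr hg h⟩
  unfold jet
  by_cases hf : SmoothNear E E' f x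
  · rw [dif_pos hf, dif_pos (hiff.1 hf), Jet.mk_eq_mk]
    refine ⟨rfl, h.self_of_nhds, fun k _ => ?_⟩
    dsimp only
    rw [← h.self_of_nhds]
    have hc : ContinuousAt (chartAt E x).symm (chartAt E x x) :=
      (chartAt E x).continuousAt_symm (mem_chart_target E x)
    have h1 : localRep (chartAt E x) (chartAt E' (f x)) f =ᶠ[𝓝 (chartAt E x x)]
        localRep (chartAt E x) (chartAt E' (f x)) g := by
      have := hc.eventually (p := fun z => f z = g z)
        (by rw [(chartAt E x).left_inv (mem_chart_source E x)]; exact h)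
      filter_upwards [this] with v hv
      simp only [localRep, hv]
    exact (h1.iteratedFDeriv ℝ k).eq_of_nhds
  -- Neither map is smooth near `x`, so both jets take the default value, the jet of the constant
  -- map with the common value at `x`.
  · rw [dif_neg hf, dif_neg fun hg => hf (hiff.2 hg)]
    simp only [h.self_of_nhds]

theorem smoothNear_rep (j : Jet E E' X Y r) : SmoothNear E E' j.rep.map j.source := by
  simpa using j.rep.smooth

theorem jet_rep (j : Jet E E' X Y r) : jet E E' r j.rep.map j.source = j := j.eq_jet_rep.symm

theorem jet_rep_jet (f : X → Y) (x : X) :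
    jet E E' r (jet E E' r f x).rep.map x = jet E E' r f x := by
  simpa using jet_rep (jet E E' r f x)

theorem smoothNear_rep_jet (f : X → Y) (x : X) :
    SmoothNear E E' (jet E E' r f x).rep.map x := by
  simpa using smoothNear_rep (jet E E' r f x)

theorem target_eq_of_jet_eq {f g : X → Y} {x : X} (h : jet E E' r f x = jet E E' r g x) :
    f x = g x := by
  simpa using congrArg Jet.target h

section

variable [IsManifold 𝓘(ℝ, E) ∞ X] [IsManifold 𝓘(ℝ, E') ∞ Y]

theorem jet_eq_iff {φ : OpenPartialHomeomorph X E} {ψ : OpenPartialHomeomorph Y E'}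
    (hφ : φ ∈ atlas E X) (hψ : ψ ∈ atlas E' Y) {f g : X → Y} {x : X} (hf : SmoothNear E E' f x)
    (hg : SmoothNear E E' g x) (hx : x ∈ φ.source) (hy : f x ∈ ψ.source) :
    jet E E' r f x = jet E E' r g x ↔
      f x = g x ∧ EqToOrder r (localRep φ ψ f) (localRep φ ψ g) (φ x) := by
  rw [jet_of_smoothNear hf, jet_of_smoothNear hg, Jet.mk_eq_mk, sameJet_iff hφ hψ hx hy]
  exact ⟨fun h => h.2, fun h => ⟨rfl, h⟩⟩

theorem jet_eq_of_le {f g : X → Y} {x : X} {q : ℕ} (hq : q ≤ r) (hf : SmoothNear E E' f x)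
    (hg : SmoothNear E E' g x) (h : jet E E' r f x = jet E E' r g x) :
    jet E E' q f x = jet E E' q g x := by
  rw [jet_eq_iff (chart_mem_atlas E x) (chart_mem_atlas E' (f x)) hf hg (mem_chart_source E x)
    (mem_chart_source E' _)] at h ⊢
  exact ⟨h.1, h.2.mono hq⟩

theorem contDiffAt_localRep_chartAt {f : X → Y} {x : X} (hf : ContMDiffAt 𝓘(ℝ, E) 𝓘(ℝ, E') ∞ f x)
    {y : Y} (hy : f x ∈ (chartAt E' y).source) :
    ContDiffAt ℝ ∞ (localRep (chartAt E x) (chartAt E' y) f) (chartAt E x x) :=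
  contDiffAt_localRep (chart_mem_atlas E x) (chart_mem_atlas E' y) (mem_chart_target E x)
    (by rwa [(chartAt E x).left_inv (mem_chart_source E x)])
    (by rwa [(chartAt E x).left_inv (mem_chart_source E x)])


theorem eventually_symm_chartAt {x : X} {p : X → Prop} (h : ∀ᶠ z in 𝓝 x, p z) :
    ∀ᶠ v in 𝓝 (chartAt E x x), p ((chartAt E x).symm v) := by
  have hc : ContinuousAt (chartAt E x).symm (chartAt E x x) :=
    (chartAt E x).continuousAt_symm (mem_chart_target E x)
  apply hc.eventually
  rwa [(chartAt E x).left_inv (mem_chart_source E x)]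

theorem smoothAround_chartAt {x x' : X} (h : x' ∈ (chartAt E x).source) :
    SmoothAround 𝓘(ℝ, E) 𝓘(ℝ, E) (chartAt E x) x' := by
  filter_upwards [(chartAt E x).open_source.mem_nhds h] with y hy
  exact contMDiffAt_of_mem_maximalAtlas
    (IsManifold.subset_maximalAtlas (chart_mem_atlas E x)) hy

theorem smoothAround_chartAt_symm {x : X} {v : E} (h : v ∈ (chartAt E x).target) :
    SmoothAround 𝓘(ℝ, E) 𝓘(ℝ, E) (chartAt E x).symm v := by
  filter_upwards [(chartAt E x).open_target.mem_nhds h] with y hy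
  exact contMDiffAt_symm_of_mem_maximalAtlas
    (IsManifold.subset_maximalAtlas (chart_mem_atlas E x)) hy

variable {V N E'' W : Type*} [NormedAddCommGroup V] [NormedSpace ℝ V] [TopologicalSpace N]
  [ChartedSpace V N] [IsManifold 𝓘(ℝ, V) ∞ N]
  [NormedAddCommGroup E''] [NormedSpace ℝ E''] [TopologicalSpace W] [ChartedSpace E'' W]
  [IsManifold 𝓘(ℝ, E'') ∞ W]

/-- `Jet.comp_jet` expresses the jet of a composite through the jets of its factors. The point `y`
is kept separate from `f₁ x` because in applications the two are often equal only after a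
computation. -/
theorem jet_comp_congr {g₁ g₂ : Y → W} {f₁ f₂ : X → Y} {x : X} {y : Y} (hy : f₁ x = y)
    (hg₁ : SmoothNear E' E'' g₁ y) (hg₂ : SmoothNear E' E'' g₂ y) (hf₁ : SmoothNear E E' f₁ x)
    (hf₂ : SmoothNear E E' f₂ x) (hg : jet E' E'' r g₁ y = jet E' E'' r g₂ y)
    (hf : jet E E' r f₁ x = jet E E' r f₂ x) :
    jet E E'' r (fun z => g₁ (f₁ z)) x = jet E E'' r (fun z => g₂ (f₂ z)) x := by
  subst hy
  have h := target_eq_of_jet_eq hf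
  have e1 := Jet.comp_jet (r := r) hg₁ hf₁
  have e2 := Jet.comp_jet (r := r) (h ▸ hg₂) hf₂
  refine e1.symm.trans (Eq.trans ?_ e2)
  rw [hg, hf, h]

/-- The jet of a map built smoothly from two others depends only on their jets. -/
theorem jet_family_congr {H : X × Y × N → W} {f₁ f₂ : X → Y} {g₁ g₂ : X → N} {x : X}
    (hf₁ : SmoothNear E E' f₁ x) (hf₂ : SmoothNear E E' f₂ x)
    (hg₁ : SmoothNear E V g₁ x) (hg₂ : SmoothNear E V g₂ x)
    (hf : jet E E' r f₁ x = jet E E' r f₂ x) (hg : jet E V r g₁ x = jet E V r g₂ x)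
    (hH : SmoothAround (𝓘(ℝ, E).prod (𝓘(ℝ, E').prod 𝓘(ℝ, V))) 𝓘(ℝ, E'') H (x, f₁ x, g₁ x)) :
    jet E E'' r (fun z => H (z, f₁ z, g₁ z)) x = jet E E'' r (fun z => H (z, f₂ z, g₂ z)) x := by
  have ef := target_eq_of_jet_eq hf
  have eg := target_eq_of_jet_eq hg
  have s : ∀ (f : X → Y) (g : X → N), SmoothNear E E' f x → SmoothNear E V g x → f x = f₁ x →
      g x = g₁ x → SmoothNear E E'' (fun z => H (z, f z, g z)) x := fun f g hf hg h1 h2 =>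
    hH.comp_of_eq ((SmoothAround.id x).prodMk (SmoothAround.prodMk hf hg)) (by rw [h1, h2])
  have s₁ := s f₁ g₁ hf₁ hg₁ rfl rfl
  have s₂ := s f₂ g₂ hf₂ hg₂ ef.symm eg.symm
  set φ := chartAt E x
  set ψ₁ := chartAt E' (f₁ x)
  set ψ₂ := chartAt V (g₁ x)
  set ψ₃ := chartAt E'' (H (x, f₁ x, g₁ x)) with hψ₃
  let H' : E × E' × V → E'' := fun w => ψ₃ (H (φ.symm w.1, ψ₁.symm w.2.1, ψ₂.symm w.2.2))
  have mx := mem_chart_source E x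
  have my := mem_chart_source E' (f₁ x)
  have mn := mem_chart_source V (g₁ x)
  rw [jet_eq_iff (chart_mem_atlas E x) (chart_mem_atlas E'' (H (x, f₁ x, g₁ x))) s₁ s₂ mx
    (mem_chart_source E'' _)]
  refine ⟨by rw [ef, eg], ?_⟩
  have e : ∀ (f : X → Y) (g : X → N), ContinuousAt f x → ContinuousAt g x → f x = f₁ x →
      g x = g₁ x → localRep φ ψ₃ (fun z => H (z, f z, g z)) =ᶠ[𝓝 (φ x)]
        fun v => H' (v, localRep φ ψ₁ f v, localRep φ ψ₂ g v) := by
    intro f g hf hg h1 h2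
    have c1 := hf.eventually (p := fun y => y ∈ ψ₁.source)
      (ψ₁.open_source.mem_nhds (by rw [h1]; exact my))
    have c2 := hg.eventually (p := fun y => y ∈ ψ₂.source)
      (ψ₂.open_source.mem_nhds (by rw [h2]; exact mn))
    filter_upwards [eventually_symm_chartAt c1, eventually_symm_chartAt c2] with v h1 h2
    simp only [localRep, H']
    rw [ψ₁.left_inv h1, ψ₂.left_inv h2]
  refine EqToOrder.congr ?_ (e f₁ g₁ hf₁.self_of_nhds.continuousAt hg₁.self_of_nhds.continuousAt
    rfl rfl) (e f₂ g₂ hf₂.self_of_nhds.continuousAt hg₂.self_of_nhds.continuousAt ef.symm eg.symm)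
  have lf := ((jet_eq_iff (chart_mem_atlas E x) (chart_mem_atlas E' (f₁ x)) hf₁ hf₂ mx my).1 hf).2
  have lg := ((jet_eq_iff (chart_mem_atlas E x) (chart_mem_atlas V (g₁ x)) hg₁ hg₂ mx mn).1 hg).2
  have df₁ := contDiffAt_localRep_chartAt hf₁.self_of_nhds my
  have df₂ := contDiffAt_localRep_chartAt hf₂.self_of_nhds (y := f₁ x) (ef ▸ my)
  have dg₁ := contDiffAt_localRep_chartAt hg₁.self_of_nhds mn
  have dg₂ := contDiffAt_localRep_chartAt hg₂.self_of_nhds (y := g₁ x) (eg ▸ mn)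
  -- Both chart expressions are `H'` composed with `v ↦ (v, F v, G v)`, where `F` and `G` are the
  -- chart expressions of the two inner maps. The first component is the same on both sides, the
  -- others agree to order `r` by assumption.
  refine EqToOrder.comp (H := H') ((EqToOrder.prodMk (fun _ _ => rfl)
    (EqToOrder.prodMk lf lg df₁ df₂ dg₁ dg₂) contDiffAt_id contDiffAt_id
    (df₁.prodMk dg₁) (df₂.prodMk dg₂))) (contDiffAt_id.prodMk (df₁.prodMk dg₁))
    (contDiffAt_id.prodMk (df₂.prodMk dg₂)) ?_
  have x0 : φ.symm (φ x) = x := φ.left_inv mx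
  have e1 : localRep φ ψ₁ f₁ (φ x) = ψ₁ (f₁ x) := by rw [localRep, x0]
  have e2 : localRep φ ψ₂ g₁ (φ x) = ψ₂ (g₁ x) := by rw [localRep, x0]
  rw [e1, e2, ← contMDiffAt_iff_contDiffAt]
  have h1 : SmoothAround 𝓘(ℝ, E × E' × V) 𝓘(ℝ, E) (fun w : E × E' × V => φ.symm w.1)
      (φ x, ψ₁ (f₁ x), ψ₂ (g₁ x)) :=
    (smoothAround_chartAt_symm (mem_chart_target E x)).comp_of_eq
      (SmoothAround.of_contMDiff contDiff_fst.contMDiff _) rfl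
  have h2 : SmoothAround 𝓘(ℝ, E × E' × V) 𝓘(ℝ, E') (fun w : E × E' × V => ψ₁.symm w.2.1)
      (φ x, ψ₁ (f₁ x), ψ₂ (g₁ x)) :=
    (smoothAround_chartAt_symm (mem_chart_target E' (f₁ x))).comp_of_eq
      (SmoothAround.of_contMDiff (contDiff_fst.comp contDiff_snd).contMDiff _) rfl
  have h3 : SmoothAround 𝓘(ℝ, E × E' × V) 𝓘(ℝ, V) (fun w : E × E' × V => ψ₂.symm w.2.2)
      (φ x, ψ₁ (f₁ x), ψ₂ (g₁ x)) :=
    (smoothAround_chartAt_symm (mem_chart_target V (g₁ x))).comp_of_eq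
      (SmoothAround.of_contMDiff (contDiff_snd.comp contDiff_snd).contMDiff _) rfl
  have h4 := hH.comp_of_eq (h1.prodMk (h2.prodMk h3))
    (by simp only [x0, ψ₁.left_inv my, ψ₂.left_inv mn])
  exact ((smoothAround_chartAt (mem_chart_source E'' _)).comp_of_eq h4
    (by simp only [x0, ψ₁.left_inv my, ψ₂.left_inv mn])).contMDiffAt

theorem jet_family_congr_left {H : X × Y → W} {f₁ f₂ : X → Y} {x : X}
    (hf₁ : SmoothNear E E' f₁ x) (hf₂ : SmoothNear E E' f₂ x)
    (hf : jet E E' r f₁ x = jet E E' r f₂ x)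
    (hH : SmoothAround (𝓘(ℝ, E).prod 𝓘(ℝ, E')) 𝓘(ℝ, E'') H (x, f₁ x)) :
    jet E E'' r (fun z => H (z, f₁ z)) x = jet E E'' r (fun z => H (z, f₂ z)) x :=
  jet_family_congr (H := fun w : X × Y × Y => H (w.1, w.2.1)) hf₁ hf₂ hf₁ hf₂ hf hf
    (hH.comp_of_eq ((SmoothAround.fst _).prodMk
      ((SmoothAround.fst _).comp_of_eq (SmoothAround.snd _) rfl)) rfl)

end

end JetCalculus

/-! ### Jets of smooth families of maps. -/

section JetSmoothness

set_option linter.unusedSectionVars false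

variable {E E' : Type*} [NormedAddCommGroup E] [NormedSpace ℝ E]
  [NormedAddCommGroup E'] [NormedSpace ℝ E']
  {X Y : Type*} [TopologicalSpace X] [ChartedSpace E X] [TopologicalSpace Y] [ChartedSpace E' Y]
  [IsManifold 𝓘(ℝ, E) ∞ X] [IsManifold 𝓘(ℝ, E') ∞ Y] {r : ℕ}

theorem chartAt_jet_apply (j₀ j : Jet E E' X Y r) : chartAt (JetModel r E E') j₀ j =
    jetCoord (chartAt E j₀.source) (chartAt E' j₀.target) j := rfl

theorem mem_chartAt_jet_source (j₀ j : Jet E E' X Y r) :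
    j ∈ (chartAt (JetModel r E E') j₀).source ↔
      j.source ∈ (chartAt E j₀.source).source ∧ j.target ∈ (chartAt E' j₀.target).source := Iff.rfl

theorem jetCoord_jet {φ : OpenPartialHomeomorph X E} {ψ : OpenPartialHomeomorph Y E'}
    (hφ : φ ∈ atlas E X) (hψ : ψ ∈ atlas E' Y) {f : X → Y} {x : X} (hf : SmoothNear E E' f x)
    (hx : x ∈ φ.source) (hy : f x ∈ ψ.source) :
    jetCoord φ ψ (jet E E' r f x) = (φ x, fun k : Fin (r + 1) =>
      symmetrize k (iteratedFDeriv ℝ k (localRep φ ψ f) (φ x))) := by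
  rw [jet_of_smoothNear hf]
  exact jetCoord_mk hφ hψ ⟨x, f, hf⟩ hx hy

/-- Every jet is the jet of a polynomial map in charts. -/
theorem jet_polyMap {φ : OpenPartialHomeomorph X E} {ψ : OpenPartialHomeomorph Y E'}
    (hφ : φ ∈ atlas E X) (hψ : ψ ∈ atlas E' Y) {j : Jet E E' X Y r} (hx : j.source ∈ φ.source)
    (hy : j.target ∈ ψ.source) : jet E E' r (polyMap φ ψ (jetCoord φ ψ j)) j.source = j := by
  have hz := jetCoord_mem hφ hψ hx hy
  have h := (jetChartOf hφ hψ j).left_inv (x := j) ⟨hx, hy⟩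
  have e : (jetChartOf hφ hψ j).symm (jetChartOf hφ hψ j j) =
      Jet.mk r ⟨φ.symm (jetCoord φ ψ j).1, polyMap φ ψ (jetCoord φ ψ j),
        smoothNear_polyMap hφ hψ hz⟩ := dif_pos hz
  rw [e] at h
  have e0 : φ.symm (jetCoord φ ψ j).1 = j.source := φ.left_inv hx
  have hs := smoothNear_polyMap hφ hψ hz
  rw [← jet_of_smoothNear hs, e0] at h
  exact h

/-- In a chart of the jet space the coordinates are the derivatives of the chart expression of `G p`
at the point `φ (b p)`; they are smooth in `p` by `contDiffAt_iteratedFDeriv_param`. That statement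
concerns normed spaces, which is why the parameters form a normed space here. -/
theorem contMDiffAt_jet_of_normedSpace {P : Type*} [NormedAddCommGroup P] [NormedSpace ℝ P]
    {G : P → X → Y} {b : P → X} {p₀ : P}
    (hG : SmoothAround (𝓘(ℝ, P).prod 𝓘(ℝ, E)) 𝓘(ℝ, E') (fun w : P × X => G w.1 w.2) (p₀, b p₀))
    (hb : SmoothAround 𝓘(ℝ, P) 𝓘(ℝ, E) b p₀) :
    ContMDiffAt 𝓘(ℝ, P) 𝓘(ℝ, JetModel r E E') ∞ (fun p => jet E E' r (G p) (b p)) p₀ := by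
  set j₀ := jet E E' r (G p₀) (b p₀) with hj₀
  have hs : j₀.source = b p₀ := source_jet _ _
  have ht : j₀.target = G p₀ (b p₀) := target_jet _ _
  have mx : b p₀ ∈ (chartAt E j₀.source).source := by rw [hs]; exact mem_chart_source E _
  have my : G p₀ (b p₀) ∈ (chartAt E' j₀.target).source := by rw [ht]; exact mem_chart_source E' _
  set φ := chartAt E j₀.source
  set ψ := chartAt E' j₀.target
  have hφ : φ ∈ atlas E X := chart_mem_atlas E _
  have hψ : ψ ∈ atlas E' Y := chart_mem_atlas E' _
  have hpb : SmoothAround 𝓘(ℝ, P) (𝓘(ℝ, P).prod 𝓘(ℝ, E)) (fun p => (p, b p)) p₀ :=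
    (SmoothAround.id p₀).prodMk hb
  have hGb : SmoothAround 𝓘(ℝ, P) 𝓘(ℝ, E') (fun p => G p (b p)) p₀ := hG.comp_of_eq hpb rfl
  have ev1 : ∀ᶠ p in 𝓝 p₀, b p ∈ φ.source := hb.continuousAt (φ.open_source.mem_nhds mx)
  have ev2 : ∀ᶠ p in 𝓝 p₀, G p (b p) ∈ ψ.source :=
    hGb.continuousAt.eventually (ψ.open_source.mem_nhds my)
  have ev3 : ∀ᶠ p in 𝓝 p₀, SmoothNear E E' (G p) (b p) := by
    filter_upwards [hpb.continuousAt.eventually hG.eventually] with p hp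
    exact hp.left
  have hsrc : (fun p => jet E E' r (G p) (b p)) ⁻¹' (chartAt (JetModel r E E') j₀).source ∈ 𝓝 p₀ := by
    filter_upwards [ev1, ev2] with p h1 h2
    refine (mem_chartAt_jet_source j₀ _).2 ⟨?_, ?_⟩
    · rwa [source_jet (G p) (b p)]
    · rwa [target_jet (G p) (b p)]
  have hφb : ContDiffAt ℝ ∞ (fun p => φ (b p)) p₀ :=
    ((smoothAround_chartAt mx).comp_of_eq hb rfl).contMDiffAt.contDiffAt
  have hL : ContDiffAt ℝ ∞ (Function.uncurry fun p : P => localRep φ ψ (G p)) (p₀, φ (b p₀)) := by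
    rw [← contMDiffAt_iff_contDiffAt]
    have h1 : SmoothAround 𝓘(ℝ, P × E) 𝓘(ℝ, E) (fun w : P × E => φ.symm w.2) (p₀, φ (b p₀)) :=
      (smoothAround_chartAt_symm (φ.map_source mx)).comp_of_eq
        (contDiff_snd.smoothAround _) rfl
    have h2 : SmoothAround 𝓘(ℝ, P × E) 𝓘(ℝ, P) (fun w : P × E => w.1) (p₀, φ (b p₀)) :=
      contDiff_fst.smoothAround _
    have h3 := hG.comp_of_eq (h2.prodMk h1) (by simp only [φ.left_inv mx])
    exact ((smoothAround_chartAt my).comp_of_eq h3 (by simp only [φ.left_inv mx])).contMDiffAt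
  have hD : ContDiffAt ℝ ∞ (fun p => ((φ (b p), fun k : Fin (r + 1) => symmetrize (k : ℕ)
      (iteratedFDeriv ℝ k (localRep φ ψ (G p)) (φ (b p)))) : JetModel r E E')) p₀ := by
    refine hφb.prodMk (contDiffAt_pi.2 fun k => ?_)
    have h5 : ContDiffAt ℝ ∞ (fun p => iteratedFDeriv ℝ k (localRep φ ψ (G p)) (φ (b p))) p₀ :=
      ContDiffAt.comp (f := fun p => (p, φ (b p)))
        (g := fun w : P × E => iteratedFDeriv ℝ k (localRep φ ψ (G w.1)) w.2) p₀
        (contDiffAt_iteratedFDeriv_param hL k) (contDiffAt_id.prodMk hφb)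
    exact (contDiff_symmetrize (k : ℕ)).contDiffAt.comp p₀ h5
  have hchart : ContDiffAt ℝ ∞ (chartAt (JetModel r E E') j₀ ∘ fun p => jet E E' r (G p) (b p)) p₀ := by
    refine hD.congr_of_eventuallyEq ?_
    filter_upwards [ev1, ev2, ev3] with p h1 h2 h3
    rw [Function.comp_apply, chartAt_jet_apply]
    exact jetCoord_jet hφ hψ h3 h1 h2
  rw [contMDiffAt_iff_target]
  refine ⟨?_, ?_⟩
  · rw [OpenPartialHomeomorph.continuousAt_iff_continuousAt_comp_left _ hsrc]
    exact hchart.continuousAt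
  · exact hchart.contMDiffAt

/-- The jets of a smooth family of maps form a smooth family. -/
theorem smoothAround_jet {EP HP P : Type*} [NormedAddCommGroup EP] [NormedSpace ℝ EP]
    [TopologicalSpace HP] {I : ModelWithCorners ℝ EP HP} [I.Boundaryless] [TopologicalSpace P]
    [ChartedSpace HP P] [IsManifold I ∞ P] {G : P → X → Y} {b : P → X} {p₀ : P}
    (hG : SmoothAround (I.prod 𝓘(ℝ, E)) 𝓘(ℝ, E') (fun w : P × X => G w.1 w.2) (p₀, b p₀))
    (hb : SmoothAround I 𝓘(ℝ, E) b p₀) :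
    SmoothAround I 𝓘(ℝ, JetModel r E E') (fun p => jet E E' r (G p) (b p)) p₀ := by
  have hpb : SmoothAround I (I.prod 𝓘(ℝ, E)) (fun p => (p, b p)) p₀ :=
    (SmoothAround.id p₀).prodMk hb
  filter_upwards [hpb.continuousAt.eventually hG.eventually, hb.eventually] with p hG hb
  set e := extChartAt I p
  have e0 : e.symm (e p) = p := extChartAt_to_inv p
  -- Reading the parameters in a chart reduces to a normed parameter space. Since there is no
  -- boundary, the target of the chart is a neighbourhood of `e p`.
  have hsymm : SmoothAround 𝓘(ℝ, EP) I e.symm (e p) :=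
    SmoothAround.of_contMDiffOn (contMDiffOn_extChartAt_symm p) (extChartAt_target_mem_nhds p)
  have he : ContMDiffAt I 𝓘(ℝ, EP) ∞ e p := contMDiffAt_extChartAt
  have key : ContMDiffAt 𝓘(ℝ, EP) 𝓘(ℝ, JetModel r E E') ∞
      (fun v => jet E E' r (G (e.symm v)) (b (e.symm v))) (e p) := by
    refine contMDiffAt_jet_of_normedSpace (G := fun v => G (e.symm v)) (b := fun v => b (e.symm v))
      ?_ (hb.comp_of_eq hsymm e0)
    refine hG.comp_of_eq (((hsymm.comp_of_eq (SmoothAround.fst _) rfl)).prodMk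
      (SmoothAround.snd _)) ?_
    simp only [e0]
  refine (ContMDiffAt.comp p key he).congr_of_eventuallyEq ?_
  filter_upwards [extChartAt_source_mem_nhds (I := I) p] with z hz
  simp only [Function.comp_apply]
  rw [e.left_inv hz]

theorem smoothAround_source (j₀ : Jet E E' X Y r) :
    SmoothAround 𝓘(ℝ, JetModel r E E') 𝓘(ℝ, E) Jet.source j₀ := by
  have hc := smoothAround_chartAt (mem_chart_source (JetModel r E E') j₀)
  have h1 : SmoothAround 𝓘(ℝ, JetModel r E E') 𝓘(ℝ, E)
      (fun j => (chartAt E j₀.source).symm (chartAt (JetModel r E E') j₀ j).1) j₀ :=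
    (smoothAround_chartAt_symm (mem_chart_target E j₀.source)).comp_of_eq
      (SmoothAround.comp (contDiff_fst.smoothAround _) hc) rfl
  refine h1.congr ?_
  filter_upwards [(chartAt (JetModel r E E') j₀).open_source.mem_nhds (mem_chart_source _ j₀)] with j hj
  exact ((chartAt E j₀.source).left_inv hj.1).symm

/-- In the chart of the jet space, the target is the value at `0` of the polynomial with the given
coefficients. -/
theorem smoothAround_target (j₀ : Jet E E' X Y r) :
    SmoothAround 𝓘(ℝ, JetModel r E E') 𝓘(ℝ, E') Jet.target j₀ := by
  have hc := smoothAround_chartAt (mem_chart_source (JetModel r E E') j₀)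
  have hP : ContDiff ℝ ∞ fun z : JetModel r E E' => taylorPoly z.2 0 :=
    contDiff_taylorPoly.comp (contDiff_snd.prodMk contDiff_const)
  have m0 := mem_chart_source E' j₀.target
  have e0 := taylorPoly_jetCoord (chart_mem_atlas E j₀.source) (chart_mem_atlas E' j₀.target)
    (mem_chart_source E j₀.source) m0
  have h1 : SmoothAround 𝓘(ℝ, JetModel r E E') 𝓘(ℝ, E')
      (fun j => (chartAt E' j₀.target).symm
        (taylorPoly (chartAt (JetModel r E E') j₀ j).2 0)) j₀ :=
    (smoothAround_chartAt_symm (mem_chart_target E' j₀.target)).comp_of_eq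
      (SmoothAround.comp (g := fun z : JetModel r E E' => taylorPoly z.2 0) (hP.smoothAround _) hc) e0
  refine h1.congr ?_
  filter_upwards [(chartAt (JetModel r E E') j₀).open_source.mem_nhds (mem_chart_source _ j₀)] with j hj
  rw [chartAt_jet_apply, taylorPoly_jetCoord (chart_mem_atlas E _) (chart_mem_atlas E' _) hj.1 hj.2,
    (chartAt E' j₀.target).left_inv hj.2]

/-- Near a given jet there is a smooth family of maps representing the jets. -/
theorem exists_smooth_representatives (j₀ : Jet E E' X Y r) : ∃ G : Jet E E' X Y r → X → Y,
    SmoothAround (𝓘(ℝ, JetModel r E E').prod 𝓘(ℝ, E)) 𝓘(ℝ, E')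
      (fun w : Jet E E' X Y r × X => G w.1 w.2) (j₀, j₀.source) ∧
    ∀ᶠ j in 𝓝 j₀, SmoothNear E E' (G j) j.source ∧ jet E E' r (G j) j.source = j := by
  set φ := chartAt E j₀.source
  set ψ := chartAt E' j₀.target
  have mx := mem_chart_source E j₀.source
  have my := mem_chart_source E' j₀.target
  have hφ : φ ∈ atlas E X := chart_mem_atlas E _
  have hψ : ψ ∈ atlas E' Y := chart_mem_atlas E' _
  have hc := smoothAround_chartAt (mem_chart_source (JetModel r E E') j₀)
  have hP : ContDiff ℝ ∞ fun w : JetModel r E E' × E => taylorPoly w.1.2 (w.2 - w.1.1) :=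
    contDiff_taylorPoly.comp ((contDiff_snd.comp contDiff_fst).prodMk
      (contDiff_snd.sub (contDiff_fst.comp contDiff_fst)))
  set c := chartAt (JetModel r E E') j₀ with hc'
  have hG : SmoothAround (𝓘(ℝ, JetModel r E E').prod 𝓘(ℝ, E)) 𝓘(ℝ, E')
      (fun w : Jet E E' X Y r × X => polyMap φ ψ (c w.1) w.2) (j₀, j₀.source) := by
    have h1 : SmoothAround (𝓘(ℝ, JetModel r E E').prod 𝓘(ℝ, E)) 𝓘(ℝ, JetModel r E E' × E)
        (fun w : Jet E E' X Y r × X => (c w.1, φ w.2)) (j₀, j₀.source) :=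
      (hc.comp_of_eq (SmoothAround.fst _) rfl).prodMk_space
        ((smoothAround_chartAt mx).comp_of_eq (SmoothAround.snd _) rfl)
    have h0 := hP.smoothAround (c j₀, φ j₀.source)
    have h2 := h0.comp_of_eq h1 rfl
    refine SmoothAround.comp_of_eq (smoothAround_chartAt_symm (ψ.map_source my)) h2 ?_
    have e0 : (c j₀).1 = φ j₀.source := rfl
    have e1 : taylorPoly (c j₀).2 0 = ψ j₀.target := taylorPoly_jetCoord hφ hψ mx my
    change taylorPoly (c j₀).2 (φ j₀.source - (c j₀).1) = ψ j₀.target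
    rw [e0, sub_self, e1]
  -- The representative of `j` is the map that is polynomial in the charts, with the coordinates of
  -- `j` as coefficients.
  refine ⟨fun j => polyMap φ ψ (c j), hG, ?_⟩
  have hs : ContinuousAt (fun j : Jet E E' X Y r => (j, j.source)) j₀ :=
    continuousAt_id.prodMk (smoothAround_source j₀).continuousAt
  filter_upwards [hs.eventually hG.eventually,
    c.open_source.mem_nhds (mem_chart_source _ j₀)] with j h1 hj
  exact ⟨h1.left (f := fun j => polyMap φ ψ (c j)), jet_polyMap hφ hψ hj.1 hj.2⟩

theorem smoothNear_jet {f : X → Y} {x : X} (hf : SmoothNear E E' f x) :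
    SmoothNear E (JetModel r E E') (fun z => jet E E' r f z) x :=
  smoothAround_jet (I := 𝓘(ℝ, E)) (G := fun _ : X => f) (b := fun z => z)
    (SmoothAround.comp_of_eq (g := f) hf (SmoothAround.snd _) rfl) (SmoothAround.id x)

/-- The `r`-jet of the map `z ↦ j_z^q f` depends only on the `q + r`-jet of `f`. -/
theorem jet_jet_congr {q : ℕ} {f₁ f₂ : X → Y} {x : X} (h₁ : SmoothNear E E' f₁ x)
    (h₂ : SmoothNear E E' f₂ x) (h : jet E E' (q + r) f₁ x = jet E E' (q + r) f₂ x) :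
    jet E (JetModel q E E') r (fun z => jet E E' q f₁ z) x =
      jet E (JetModel q E E') r (fun z => jet E E' q f₂ z) x := by
  have hq := jet_eq_of_le (Nat.le_add_right q r) h₁ h₂ h
  have mx := mem_chart_source E x
  have my := mem_chart_source E' (f₁ x)
  have ef := target_eq_of_jet_eq h
  have hE := ((jet_eq_iff (chart_mem_atlas E x) (chart_mem_atlas E' (f₁ x)) h₁ h₂ mx my).1 h).2
  set j₀ := jet E E' q f₁ x with hj₀
  have hs : j₀.source = x := source_jet _ _
  have ht : j₀.target = f₁ x := target_jet _ _
  rw [jet_eq_iff (chart_mem_atlas E x) (chart_mem_atlas (JetModel q E E') j₀)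
    (smoothNear_jet h₁) (smoothNear_jet h₂) mx (mem_chart_source _ j₀)]
  refine ⟨hq, ?_⟩
  set φ := chartAt E x
  set ψ := chartAt E' (f₁ x)
  -- `D f` is the coordinate expression of `z ↦ j_z^q f`: the point and the derivatives of `f`
  -- there.
  let D : (X → Y) → E → JetModel q E E' := fun f v => (v, fun k : Fin (q + 1) =>
    symmetrize (k : ℕ) (iteratedFDeriv ℝ k (localRep φ ψ f) v))
  have key : ∀ f : X → Y, SmoothNear E E' f x → f x ∈ ψ.source →
      localRep φ (chartAt (JetModel q E E') j₀) (fun z => jet E E' q f z) =ᶠ[𝓝 (φ x)] D f := by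
    intro f hf hfx
    have c1 := hf.self_of_nhds.continuousAt.eventually (p := fun y => y ∈ ψ.source)
      (ψ.open_source.mem_nhds hfx)
    filter_upwards [eventually_symm_chartAt c1,
      eventually_symm_chartAt (SmoothAround.eventually (f := f) hf),
      φ.open_target.mem_nhds (mem_chart_target E x)] with v h1 h2 hv
    simp only [localRep, chartAt_jet_apply, hs, ht]
    rw [jetCoord_jet (chart_mem_atlas E x) (chart_mem_atlas E' (f₁ x)) h2 (φ.map_target hv) h1,
      φ.right_inv hv]
    rfl
  refine EqToOrder.congr ?_ (key f₁ h₁ my) (key f₂ h₂ (ef ▸ my))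
  have smooth : ∀ f : X → Y, SmoothNear E E' f x → f x ∈ ψ.source → ∀ k : ℕ,
      ContDiffAt ℝ ∞ (iteratedFDeriv ℝ k (localRep φ ψ f)) (φ x) := fun f hf hfx k =>
    (contDiffAt_localRep_chartAt hf.self_of_nhds hfx).iteratedFDeriv_right (by exact_mod_cast le_top)
  -- Since `k ≤ q`, agreement to order `q + r` leaves at least order `r` after `k` derivatives.
  have comp : ∀ k : Fin (q + 1), EqToOrder r
      (fun v => symmetrize (k : ℕ) (iteratedFDeriv ℝ k (localRep φ ψ f₁) v))
      (fun v => symmetrize (k : ℕ) (iteratedFDeriv ℝ k (localRep φ ψ f₂) v)) (φ x) := fun k =>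
    EqToOrder.comp (H := fun m => symmetrize (k : ℕ) m)
      (hE.mono (m := k + r) (by have := k.2; omega)).iteratedFDeriv
      (smooth f₁ h₁ my k) (smooth f₂ h₂ (ef ▸ my) k) (contDiff_symmetrize (k : ℕ)).contDiffAt
  have smooth' : ∀ f : X → Y, SmoothNear E E' f x → f x ∈ ψ.source →
      ContDiffAt ℝ ∞ (fun v => (D f v).2) (φ x) := fun f hf hfx =>
    contDiffAt_pi.2 fun k => (contDiff_symmetrize (k : ℕ)).contDiffAt.comp _ (smooth f hf hfx k)
  refine EqToOrder.prodMk (fun _ _ => rfl) ?_ contDiffAt_id contDiffAt_id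
    (smooth' f₁ h₁ my) (smooth' f₂ h₂ (ef ▸ my))
  exact EqToOrder.of_clm (fun k : Fin (q + 1) => (ContinuousLinearMap.proj k :
    ((k : Fin (q + 1)) → SymMap (k : ℕ) E E') →L[ℝ] SymMap (k : ℕ) E E'))
    (fun _ _ h => funext h) (smooth' f₁ h₁ my) (smooth' f₂ h₂ (ef ▸ my)) comp

end JetSmoothness

/-- The inverse function theorem for maps that are smooth near a point. -/
theorem exists_smooth_localInverse {A B : Type*} [NormedAddCommGroup A] [NormedSpace ℝ A]
    [NormedAddCommGroup B] [NormedSpace ℝ B] [CompleteSpace A] {F : A → B} {a : A}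
    (hF : SmoothAround 𝓘(ℝ, A) 𝓘(ℝ, B) F a)
    (hF' : fderiv ℝ F a ∈ range ((↑) : (A ≃L[ℝ] B) → (A →L[ℝ] B))) :
    ∃ G : B → A, SmoothAround 𝓘(ℝ, B) 𝓘(ℝ, A) G (F a) ∧ (∀ᶠ v in 𝓝 a, G (F v) = v) ∧
      ∀ᶠ w in 𝓝 (F a), F (G w) = w := by
  have hFa : ContDiffAt ℝ ∞ F a := hF.contMDiffAt.contDiffAt
  obtain ⟨L, hL⟩ := hF'
  have hd : HasFDerivAt F (L : A →L[ℝ] B) a := by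
    rw [hL]; exact (hFa.differentiableAt (by simp)).hasFDerivAt
  let e := hFa.toOpenPartialHomeomorph F hd (by simp)
  have ha : a ∈ e.source := hFa.mem_toOpenPartialHomeomorph_source hd (by simp)
  have he : ∀ v, e v = F v := fun _ => rfl
  -- Invertible operators form an open set, so the inverse is smooth at all points near `F a` and
  -- not only at `F a` itself.
  have hopen : ∀ᶠ v in 𝓝 a, fderiv ℝ F v ∈ range ((↑) : (A ≃L[ℝ] B) → (A →L[ℝ] B)) := by
    refine (hFa.fderiv_right (m := 0) (by simp)).continuousAt.eventually_mem ?_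
    exact ContinuousLinearEquiv.isOpen.mem_nhds ⟨L, hL⟩
  refine ⟨e.symm, ?_, ?_, ?_⟩
  · have ht := e.map_source ha
    have hc := e.continuousAt_symm ht
    rw [ContinuousAt, e.left_inv ha] at hc
    filter_upwards [hc.eventually hopen, hc.eventually hF, e.open_target.mem_nhds ht] with w h1 h2 h3
    obtain ⟨L', hL'⟩ := h1
    have h2' := h2.contDiffAt
    refine (e.contDiffAt_symm (f₀' := L') h3 ?_ h2').contMDiffAt
    rw [hL']
    exact (h2'.differentiableAt (by simp)).hasFDerivAt
  · filter_upwards [e.open_source.mem_nhds ha] with v hv using e.left_inv hv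
  · filter_upwards [e.open_target.mem_nhds (e.map_source ha)] with w hw using e.right_inv hw

/-! ### Local diffeomorphisms and the inverse function theorem. -/

section LocalDiffeomorphisms

set_option linter.unusedSectionVars false

variable {E E' : Type*} [NormedAddCommGroup E] [NormedSpace ℝ E]
  [NormedAddCommGroup E'] [NormedSpace ℝ E']
  {X Y : Type*} [TopologicalSpace X] [ChartedSpace E X] [TopologicalSpace Y] [ChartedSpace E' Y]

/-- This trades a diffeomorphism between open sets for a pair of germs inverse to each other, so
that domains need not be tracked afterwards. -/
theorem isLocalDiffeomorphAt_iff_exists_inverse {f : X → Y} {x : X} :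
    IsLocalDiffeomorphAt 𝓘(ℝ, E) 𝓘(ℝ, E') ∞ f x ↔ SmoothNear E E' f x ∧
      ∃ g : Y → X, SmoothNear E' E g (f x) ∧ (∀ᶠ z in 𝓝 x, g (f z) = z) ∧
        ∀ᶠ w in 𝓝 (f x), f (g w) = w := by
  constructor
  · intro h
    refine ⟨?_, h.localInverse, SmoothAround.of_contMDiffOn h.localInverse_contMDiffOn
      (h.localInverse_open_source.mem_nhds h.localInverse_mem_source),
      h.localInverse_eventuallyEq_left, h.localInverse_eventuallyEq_right⟩
    obtain ⟨Φ, hx, hΦ⟩ := h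
    have hn := Φ.open_source.mem_nhds hx
    exact SmoothAround.congr (SmoothAround.of_contMDiffOn Φ.contMDiffOn hn)
      (eventuallyEq_of_mem hn hΦ)
  · rintro ⟨hf, g, hg, hgf, hfg⟩
    obtain ⟨S, hS, hSo, hxS⟩ := eventually_nhds_iff.1 (Eventually.and hf hgf)
    obtain ⟨T, hT, hTo, hxT⟩ := eventually_nhds_iff.1 (Eventually.and hg hfg)
    have hfS : ContMDiffOn 𝓘(ℝ, E) 𝓘(ℝ, E') ∞ f S := fun y hy => (hS y hy).1.contMDiffWithinAt
    have hgT : ContMDiffOn 𝓘(ℝ, E') 𝓘(ℝ, E) ∞ g T := fun y hy => (hT y hy).1.contMDiffWithinAt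
    -- Each domain is cut down by the preimage of the other, so that `f` and `g` exchange them.
    let Φ : PartialDiffeomorph 𝓘(ℝ, E) 𝓘(ℝ, E') X Y ∞ :=
      { toFun := f
        invFun := g
        source := S ∩ f ⁻¹' T
        target := T ∩ g ⁻¹' S
        map_source' := fun y hy => ⟨hy.2, by rw [mem_preimage, (hS y hy.1).2]; exact hy.1⟩
        map_target' := fun y hy => ⟨hy.2, by rw [mem_preimage, (hT y hy.1).2]; exact hy.1⟩
        left_inv' := fun y hy => (hS y hy.1).2
        right_inv' := fun y hy => (hT y hy.1).2
        open_source := hfS.continuousOn.isOpen_inter_preimage hSo hTo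
        open_target := hgT.continuousOn.isOpen_inter_preimage hTo hSo
        contMDiffOn_toFun := hfS.mono inter_subset_left
        contMDiffOn_invFun := hgT.mono inter_subset_left }
    exact ⟨Φ, ⟨hxS, hxT⟩, fun _ _ => rfl⟩

theorem smoothNear_of_isLocalDiffeomorphAt {f : X → Y} {x : X}
    (h : IsLocalDiffeomorphAt 𝓘(ℝ, E) 𝓘(ℝ, E') ∞ f x) : SmoothNear E E' f x :=
  (isLocalDiffeomorphAt_iff_exists_inverse.1 h).1

theorem isLocalDiffeomorphAt_eventually {f : X → Y} {x : X}
    (h : IsLocalDiffeomorphAt 𝓘(ℝ, E) 𝓘(ℝ, E') ∞ f x) :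
    ∀ᶠ z in 𝓝 x, IsLocalDiffeomorphAt 𝓘(ℝ, E) 𝓘(ℝ, E') ∞ f z := by
  obtain ⟨Φ, hx, hΦ⟩ := h
  filter_upwards [Φ.open_source.mem_nhds hx] with z hz using ⟨Φ, hz, hΦ⟩

variable [IsManifold 𝓘(ℝ, E) ∞ X] [IsManifold 𝓘(ℝ, E') ∞ Y]

/-- This is the chain rule for `g ∘ f = id` in charts. Only a one-sided inverse is needed, so
exchanging the roles of `f` and `g` yields the other composite. -/
theorem localRep_inverse {φ : OpenPartialHomeomorph X E} {ψ : OpenPartialHomeomorph Y E'}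
    (hφ : φ ∈ atlas E X) (hψ : ψ ∈ atlas E' Y) {f : X → Y} {g : Y → X} {x : X}
    (hx : x ∈ φ.source) (hy : f x ∈ ψ.source) (hf : SmoothNear E E' f x)
    (hg : SmoothNear E' E g (f x)) (hgf : ∀ᶠ z in 𝓝 x, g (f z) = z) :
    fderiv ℝ (localRep ψ φ g) (ψ (f x)) ∘L fderiv ℝ (localRep φ ψ f) (φ x) =
      ContinuousLinearMap.id ℝ E := by
  have x0 : φ.symm (φ x) = x := φ.left_inv hx
  have y0 : ψ.symm (ψ (f x)) = f x := ψ.left_inv hy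
  have e : localRep φ ψ f (φ x) = ψ (f x) := by rw [localRep, x0]
  have df : DifferentiableAt ℝ (localRep φ ψ f) (φ x) :=
    (contDiffAt_localRep hφ hψ (φ.map_source hx) (by rw [x0]; exact hf.self_of_nhds)
      (by rwa [x0])).differentiableAt (by simp)
  have dg : DifferentiableAt ℝ (localRep ψ φ g) (ψ (f x)) :=
    (contDiffAt_localRep hψ hφ (ψ.map_source hy) (by rw [y0]; exact hg.self_of_nhds)
      (by rwa [y0, hgf.self_of_nhds])).differentiableAt (by simp)
  rw [← e, ← fderiv_comp (φ x) (by rwa [e]) df]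
  have hc : ContinuousAt φ.symm (φ x) := φ.continuousAt_symm (φ.map_source hx)
  rw [ContinuousAt, x0] at hc
  have h2 : ∀ᶠ z in 𝓝 x, f z ∈ ψ.source :=
    hf.self_of_nhds.continuousAt.eventually (ψ.open_source.mem_nhds hy)
  have : localRep ψ φ g ∘ localRep φ ψ f =ᶠ[𝓝 (φ x)] id := by
    filter_upwards [hc.eventually hgf, hc.eventually h2, φ.open_target.mem_nhds (φ.map_source hx)]
      with v h1 h2 h3
    simp only [Function.comp_apply, localRep, id_eq]
    rw [ψ.left_inv h2, h1, φ.right_inv h3]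
  rw [this.fderiv_eq, fderiv_id]

/-- A smooth map is a local diffeomorphism if and only if its derivative in charts is
invertible. -/
theorem isLocalDiffeomorphAt_iff [CompleteSpace E] {φ : OpenPartialHomeomorph X E}
    {ψ : OpenPartialHomeomorph Y E'} (hφ : φ ∈ atlas E X) (hψ : ψ ∈ atlas E' Y) {f : X → Y} {x : X}
    (hf : SmoothNear E E' f x) (hx : x ∈ φ.source) (hy : f x ∈ ψ.source) :
    IsLocalDiffeomorphAt 𝓘(ℝ, E) 𝓘(ℝ, E') ∞ f x ↔
      fderiv ℝ (localRep φ ψ f) (φ x) ∈ range ((↑) : (E ≃L[ℝ] E') → (E →L[ℝ] E')) := by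
  have x0 : φ.symm (φ x) = x := φ.left_inv hx
  have y0 : ψ.symm (ψ (f x)) = f x := ψ.left_inv hy
  constructor
  · intro h
    obtain ⟨-, g, hg, hgf, hfg⟩ := isLocalDiffeomorphAt_iff_exists_inverse.1 h
    have h1 := localRep_inverse hφ hψ hx hy hf hg hgf
    have hgx : g (f x) = x := hgf.self_of_nhds
    have h2 := localRep_inverse (x := f x) (f := g) (g := f) hψ hφ hy (by rwa [hgx]) hg
      (by rwa [hgx]) hfg
    rw [hgx] at h2
    exact ⟨ContinuousLinearEquiv.equivOfInverse _ _ (fun v => congrArg (fun L => L v) h1)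
      (fun v => congrArg (fun L => L v) h2), rfl⟩
  · intro h
    have e : localRep φ ψ f (φ x) = ψ (f x) := by rw [localRep, x0]
    have hc : ContinuousAt φ.symm (φ x) := φ.continuousAt_symm (φ.map_source hx)
    rw [ContinuousAt, x0] at hc
    have h2 : ∀ᶠ z in 𝓝 x, f z ∈ ψ.source :=
      hf.self_of_nhds.continuousAt.eventually (ψ.open_source.mem_nhds hy)
    have hF : SmoothAround 𝓘(ℝ, E) 𝓘(ℝ, E') (localRep φ ψ f) (φ x) := by
      filter_upwards [hc.eventually h2, hc.eventually hf,
        φ.open_target.mem_nhds (φ.map_source hx)] with v h1 h3 h4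
      exact (contDiffAt_localRep hφ hψ h4 h3 h1).contMDiffAt
    obtain ⟨G, hG, hGF, hFG⟩ := exists_smooth_localInverse hF h
    have cG := hG.continuousAt
    rw [ContinuousAt, hGF.self_of_nhds, e] at cG
    rw [e] at hG hFG
    rw [isLocalDiffeomorphAt_iff_exists_inverse]
    have sψ : SmoothAround 𝓘(ℝ, E') 𝓘(ℝ, E') ψ (f x) := by
      filter_upwards [ψ.open_source.mem_nhds hy] with y hy
      exact contMDiffAt_of_mem_maximalAtlas (IsManifold.subset_maximalAtlas hψ) hy
    have sφ : SmoothAround 𝓘(ℝ, E) 𝓘(ℝ, E) φ.symm (φ x) := by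
      filter_upwards [φ.open_target.mem_nhds (φ.map_source hx)] with y hy
      exact contMDiffAt_symm_of_mem_maximalAtlas (IsManifold.subset_maximalAtlas hφ) hy
    have eG : G (ψ (f x)) = φ x := by rw [← e]; exact hGF.self_of_nhds
    have cφ : Tendsto φ (𝓝 x) (𝓝 (φ x)) := φ.continuousAt hx
    have cψ : Tendsto ψ (𝓝 (f x)) (𝓝 (ψ (f x))) := ψ.continuousAt hy
    refine ⟨hf, fun y => φ.symm (G (ψ y)), (sφ.comp_of_eq hG eG).comp_of_eq sψ rfl, ?_, ?_⟩
    · filter_upwards [cφ.eventually hGF, φ.open_source.mem_nhds hx] with z h1 h3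
      have : localRep φ ψ f (φ z) = ψ (f z) := by rw [localRep, φ.left_inv h3]
      rw [← this, h1, φ.left_inv h3]
    -- The chart `ψ` is injective only on its source, so `f (φ.symm (G (ψ y)))` has to be known to
    -- lie there.
    · have h5 : ∀ᶠ v in 𝓝 (φ x), f (φ.symm v) ∈ ψ.source := hc.eventually h2
      filter_upwards [cψ.eventually hFG, cψ.eventually (cG.eventually h5),
        ψ.open_source.mem_nhds hy] with y h1 h3 h4
      have h6 : ψ (f (φ.symm (G (ψ y)))) = ψ y := h1
      exact ψ.injOn h3 h4 h6

end LocalDiffeomorphisms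

/-! ### The full jet groupoid: composition, inverses and openness. -/

section Groupoid

set_option linter.unusedSectionVars false

variable {E : Type*} [NormedAddCommGroup E] [NormedSpace ℝ E]
  {X : Type*} [TopologicalSpace X] [ChartedSpace E X] {q : ℕ}

theorem jet_mem_fullJetGroupoid {f : X → X} {x : X}
    (h : IsLocalDiffeomorphAt 𝓘(ℝ, E) 𝓘(ℝ, E) ∞ f x) : jet E E q f x ∈ fullJetGroupoid E X q :=
  ⟨f, x, h, rfl⟩

theorem isLocalDiffeomorphAt_id (x : X) : IsLocalDiffeomorphAt 𝓘(ℝ, E) 𝓘(ℝ, E) ∞ id x :=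
  isLocalDiffeomorphAt_iff_exists_inverse.2 ⟨SmoothAround.id x, id, SmoothAround.id x,
    Eventually.of_forall fun _ => rfl, Eventually.of_forall fun _ => rfl⟩

theorem jet_id_mem_fullJetGroupoid (x : X) : jet E E q id x ∈ fullJetGroupoid E X q :=
  jet_mem_fullJetGroupoid (isLocalDiffeomorphAt_id x)

theorem exists_localDiffeomorph_of_mem {g : Jet E E X X q} (hg : g ∈ fullJetGroupoid E X q) :
    ∃ f : X → X, IsLocalDiffeomorphAt 𝓘(ℝ, E) 𝓘(ℝ, E) ∞ f g.source ∧ f g.source = g.target ∧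
      g = jet E E q f g.source := by
  obtain ⟨f, x, hf, rfl⟩ := hg
  exact ⟨f, by simpa using hf, by simp, by simp⟩

variable [IsManifold 𝓘(ℝ, E) ∞ X]

theorem Jet.comp_mem {a b : Jet E E X X q} (ha : a ∈ fullJetGroupoid E X q)
    (hb : b ∈ fullJetGroupoid E X q) (h : a.source = b.target) :
    a.comp b ∈ fullJetGroupoid E X q := by
  obtain ⟨f, x, hf, rfl⟩ := ha
  obtain ⟨g, y, hg, rfl⟩ := hb
  rw [source_jet, target_jet] at h
  subst h
  rw [Jet.comp_jet (smoothNear_of_isLocalDiffeomorphAt hf) (smoothNear_of_isLocalDiffeomorphAt hg)]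
  exact jet_mem_fullJetGroupoid (IsLocalDiffeomorphAt.comp (K := 𝓘(ℝ, E)) X hg hf)

@[simp] theorem Jet.source_comp (a b : Jet E E X X q) : (a.comp b).source = b.source :=
  source_jet _ _

theorem Jet.target_comp {a b : Jet E E X X q} (h : a.source = b.target) :
    (a.comp b).target = a.target := by
  rw [Jet.comp, target_jet, Function.comp_apply, Jet.rep_map, ← h, Jet.rep_map]

/-- For two invertible jets with the same source and the same target, there is a third one that
transforms the first into the second, and it has an inverse. -/
theorem exists_comp_eq {a b : Jet E E X X q} (ha : a ∈ fullJetGroupoid E X q)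
    (hb : b ∈ fullJetGroupoid E X q) (hs : a.source = b.source) (ht : a.target = b.target) :
    ∃ c ∈ fullJetGroupoid E X q, ∃ d ∈ fullJetGroupoid E X q, c.source = a.source ∧
      c.target = a.source ∧ d.source = a.source ∧ d.target = a.source ∧ a.comp c = b ∧
      c.comp d = jet E E q id a.source := by
  obtain ⟨f, x, hf, rfl⟩ := ha
  obtain ⟨h, y, hh, rfl⟩ := hb
  rw [source_jet, source_jet] at hs
  subst hs
  rw [target_jet, target_jet] at ht
  obtain ⟨hfs, f', hf', hff', hf'f⟩ := isLocalDiffeomorphAt_iff_exists_inverse.1 hf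
  obtain ⟨hhs, h', hh', hhh', hh'h⟩ := isLocalDiffeomorphAt_iff_exists_inverse.1 hh
  have lf' : IsLocalDiffeomorphAt 𝓘(ℝ, E) 𝓘(ℝ, E) ∞ f' (f x) := by
    refine isLocalDiffeomorphAt_iff_exists_inverse.2 ⟨hf', f, ?_, hf'f, ?_⟩ <;>
    rwa [hff'.self_of_nhds]
  have lh' : IsLocalDiffeomorphAt 𝓘(ℝ, E) 𝓘(ℝ, E) ∞ h' (h x) := by
    refine isLocalDiffeomorphAt_iff_exists_inverse.2 ⟨hh', h, ?_, hh'h, ?_⟩ <;>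
    rwa [hhh'.self_of_nhds]
  have e1 : f' (h x) = x := by rw [← ht]; exact hff'.self_of_nhds
  have e2 : h' (f x) = x := by rw [ht]; exact hhh'.self_of_nhds
  -- With `f` and `h` representing `a` and `b`, the required jets are those of `f⁻¹ ∘ h` and its
  -- inverse `h⁻¹ ∘ f`.
  have lc : IsLocalDiffeomorphAt 𝓘(ℝ, E) 𝓘(ℝ, E) ∞ (f' ∘ h) x := IsLocalDiffeomorphAt.comp (K := 𝓘(ℝ, E)) X hh (ht ▸ lf')
  have ld : IsLocalDiffeomorphAt 𝓘(ℝ, E) 𝓘(ℝ, E) ∞ (h' ∘ f) x := IsLocalDiffeomorphAt.comp (K := 𝓘(ℝ, E)) X hf (ht ▸ lh')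
  have sc := smoothNear_of_isLocalDiffeomorphAt lc
  have sd := smoothNear_of_isLocalDiffeomorphAt ld
  refine ⟨_, jet_mem_fullJetGroupoid lc, _, jet_mem_fullJetGroupoid ld, by simp, by simpa using e1,
    by simp, by simpa using e2, ?_, ?_⟩
  · have := Jet.comp_jet (r := q) (g := f) (f := f' ∘ h) (x := x)
      (by rw [Function.comp_apply, e1]; exact hfs) sc
    rw [Function.comp_apply, e1] at this
    rw [this]
    refine jet_congr ?_
    filter_upwards [hhs.self_of_nhds.continuousAt.eventually (by rw [← ht]; exact hf'f)] with z hz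
    exact hz
  · have := Jet.comp_jet (r := q) (g := f' ∘ h) (f := h' ∘ f) (x := x)
      (by rw [Function.comp_apply, e2]; exact sc) sd
    rw [Function.comp_apply, e2] at this
    rw [this, source_jet]
    refine jet_congr ?_
    filter_upwards [hfs.self_of_nhds.continuousAt.eventually (by rw [ht]; exact hh'h), hff']
      with z h1 h2
    simp only [Function.comp_apply, id_eq, h1, h2]

/-- A `0`-jet is a pair of points `(x, y)`. It is realized by the local diffeomorphism that is, in
charts around `x` and `y`, the translation by `ψ y - φ x`. -/
theorem fullJetGroupoid_zero : fullJetGroupoid E X 0 = univ := by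
  refine eq_univ_of_forall fun g => ?_
  set x := g.source with hx
  set y := g.target with hy
  set φ := chartAt E x
  set ψ := chartAt E y
  have mx : x ∈ φ.source := mem_chart_source E x
  have my : y ∈ ψ.source := mem_chart_source E y
  let a : E := ψ y - φ x
  let f : X → X := fun z => ψ.symm (φ z + a)
  let f' : X → X := fun z => φ.symm (ψ z - a)
  have ex : φ x + a = ψ y := by simp [a]
  have ey : ψ y - a = φ x := by simp [a]
  have fx : f x = y := by simp only [f, ex, ψ.left_inv my]
  have sf : SmoothNear E E f x :=
    (smoothAround_chartAt_symm (mem_chart_target E y)).comp_of_eq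
      (((contDiff_id.add contDiff_const).smoothAround _).comp_of_eq (smoothAround_chartAt mx) rfl) ex
  have sf' : SmoothNear E E f' y :=
    (smoothAround_chartAt_symm (mem_chart_target E x)).comp_of_eq
      (((contDiff_id.sub contDiff_const).smoothAround _).comp_of_eq (smoothAround_chartAt my) rfl) ey
  have hf : IsLocalDiffeomorphAt 𝓘(ℝ, E) 𝓘(ℝ, E) ∞ f x := by
    refine isLocalDiffeomorphAt_iff_exists_inverse.2 ⟨sf, f', by rwa [fx], ?_, ?_⟩
    · have h1 : ∀ᶠ z in 𝓝 x, φ z + a ∈ ψ.target :=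
        ((φ.continuousAt mx).add continuousAt_const).eventually
          (ψ.open_target.mem_nhds (by change φ x + a ∈ _; rw [ex]; exact mem_chart_target E y))
      filter_upwards [h1, φ.open_source.mem_nhds mx] with z h1 h2
      simp only [f, f', ψ.right_inv h1, add_sub_cancel_right, φ.left_inv h2]
    · rw [fx]
      have h1 : ∀ᶠ z in 𝓝 y, ψ z - a ∈ φ.target :=
        ((ψ.continuousAt my).sub continuousAt_const).eventually
          (φ.open_target.mem_nhds (by change ψ y - a ∈ _; rw [ey]; exact mem_chart_target E x))
      filter_upwards [h1, ψ.open_source.mem_nhds my] with z h1 h2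
      simp only [f, f', φ.right_inv h1, sub_add_cancel, ψ.left_inv h2]
  refine ⟨f, x, hf, ?_⟩
  conv_lhs => rw [← jet_rep g]
  rw [jet_eq_iff (chart_mem_atlas E x) (chart_mem_atlas E y) (smoothNear_rep g) sf mx
    (by rw [Jet.rep_map]; exact my)]
  refine ⟨by rw [Jet.rep_map, fx], fun k hk => ?_⟩
  obtain rfl := Nat.le_zero.1 hk
  ext v
  simp only [iteratedFDeriv_zero_apply, localRep]
  rw [φ.left_inv mx, Jet.rep_map, fx]

variable [CompleteSpace E]

/-- A jet of order at least `1` determines the first derivative in charts, and by the inverse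
function theorem this derivative decides whether the map is a local diffeomorphism. A `0`-jet
carries no such information. -/
theorem jet_mem_fullJetGroupoid_iff {f : X → X} {x : X} (hf : SmoothNear E E f x) (hq : 1 ≤ q) :
    jet E E q f x ∈ fullJetGroupoid E X q ↔ IsLocalDiffeomorphAt 𝓘(ℝ, E) 𝓘(ℝ, E) ∞ f x := by
  refine ⟨fun h => ?_, jet_mem_fullJetGroupoid⟩
  obtain ⟨h, hh, -, he⟩ := exists_localDiffeomorph_of_mem h
  rw [source_jet] at hh he
  have sh := smoothNear_of_isLocalDiffeomorphAt hh
  have mx := mem_chart_source E x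
  have my := mem_chart_source E (f x)
  obtain ⟨h0, h1⟩ := (jet_eq_iff (chart_mem_atlas E x) (chart_mem_atlas E (f x)) hf sh mx my).1 he
  rw [isLocalDiffeomorphAt_iff (chart_mem_atlas E x) (chart_mem_atlas E (f x)) hf mx my,
    ((h1.mono hq).fderiv (n := 0)).eq]
  exact (isLocalDiffeomorphAt_iff (chart_mem_atlas E x) (chart_mem_atlas E (f x)) sh mx
    (h0 ▸ my)).1 hh

/-- For `q ≥ 1` invertibility of a jet means invertibility of its linear coefficient in charts. This
coefficient is continuous in the jet and invertible operators form an open set. -/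
theorem isOpen_fullJetGroupoid : IsOpen (fullJetGroupoid E X q) := by
  rcases Nat.eq_zero_or_pos q with rfl | hq
  · rw [fullJetGroupoid_zero]; exact isOpen_univ
  rw [isOpen_iff_mem_nhds]
  intro j₀ hj₀
  obtain ⟨G, hG, hGj⟩ := exists_smooth_representatives j₀
  set φ := chartAt E j₀.source
  set ψ := chartAt E j₀.target
  have hφ : φ ∈ atlas E X := chart_mem_atlas E _
  have hψ : ψ ∈ atlas E X := chart_mem_atlas E _
  set c := chartAt (JetModel q E E) j₀
  have hc0 : j₀ ∈ c.source := mem_chart_source _ j₀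
  let Λ : Jet E E X X q → (E →L[ℝ] E) := fun j => continuousMultilinearCurryFin1 ℝ E E
    ((c j).2 ⟨1, by omega⟩ : E [×1]→L[ℝ] E)
  have hΛc : ContinuousAt Λ j₀ := by
    have h1 : Continuous fun z : JetModel q E E => (z.2 ⟨1, by omega⟩ : SymMap 1 E E) :=
      (contDiff_jetCoeff_apply (E := E) (V := E) (⟨1, by omega⟩ : Fin (q + 1))).continuous.comp
        continuous_snd
    have h2 : Continuous fun z : JetModel q E E => continuousMultilinearCurryFin1 ℝ E E
        (z.2 ⟨1, by omega⟩ : E [×1]→L[ℝ] E) :=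
      (continuousMultilinearCurryFin1 ℝ E E).continuous.comp (continuous_subtype_val.comp h1)
    exact h2.continuousAt.comp (c.continuousAt hc0)
  have key : ∀ᶠ j in 𝓝 j₀, (j ∈ fullJetGroupoid E X q ↔
      Λ j ∈ range ((↑) : (E ≃L[ℝ] E) → (E →L[ℝ] E))) := by
    filter_upwards [hGj, c.open_source.mem_nhds hc0] with j ⟨h1, h2⟩ h3
    have hx : j.source ∈ φ.source := h3.1
    have hy : G j j.source ∈ ψ.source := by
      have h4 : j.target ∈ ψ.source := h3.2
      rwa [← h2, target_jet] at h4
    have e : Λ j = fderiv ℝ (localRep φ ψ (G j)) (φ j.source) := by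
      have e1 : c j = (φ j.source, fun k : Fin (q + 1) =>
          symmetrize k (iteratedFDeriv ℝ k (localRep φ ψ (G j)) (φ j.source))) := by
        rw [← jetCoord_jet hφ hψ h1 hx hy, h2]; rfl
      ext v
      simp only [Λ, e1]
      rw [continuousMultilinearCurryFin1_apply,
        symmetrize_of_mem (symm_iteratedFDeriv_localRep hφ hψ h1 hx hy 1),
        iteratedFDeriv_one_apply]
      rfl
    rw [e, ← isLocalDiffeomorphAt_iff hφ hψ h1 hx hy, ← jet_mem_fullJetGroupoid_iff h1 hq, h2]
  filter_upwards [key, hΛc.eventually_mem (ContinuousLinearEquiv.isOpen.mem_nhds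
    (key.self_of_nhds.1 hj₀))] with j h1 h2 using h1.2 h2

theorem eventually_jet_mem_fullJetGroupoid {f : X → X} {x : X} (hf : SmoothNear E E f x)
    (h : jet E E q f x ∈ fullJetGroupoid E X q) :
    ∀ᶠ z in 𝓝 x, jet E E q f z ∈ fullJetGroupoid E X q :=
  (smoothNear_jet hf).self_of_nhds.continuousAt.eventually_mem (isOpen_fullJetGroupoid.mem_nhds h)

theorem jet_mem_fullJetGroupoid_of_le {f : X → X} {x : X} {m : ℕ} (hq : q ≤ m)
    (hf : SmoothNear E E f x) (h : jet E E m f x ∈ fullJetGroupoid E X m) :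
    jet E E q f x ∈ fullJetGroupoid E X q := by
  obtain ⟨h, hh, -, he⟩ := exists_localDiffeomorph_of_mem h
  rw [source_jet] at hh he
  rw [jet_eq_of_le hq hf (smoothNear_of_isLocalDiffeomorphAt hh) he]
  exact jet_mem_fullJetGroupoid hh

end Groupoid

/-! ### Images of smooth maps of constant rank. -/

section ConstantRank

set_option linter.unusedSectionVars false

variable {C V : Type*} [NormedAddCommGroup C] [NormedSpace ℝ C] [FiniteDimensional ℝ C]
  [NormedAddCommGroup V] [NormedSpace ℝ V] [FiniteDimensional ℝ V]

open MeasureTheory Module in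
/-- A smooth map whose rank is maximal at a point, but smaller than the dimension of the target,
maps a neighbourhood of this point to a null set. -/
theorem exists_nhds_image_null [MeasurableSpace V] [BorelSpace V] (μ : Measure V)
    [μ.IsAddHaarMeasure] {f : C → V} {a : C}
    (hf : ∀ᶠ x in 𝓝 a, ContDiffAt ℝ ∞ f x)
    (hr : ∀ᶠ x in 𝓝 a, finrank ℝ (fderiv ℝ f x).range ≤ finrank ℝ (fderiv ℝ f a).range)
    (hlt : finrank ℝ (fderiv ℝ f a).range < finrank ℝ V) :
    ∃ N ∈ 𝓝 a, μ (f '' N) = 0 := by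
  set L := fderiv ℝ f a with hL
  set R := L.range with hR
  set K := L.ker
  obtain ⟨P, hP⟩ := Submodule.ClosedComplemented.of_finiteDimensional (𝕜 := ℝ) R
  obtain ⟨Q, hQ⟩ := Submodule.ClosedComplemented.of_finiteDimensional (𝕜 := ℝ) K
  -- These are the straightening coordinates of the constant rank theorem: `P` projects onto the
  -- range of the derivative `L` at `a`, `Q` onto its kernel. The derivative of `Θ` at `a` is
  -- injective, and rank plus nullity makes it bijective.
  let Θ : C → R × K := fun x => (P (f x), Q x)
  have hΘs : SmoothAround 𝓘(ℝ, C) 𝓘(ℝ, R × K) Θ a := by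
    filter_upwards [hf] with x hx
    exact ((P.contDiff.contDiffAt.comp x hx).prodMk Q.contDiff.contDiffAt).contMDiffAt
  have hΘd : ∀ x, ContDiffAt ℝ ∞ f x → HasFDerivAt Θ ((P ∘L fderiv ℝ f x).prod Q) x := fun x hx =>
    (P.hasFDerivAt.comp x (hx.differentiableAt (by simp)).hasFDerivAt).prodMk Q.hasFDerivAt
  have hfa := hf.self_of_nhds
  have hinv : fderiv ℝ Θ a ∈ range ((↑) : (C ≃L[ℝ] (R × K)) → (C →L[ℝ] (R × K))) := by
    rw [(hΘd a hfa).fderiv]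
    have hinj : Function.Injective ((P ∘L L).prod Q : C →L[ℝ] R × K) := by
      rw [injective_iff_map_eq_zero]
      intro v hv
      have h1 : P (L v) = 0 := congrArg Prod.fst hv
      have h2 : Q v = 0 := congrArg Prod.snd hv
      have h3 := hP ⟨L v, v, rfl⟩
      rw [h1] at h3
      have h4 : L v = 0 := (congrArg Subtype.val h3).symm
      have h5 := hQ ⟨v, h4⟩
      rw [h2] at h5
      exact (congrArg Subtype.val h5).symm
    have hdim : finrank ℝ C = finrank ℝ (R × K) := by
      rw [finrank_prod]
      exact (LinearMap.finrank_range_add_finrank_ker (L : C →ₗ[ℝ] V)).symm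
    exact ⟨(LinearEquiv.ofInjectiveOfFinrankEq ((P ∘L L).prod Q : C →L[ℝ] R × K).toLinearMap hinj
      hdim).toContinuousLinearEquiv, by ext1 v; rfl⟩
  obtain ⟨ξ, hξ, hξΘ, hΘξ⟩ := exists_smooth_localInverse hΘs hinv
  have hξc := hξ.continuousAt
  rw [ContinuousAt, hξΘ.self_of_nhds] at hξc
  -- Differentiating `Θ ∘ ξ = id` gives `P (A (B u)) = u.1`, so `P` maps the range of `A` onto `R`.
  -- As the rank of `A` is at most the dimension of `R`, this map is also injective, and `P (A (B
  -- (0, κ))) = 0` forces `A (B (0, κ)) = 0`.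
  have good : ∀ᶠ w in 𝓝 (Θ a), ContDiffAt ℝ ∞ ξ w ∧ ContDiffAt ℝ ∞ f (ξ w) ∧
      ∀ κ : K, fderiv ℝ f (ξ w) (fderiv ℝ ξ w (0, κ)) = 0 := by
    filter_upwards [hξ, hΘξ.eventually_nhds, hξc.eventually hf, hξc.eventually hr]
      with w h1 h2 h3 h4
    refine ⟨h1.contDiffAt, h3, fun κ => ?_⟩
    set A := fderiv ℝ f (ξ w)
    set B := fderiv ℝ ξ w
    have hB : HasFDerivAt ξ B w := (h1.contDiffAt.differentiableAt (by simp)).hasFDerivAt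
    have hcomp : HasFDerivAt (id : R × K → R × K) _ w :=
      ((hΘd (ξ w) h3).comp w hB).congr_of_eventuallyEq
        (by filter_upwards [h2] with v hv using hv.symm)
    have hid := hcomp.unique (hasFDerivAt_id w)
    have hPAB : ∀ u : R × K, P (A (B u)) = u.1 := fun u =>
      congrArg (fun T : (R × K) →L[ℝ] (R × K) => (T u).1) hid
    let T : A.range →ₗ[ℝ] R := P.toLinearMap.comp A.range.subtype
    have hT : Function.Surjective T := fun y =>
      ⟨⟨A (B (y, 0)), _, rfl⟩, hPAB (y, 0)⟩
    have hTi : Function.Injective T := by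
      have h5 : finrank ℝ A.range = finrank ℝ R :=
        le_antisymm h4 (LinearMap.finrank_le_finrank_of_surjective hT)
      exact (LinearMap.injective_iff_surjective_of_finrank_eq_finrank h5).2 hT
    have h6 : (⟨A (B (0, κ)), _, rfl⟩ : A.range) = 0 := by
      apply hTi
      rw [map_zero]
      exact hPAB (0, κ)
    exact congrArg Subtype.val h6
  obtain ⟨ε, hε, hball⟩ := Metric.eventually_nhds_iff_ball.1 good
  have mem : ∀ y ∈ Metric.ball (Θ a).1 ε, ∀ κ ∈ Metric.ball (Θ a).2 ε,
      (y, κ) ∈ Metric.ball (Θ a) ε := fun y hy κ hκ => by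
    rw [← ball_prod_same]
    exact ⟨hy, hκ⟩
  -- In the coordinates `(y, κ)` the map does not depend on `κ`, because its derivative in this
  -- direction vanishes on a ball.
  have hconst : ∀ y ∈ Metric.ball (Θ a).1 ε, ∀ κ ∈ Metric.ball (Θ a).2 ε,
      f (ξ (y, κ)) = f (ξ (y, (Θ a).2)) := by
    intro y hy κ hκ
    have hd : ∀ κ ∈ Metric.ball (Θ a).2 ε,
        HasFDerivAt (fun κ : K => f (ξ (y, κ))) (0 : K →L[ℝ] V) κ := by
      intro κ hκ
      obtain ⟨h1, h2, h3⟩ := hball _ (mem y hy κ hκ)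
      have h4 := (h2.differentiableAt (by simp)).hasFDerivAt.comp κ
        ((h1.differentiableAt (by simp)).hasFDerivAt.comp κ (hasFDerivAt_prodMk_right y κ))
      have h5 : fderiv ℝ f (ξ (y, κ)) ∘L fderiv ℝ ξ (y, κ) ∘L ContinuousLinearMap.inr ℝ R K = 0 := by
        ext1 v
        exact h3 v
      rwa [h5] at h4
    exact (convex_ball (Θ a).2 ε).is_const_of_fderivWithin_eq_zero (𝕜 := ℝ)
      (fun κ hκ => (hd κ hκ).differentiableAt.differentiableWithinAt)
      (fun κ hκ => by
        rw [fderivWithin_of_isOpen Metric.isOpen_ball hκ]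
        exact (hd κ hκ).fderiv) hκ (Metric.mem_ball_self hε)
  refine ⟨{x | ξ (Θ x) = x ∧ Θ x ∈ Metric.ball (Θ a) ε}, ?_, ?_⟩
  · exact Filter.inter_mem hξΘ (hΘs.continuousAt.eventually_mem (Metric.ball_mem_nhds _ hε))
  -- The image is parametrized by `y ↦ f (ξ (y, κ₀))` with `κ₀ = (Θ a).2`. Composing with `P`
  -- extends this to an open subset of `V`; now source and target coincide, and the image is null if
  -- the determinant of the derivative vanishes.
  let h : V → V := fun v => f (ξ (P v, (Θ a).2))
  let S : Set V := P ⁻¹' Metric.ball (Θ a).1 ε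
  let h' : V → (V →L[ℝ] V) := fun v => (fderiv ℝ f (ξ (P v, (Θ a).2)) ∘L
    fderiv ℝ ξ (P v, (Θ a).2)) ∘L (ContinuousLinearMap.inl ℝ R K ∘L P)
  have hder : ∀ v ∈ S, HasFDerivWithinAt h (h' v) S v := by
    intro v hv
    obtain ⟨h1, h2, -⟩ := hball _ (mem _ hv _ (Metric.mem_ball_self hε))
    have h3 : HasFDerivAt (fun v : V => (P v, (Θ a).2)) (ContinuousLinearMap.inl ℝ R K ∘L P) v :=
      (hasFDerivAt_prodMk_left (P v) (Θ a).2).comp v P.hasFDerivAt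
    exact (HasFDerivAt.comp v ((h2.differentiableAt (by simp)).hasFDerivAt.comp _
      (h1.differentiableAt (by simp)).hasFDerivAt) h3).hasFDerivWithinAt
  -- The derivative factors through `P`, which has a nonzero kernel since the rank is smaller than
  -- the dimension of `V`.
  have hdet : ∀ v ∈ S, (h' v).det = 0 := by
    intro v _
    have hk : P.toLinearMap.ker ≠ ⊥ := LinearMap.ker_ne_bot_of_finrank_lt hlt
    obtain ⟨w, hw, hw0⟩ := (Submodule.ne_bot_iff _).1 hk
    have hw' : P w = 0 := hw
    by_contra hne
    have h7 : (h' v) w = 0 := by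
      change fderiv ℝ f _ (fderiv ℝ ξ _ (P w, (0 : K))) = 0
      rw [hw', Prod.mk_zero_zero, map_zero, map_zero]
    exact hw0 ((LinearMap.equivOfDetNeZero (h' v).toLinearMap hne).injective
      (by rw [map_zero]; exact h7))
  refine measure_mono_null ?_ (addHaar_image_eq_zero_of_det_fderivWithin_eq_zero μ hder hdet)
  rintro _ ⟨x, ⟨hx1, hx2⟩, rfl⟩
  rw [← ball_prod_same] at hx2
  refine ⟨((Θ x).1 : V), ?_, ?_⟩
  · exact mem_preimage.2 (by rw [hP]; exact hx2.1)
  · change f (ξ (P ((Θ x).1 : V), (Θ a).2)) = f x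
    rw [hP, ← hconst _ hx2.1 _ hx2.2, Prod.mk.eta, hx1]

open MeasureTheory Module in
/-- A smooth map of constant rank on an open set is a submersion if its image has an interior
point. -/
theorem range_fderiv_eq_top_of_constant_rank {f : C → V} {O : Set C} (hO : IsOpen O)
    (hf : ∀ x ∈ O, ContDiffAt ℝ ∞ f x)
    (hr : ∀ x ∈ O, ∀ y ∈ O, finrank ℝ (fderiv ℝ f x).range ≤ finrank ℝ (fderiv ℝ f y).range)
    (hi : (interior (f '' O)).Nonempty) {a : C} (ha : a ∈ O) : (fderiv ℝ f a).range = ⊤ := by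
  by_contra hne
  borelize V
  let μ : Measure V := Measure.addHaar
  have hlt : finrank ℝ (fderiv ℝ f a).range < finrank ℝ V := Submodule.finrank_lt hne
  -- The set function `A ↦ μ (f '' A)` is an outer measure on `C`. It vanishes near every point of
  -- `O`, hence on `O`, since countably many such neighbourhoods cover it.
  have h0 : (OuterMeasure.comap f μ.toOuterMeasure) O = 0 := by
    refine measure_null_of_locally_null O fun x hx => ?_
    obtain ⟨N, hN, hN0⟩ := exists_nhds_image_null μ (f := f) (a := x)
      (by filter_upwards [hO.mem_nhds hx] with y hy using hf y hy)
      (by filter_upwards [hO.mem_nhds hx] with y hy using hr y hy x hx)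
      ((hr x hx a ha).trans_lt hlt)
    exact ⟨N, mem_nhdsWithin_of_mem_nhds hN, hN0⟩
  have h1 : μ (f '' O) = 0 := h0
  exact (isOpen_interior.measure_pos μ hi).ne' (measure_mono_null interior_subset h1)

end ConstantRank

/-! ### The action of the groupoid on jets of sections. -/

section InducedAction

set_option linter.unusedSectionVars false

variable {E EM : Type*} [NormedAddCommGroup E] [NormedSpace ℝ E] [CompleteSpace E]
  [NormedAddCommGroup EM] [NormedSpace ℝ EM]
  {X : Type*} {M : Type u} [TopologicalSpace X] [ChartedSpace E X] [IsManifold 𝓘(ℝ, E) ∞ X]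
  [TopologicalSpace M] [ChartedSpace EM M] [IsManifold 𝓘(ℝ, EM) ∞ M]
  {π : M → X} {q r : ℕ} {act : M → Jet E E X X q → M}

theorem mem_jetBundle_iff {j : Jet E EM X M r} : j ∈ jetBundle r π univ ↔
    ∃ σ : X → M, SmoothNear E EM σ j.source ∧ (∀ᶠ y in 𝓝 j.source, π (σ y) = y) ∧
      jet E EM r σ j.source = j := by
  constructor
  · rintro ⟨σ, x, h1, h2, rfl⟩
    exact ⟨σ, by simpa using h1, by simpa using h2, by simp⟩
  · rintro ⟨σ, h1, h2, h3⟩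
    exact ⟨σ, _, h1, h2.mono fun y hy => ⟨mem_univ _, hy⟩, h3.symm⟩

theorem jet_mem_jetBundle {σ : X → M} {x : X} (h : SmoothNear E EM σ x)
    (hσ : ∀ᶠ y in 𝓝 x, π (σ y) = y) : jet E EM r σ x ∈ jetBundle r π univ :=
  mem_jetBundle_iff.2 ⟨σ, by simpa using h, by simpa using hσ, by simp⟩

theorem IsSmoothFiberBundle.continuous_proj (h : IsSmoothFiberBundle E EM π univ) :
    Continuous π := continuousOn_univ.1 h.contMDiffOn_proj.continuousOn

/-- Locally, the action extends to a smooth map defined on an open set of pairs. -/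
theorem IsNaturalBundle.exists_act_extension (hZ : IsNaturalBundle E EM q π univ act) {u₀ : M}
    {g₀ : Jet E E X X q} (hg₀ : g₀ ∈ fullJetGroupoid E X q) (h : π u₀ = g₀.target) :
    ∃ A : M × Jet E E X X q → M,
      SmoothAround (𝓘(ℝ, EM).prod 𝓘(ℝ, JetModel q E E)) 𝓘(ℝ, EM) A (u₀, g₀) ∧
      ∀ᶠ w in 𝓝 (u₀, g₀), π w.1 = w.2.target → act w.1 w.2 = A w := by
  have hπ := hZ.isSmoothFiberBundle.continuous_proj
  obtain ⟨V, _, _, _, F, _, _, _, htriv⟩ := hZ.isSmoothFiberBundle.locally_trivial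
  obtain ⟨U, hU, hxU, Φ, Ψ, hΦ, hΨ, hΨΦ, hΦΨ⟩ := htriv (π u₀)
  have sΦ : SmoothAround 𝓘(ℝ, EM) 𝓘(ℝ, V) Φ u₀ := by
    refine SmoothAround.of_contMDiffOn hΦ ?_
    rw [univ_inter]
    exact (hU.preimage hπ).mem_nhds hxU
  have st : SmoothAround (𝓘(ℝ, EM).prod 𝓘(ℝ, JetModel q E E)) 𝓘(ℝ, E)
      (fun w : M × Jet E E X X q => w.2.target) (u₀, g₀) :=
    (smoothAround_target g₀).comp_of_eq (SmoothAround.snd _) rfl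
  have et : ∀ᶠ w : M × Jet E E X X q in 𝓝 (u₀, g₀), w.2.target ∈ U :=
    st.continuousAt.eventually_mem (hU.mem_nhds (h ▸ hxU))
  have sΨ : SmoothAround (𝓘(ℝ, EM).prod 𝓘(ℝ, JetModel q E E)) 𝓘(ℝ, EM)
      (fun w : M × Jet E E X X q => Ψ (w.2.target, Φ w.1)) (u₀, g₀) := by
    refine SmoothAround.contMDiffOn_comp hΨ
      (f := fun w : M × Jet E E X X q => (w.2.target, Φ w.1))
      (st.prodMk (sΦ.comp_of_eq (SmoothAround.fst _) rfl)) ?_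
    filter_upwards [et] with w hw using ⟨hw, mem_univ _⟩
  -- The point `u` is moved to the fibre over the target of `g` while its fibre coordinate is kept.
  -- Every nearby pair becomes composable in this way, and a composable pair is unchanged.
  refine ⟨fun w => act (Ψ (w.2.target, Φ w.1)) w.2, ?_, ?_⟩
  · refine SmoothAround.contMDiffOn_comp hZ.isGroupoidAction.contMDiffOn_act
      (f := fun w : M × Jet E E X X q => (Ψ (w.2.target, Φ w.1), w.2))
      (sΨ.prodMk (SmoothAround.snd _)) ?_
    filter_upwards [et, continuousAt_snd.eventually_mem (isOpen_fullJetGroupoid.mem_nhds hg₀)]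
      with w h1 h2
    exact ⟨mem_univ _, h2, (hΨΦ _ h1 _).2.1⟩
  · filter_upwards [et] with w h1 h2
    rw [← h2, hΦΨ w.1 (mem_univ _) (h2 ▸ h1)]

theorem IsNaturalBundle.smoothNear_act (hZ : IsNaturalBundle E EM q π univ act) {σ : X → M}
    {f : X → X} {x : X} (hf : SmoothNear E E f x) (hfx : jet E E q f x ∈ fullJetGroupoid E X q)
    (hσ : SmoothNear E EM σ (f x)) (hπ : ∀ᶠ y in 𝓝 (f x), π (σ y) = y) :
    SmoothNear E EM (fun z => act (σ (f z)) (jet E E q f z)) x ∧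
      ∀ᶠ z in 𝓝 x, π (act (σ (f z)) (jet E E q f z)) = z := by
  have h1 : ∀ᶠ z in 𝓝 x, jet E E q f z ∈ fullJetGroupoid E X q ∧
      π (σ (f z)) = (jet E E q f z).target := by
    filter_upwards [eventually_jet_mem_fullJetGroupoid hf hfx,
      hf.self_of_nhds.continuousAt.eventually hπ] with z h1 h2
    exact ⟨h1, by rw [h2, target_jet]⟩
  constructor
  · refine SmoothAround.contMDiffOn_comp hZ.isGroupoidAction.contMDiffOn_act
      (f := fun z => (σ (f z), jet E E q f z))
      ((SmoothAround.comp hσ hf).prodMk (smoothNear_jet hf)) ?_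
    filter_upwards [h1] with z hz using ⟨mem_univ _, hz⟩
  · filter_upwards [h1] with z hz
    rw [(hZ.isGroupoidAction.act_mem _ (mem_univ _) _ hz.1 hz.2).2, source_jet]

/-- The map `A` is smooth on an open set, so the chain rule applies. The maps `σ₁` and `σ₂` need not
be sections; this matters later, when they are replaced by polynomial representatives. -/
theorem jet_extension_congr {A : M × Jet E E X X q → M} {σ₁ σ₂ : X → M} {f₁ f₂ : X → X} {x : X}
    (hf₁ : SmoothNear E E f₁ x) (hf₂ : SmoothNear E E f₂ x)
    (hf : jet E E (q + r) f₁ x = jet E E (q + r) f₂ x)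
    (hσ₁ : SmoothNear E EM σ₁ (f₁ x)) (hσ₂ : SmoothNear E EM σ₂ (f₁ x))
    (hσ : jet E EM r σ₁ (f₁ x) = jet E EM r σ₂ (f₁ x))
    (hA : SmoothAround (𝓘(ℝ, EM).prod 𝓘(ℝ, JetModel q E E)) 𝓘(ℝ, EM) A
      (σ₁ (f₁ x), jet E E q f₁ x)) :
    jet E EM r (fun z => A (σ₁ (f₁ z), jet E E q f₁ z)) x =
      jet E EM r (fun z => A (σ₂ (f₂ z), jet E E q f₂ z)) x := by
  have e := target_eq_of_jet_eq hf
  refine jet_family_congr (H := fun w : X × M × Jet E E X X q => A (w.2.1, w.2.2))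
    (f₁ := fun z => σ₁ (f₁ z)) (f₂ := fun z => σ₂ (f₂ z)) (g₁ := fun z => jet E E q f₁ z)
    (g₂ := fun z => jet E E q f₂ z)
    (SmoothAround.comp hσ₁ hf₁) (SmoothAround.comp (g := σ₂) (e ▸ hσ₂) hf₂) (smoothNear_jet hf₁)
    (smoothNear_jet hf₂) ?_ (jet_jet_congr hf₁ hf₂ hf) ?_
  · exact jet_comp_congr rfl hσ₁ hσ₂ hf₁ hf₂ hσ (jet_eq_of_le (Nat.le_add_left r q) hf₁ hf₂ hf)
  · exact hA.comp_of_eq (SmoothAround.snd _) rfl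

/-- The jet of `z ↦ σ(f(z)) (j_z^q f)`, computed with a local extension of the action. -/
theorem jet_act_eq {A : M × Jet E E X X q → M} {σ : X → M} {f : X → X} {x : X}
    (hf : SmoothNear E E f x) (hσ : SmoothNear E EM σ (f x))
    (hπ : ∀ᶠ y in 𝓝 (f x), π (σ y) = y)
    (hA : ∀ᶠ w in 𝓝 (σ (f x), jet E E q f x), π w.1 = w.2.target → act w.1 w.2 = A w) :
    jet E EM r (fun z => act (σ (f z)) (jet E E q f z)) x =
      jet E EM r (fun z => A (σ (f z), jet E E q f z)) x := by
  refine jet_congr ?_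
  have hc : ContinuousAt (fun z => (σ (f z), jet E E q f z)) x :=
    ((SmoothAround.comp hσ hf).continuousAt).prodMk
      (smoothNear_jet hf).self_of_nhds.continuousAt
  filter_upwards [hc.eventually hA, hf.self_of_nhds.continuousAt.eventually hπ] with z h1 h2
  exact h1 (by rw [h2, target_jet])

/-- This is the well-definedness of the induced action. Both sides involve the same point and the
same `q`-jet at `x`, so a single local extension `A` of the action computes both. -/
theorem IsNaturalBundle.jet_act_congr (hZ : IsNaturalBundle E EM q π univ act) {σ₁ σ₂ : X → M}
    {f₁ f₂ : X → X} {x : X}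
    (hf₁ : SmoothNear E E f₁ x) (hf₂ : SmoothNear E E f₂ x)
    (hf : jet E E (q + r) f₁ x = jet E E (q + r) f₂ x)
    (hfx : jet E E (q + r) f₁ x ∈ fullJetGroupoid E X (q + r))
    (hσ₁ : SmoothNear E EM σ₁ (f₁ x)) (hσ₂ : SmoothNear E EM σ₂ (f₁ x))
    (hπ₁ : ∀ᶠ y in 𝓝 (f₁ x), π (σ₁ y) = y) (hπ₂ : ∀ᶠ y in 𝓝 (f₁ x), π (σ₂ y) = y)
    (hσ : jet E EM r σ₁ (f₁ x) = jet E EM r σ₂ (f₁ x)) :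
    jet E EM r (fun z => act (σ₁ (f₁ z)) (jet E E q f₁ z)) x =
      jet E EM r (fun z => act (σ₂ (f₂ z)) (jet E E q f₂ z)) x := by
  have e := target_eq_of_jet_eq hf
  have eσ := target_eq_of_jet_eq hσ
  have ej : jet E E q f₁ x = jet E E q f₂ x := jet_eq_of_le (Nat.le_add_right q r) hf₁ hf₂ hf
  obtain ⟨A, hA, hAact⟩ := hZ.exists_act_extension (u₀ := σ₁ (f₁ x))
    (jet_mem_fullJetGroupoid_of_le (Nat.le_add_right q r) hf₁ hfx)
    (by rw [hπ₁.self_of_nhds, target_jet])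
  rw [jet_act_eq hf₁ hσ₁ hπ₁ hAact, jet_act_eq (A := A) hf₂ (e ▸ hσ₂) (e ▸ hπ₂)
    (by rwa [← e, ← eσ, ← ej]), jet_extension_congr hf₁ hf₂ hf hσ₁ hσ₂ hσ hA]

variable (π r act) in
open Classical in
/-- The operation of `Π_{q+r}` on `r`-jets of sections induced by the operation `act` of `Π_q`. -/
def inducedAct (j : Jet E EM X M r) (g : Jet E E X X (q + r)) : Jet E EM X M r :=
  if h : j ∈ jetBundle r π univ then
    jet E EM r (fun z => act ((mem_jetBundle_iff.1 h).choose (g.rep.map z))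
      (jet E E q g.rep.map z)) g.source
  else j

theorem IsNaturalBundle.isInducedAction_inducedAct (hZ : IsNaturalBundle E EM q π univ act) :
    IsInducedAction (EM := EM) r π act (inducedAct π r act) := by
  intro σ f x hf hfx hσ hπ
  have h := jet_mem_jetBundle (r := r) hσ hπ
  rw [inducedAct, dif_pos h]
  have spec := (mem_jetBundle_iff.1 h).choose_spec
  generalize (mem_jetBundle_iff.1 h).choose = τ at spec ⊢
  rw [source_jet] at spec ⊢
  obtain ⟨h1, h2, h3⟩ := spec
  exact (hZ.jet_act_congr hf (smoothNear_rep_jet f x) (jet_rep_jet f x).symm hfx hσ h1 hπ h2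
    h3.symm).symm

theorem IsNaturalBundle.isGroupoidAction_induced (hZ : IsNaturalBundle E EM q π univ act)
    {act' : Jet E EM X M r → Jet E E X X (q + r) → Jet E EM X M r}
    (hact : IsInducedAction r π act act') :
    IsGroupoidAction E (JetModel r E EM) (q + r) Jet.source (jetBundle r π univ) act' := by
  -- Each composable pair is represented by a section and a local diffeomorphism, and on these the
  -- product is given by the defining formula.
  have form : ∀ u ∈ jetBundle r π univ, ∀ g ∈ fullJetGroupoid E X (q + r), u.source = g.target →
      ∃ (σ : X → M) (f : X → X), SmoothNear E EM σ (f g.source) ∧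
        (∀ᶠ y in 𝓝 (f g.source), π (σ y) = y) ∧
        IsLocalDiffeomorphAt 𝓘(ℝ, E) 𝓘(ℝ, E) ∞ f g.source ∧
        u = jet E EM r σ (f g.source) ∧ g = jet E E (q + r) f g.source ∧
        act' u g = jet E EM r (fun z => act (σ (f z)) (jet E E q f z)) g.source := by
    intro u hu g hg h
    obtain ⟨σ, hσ, hπ, hu⟩ := mem_jetBundle_iff.1 hu
    obtain ⟨f, hf, hft, hgf⟩ := exists_localDiffeomorph_of_mem hg
    rw [h, ← hft] at hσ hπ hu
    refine ⟨σ, f, hσ, hπ, hf, hu.symm, hgf, ?_⟩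
    rw [← hact σ f g.source (smoothNear_of_isLocalDiffeomorphAt hf) (hgf ▸ hg) hσ hπ, hu, ← hgf]
  refine ⟨?_, ?_, ?_, ?_⟩
  · rintro ⟨j₀, g₀⟩ ⟨hj₀, hg₀, h₀⟩
    dsimp only at hj₀ hg₀ h₀
    obtain ⟨G, hG, hGj⟩ := exists_smooth_representatives j₀
    obtain ⟨K, hK, hKg⟩ := exists_smooth_representatives g₀
    have eg₀ : K g₀ g₀.source = g₀.target := by
      rw [← target_jet (E := E) (E' := E) (r := q + r) (K g₀) g₀.source, hKg.self_of_nhds.2]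
    have ej₀ : G j₀ j₀.source = j₀.target := by
      rw [← target_jet (E := E) (E' := EM) (r := r) (G j₀) j₀.source, hGj.self_of_nhds.2]
    have hπj₀ : π j₀.target = j₀.source := by
      obtain ⟨σ, -, hπ, hj⟩ := mem_jetBundle_iff.1 hj₀
      conv_lhs => rw [← hj, target_jet]
      exact hπ.self_of_nhds
    obtain ⟨A, hA, hAact⟩ := hZ.exists_act_extension (u₀ := j₀.target)
      (g₀ := jet E E q (K g₀) g₀.source)
      (jet_mem_fullJetGroupoid_of_le (Nat.le_add_right q r) hKg.self_of_nhds.1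
        (by rwa [hKg.self_of_nhds.2])) (by rw [target_jet, eg₀, ← h₀, hπj₀])
    let I := 𝓘(ℝ, JetModel r E EM).prod 𝓘(ℝ, JetModel (q + r) E E)
    have ssrc : SmoothAround I 𝓘(ℝ, E)
        (fun p : Jet E EM X M r × Jet E E X X (q + r) => p.2.source) (j₀, g₀) :=
      (smoothAround_source g₀).comp_of_eq (SmoothAround.snd _) rfl
    have stgt : SmoothAround I 𝓘(ℝ, EM)
        (fun p : Jet E EM X M r × Jet E E X X (q + r) => p.1.target) (j₀, g₀) :=
      (smoothAround_target j₀).comp_of_eq (SmoothAround.fst _) rfl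
    have sK : SmoothAround (I.prod 𝓘(ℝ, E)) 𝓘(ℝ, E)
        (fun w : (Jet E EM X M r × Jet E E X X (q + r)) × X => K w.1.2 w.2)
        ((j₀, g₀), g₀.source) :=
      hK.comp_of_eq (f := fun w : (Jet E EM X M r × Jet E E X X (q + r)) × X => (w.1.2, w.2))
        (((SmoothAround.snd _).comp_of_eq (SmoothAround.fst _) rfl).prodMk (SmoothAround.snd _)) rfl
    have sG : SmoothAround (I.prod 𝓘(ℝ, E)) 𝓘(ℝ, EM)
        (fun w : (Jet E EM X M r × Jet E E X X (q + r)) × X => G w.1.1 (K w.1.2 w.2))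
        ((j₀, g₀), g₀.source) :=
      hG.comp_of_eq
        (f := fun w : (Jet E EM X M r × Jet E E X X (q + r)) × X => (w.1.1, K w.1.2 w.2))
        (((SmoothAround.fst _).comp_of_eq (SmoothAround.fst _) rfl).prodMk sK) (by
          rw [h₀, ← eg₀])
    have sJ : SmoothAround (I.prod 𝓘(ℝ, E)) 𝓘(ℝ, JetModel q E E)
        (fun w : (Jet E EM X M r × Jet E E X X (q + r)) × X => jet E E q (K w.1.2) w.2)
        ((j₀, g₀), g₀.source) :=
      smoothAround_jet (G := fun w : (Jet E EM X M r × Jet E E X X (q + r)) × X => K w.1.2)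
        (b := fun w => w.2)
        (sK.comp_of_eq (((SmoothAround.fst _).comp_of_eq (SmoothAround.fst _) rfl).prodMk
          (SmoothAround.snd _)) rfl) (SmoothAround.snd _)
    -- The maps `G p.1` are smooth representatives of jets of sections but need not be sections, so
    -- the product is formed with the extension `A` instead of `act`.
    have sB : SmoothAround I 𝓘(ℝ, JetModel r E EM)
        (fun p : Jet E EM X M r × Jet E E X X (q + r) =>
          jet E EM r (fun z => A (G p.1 (K p.2 z), jet E E q (K p.2) z)) p.2.source) (j₀, g₀) :=
      smoothAround_jet
        (G := fun p : Jet E EM X M r × Jet E E X X (q + r) => fun z =>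
          A (G p.1 (K p.2 z), jet E E q (K p.2) z))
        (b := fun p => p.2.source) (hA.comp_of_eq (sG.prodMk sJ) (by rw [eg₀, ← h₀, ej₀])) ssrc
    have cA : ContinuousAt (fun p : Jet E EM X M r × Jet E E X X (q + r) =>
        (p.1.target, jet E E q (K p.2) p.2.source)) (j₀, g₀) :=
      stgt.continuousAt.prodMk
        (sJ.comp_of_eq (f := fun p : Jet E EM X M r × Jet E E X X (q + r) => (p, p.2.source))
          ((SmoothAround.id _).prodMk ssrc) rfl).continuousAt
    -- Along the set of composable pairs, the smooth family just constructed coincides with `act'`: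
    -- both are computed by `A`, from representatives with the same jets.
    refine sB.contMDiffAt.contMDiffWithinAt.congr_of_eventuallyEq_of_mem ?_ ⟨hj₀, hg₀, h₀⟩
    filter_upwards [self_mem_nhdsWithin, mem_nhdsWithin_of_mem_nhds (continuousAt_fst.eventually hGj),
      mem_nhdsWithin_of_mem_nhds (continuousAt_snd.eventually hKg),
      mem_nhdsWithin_of_mem_nhds (cA.eventually hA.eventually),
      mem_nhdsWithin_of_mem_nhds (cA.eventually hAact.eventually_nhds)]
    rintro ⟨j, g⟩ ⟨hj, hg, h⟩ ⟨h1, h1'⟩ ⟨h2, h2'⟩ h3 h4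
    dsimp only at hj hg h h1 h1' h2 h2' h3 h4
    obtain ⟨σ, f, hσ, hπ, hf, hjσ, hgf, he⟩ := form j hj g hg h
    have sf := smoothNear_of_isLocalDiffeomorphAt hf
    have ef : jet E E (q + r) f g.source = jet E E (q + r) (K g) g.source := by rw [h2', ← hgf]
    have eσ : σ (f g.source) = j.target := by rw [hjσ, target_jet]
    have ej : jet E E q f g.source = jet E E q (K g) g.source :=
      jet_eq_of_le (Nat.le_add_right q r) sf h2 ef
    have hs : j.source = f g.source := by rw [hjσ, source_jet]
    change act' j g = jet E EM r (fun z => A (G j (K g z), jet E E q (K g) z)) g.source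
    rw [he, jet_act_eq (A := A) sf hσ hπ (by rwa [eσ, ej])]
    rw [hs] at h1 h1'
    exact jet_extension_congr sf h2 ef hσ h1 (by rw [h1', ← hjσ]) (by rwa [eσ, ej])
  · intro u hu g hg h
    obtain ⟨σ, f, hσ, hπ, hf, -, hgf, he⟩ := form u hu g hg h
    have sf := smoothNear_of_isLocalDiffeomorphAt hf
    obtain ⟨h1, h2⟩ := hZ.smoothNear_act sf (jet_mem_fullJetGroupoid hf) hσ hπ
    rw [he, source_jet]
    exact ⟨jet_mem_jetBundle h1 h2, rfl⟩
  · intro u hu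
    obtain ⟨σ, hσ, hπ, hjσ⟩ := mem_jetBundle_iff.1 hu
    have h := hact σ id u.source (SmoothAround.id _) (jet_id_mem_fullJetGroupoid _) hσ hπ
    rw [id, hjσ] at h
    rw [h]
    refine Eq.trans (jet_congr ?_) hjσ
    filter_upwards [hπ] with z hz
    have := hZ.isGroupoidAction.act_one (σ z) (mem_univ _)
    rwa [hz] at this
  · intro u hu a ha b hb h1 h2
    obtain ⟨σ, f, hσ, hπ, hf, huσ, haf, hea⟩ := form u hu a ha h1
    obtain ⟨g, hg, hgt, hbg⟩ := exists_localDiffeomorph_of_mem hb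
    have sf := smoothNear_of_isLocalDiffeomorphAt hf
    have sg := smoothNear_of_isLocalDiffeomorphAt hg
    rw [h2, ← hgt] at hσ hπ hf huσ haf hea sf
    have lfg : IsLocalDiffeomorphAt 𝓘(ℝ, E) 𝓘(ℝ, E) ∞ (f ∘ g) b.source :=
      IsLocalDiffeomorphAt.comp 𝓘(ℝ, E) X hg hf
    have sfg := smoothNear_of_isLocalDiffeomorphAt lfg
    have ecomp : a.comp b = jet E E (q + r) (f ∘ g) b.source := by
      rw [haf, hbg, source_jet]
      exact Jet.comp_jet sf sg
    obtain ⟨h3, h4⟩ := hZ.smoothNear_act sf (jet_mem_fullJetGroupoid hf) hσ hπ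
    have e1 := hact σ (f ∘ g) b.source sfg (jet_mem_fullJetGroupoid lfg) hσ hπ
    have e2 := hact _ g b.source sg (jet_mem_fullJetGroupoid hg) h3 h4
    rw [← ecomp, Function.comp_apply, ← huσ] at e1
    rw [← hea, ← hbg] at e2
    rw [e1, e2]
    -- Both sides are jets of explicit local sections, which agree pointwise by the associativity of
    -- `act`.
    refine jet_congr ?_
    have hgc : ContinuousAt g b.source := sg.self_of_nhds.continuousAt
    filter_upwards [isLocalDiffeomorphAt_eventually hg,
      hgc.eventually (isLocalDiffeomorphAt_eventually hf),
      hgc.eventually (sf.self_of_nhds.continuousAt.eventually hπ)] with z hgz hfz hz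
    rw [← Jet.comp_jet (smoothNear_of_isLocalDiffeomorphAt hfz)
      (smoothNear_of_isLocalDiffeomorphAt hgz)]
    exact hZ.isGroupoidAction.act_comp _ (mem_univ _) _ (jet_mem_fullJetGroupoid hfz) _
      (jet_mem_fullJetGroupoid hgz) (by rw [target_jet]; exact hz)
      (by rw [source_jet, target_jet])

end InducedAction

/-! ### The typical fibre of the jet bundle as a manifold. -/

section JetFiber

set_option linter.unusedSectionVars false

theorem finiteDimensional_symMap (k : ℕ) (E V : Type*) [NormedAddCommGroup E] [NormedSpace ℝ E]
    [FiniteDimensional ℝ E] [NormedAddCommGroup V] [NormedSpace ℝ V] [FiniteDimensional ℝ V] :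
    FiniteDimensional ℝ (SymMap k E V) := by
  have h : FiniteDimensional ℝ (E [×k]→L[ℝ] V) :=
    FiniteDimensional.of_injective
      (ContinuousMultilinearMap.toMultilinearMapLinear :
        (E [×k]→L[ℝ] V) →ₗ[ℝ] MultilinearMap ℝ (fun _ : Fin k => E) V)
      ContinuousMultilinearMap.toMultilinearMap_injective
  infer_instance

theorem finiteDimensional_jetCoeff (r : ℕ) (E V : Type*) [NormedAddCommGroup E] [NormedSpace ℝ E]
    [FiniteDimensional ℝ E] [NormedAddCommGroup V] [NormedSpace ℝ V] [FiniteDimensional ℝ V] :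
    FiniteDimensional ℝ (JetCoeff r E V) := by
  have h : ∀ k : ℕ, FiniteDimensional ℝ (SymMap k E V) := fun k => finiteDimensional_symMap k E V
  exact inferInstanceAs (FiniteDimensional ℝ ((k : Fin (r + 1)) → SymMap k E V))

variable (r : ℕ) (E V : Type*) [NormedAddCommGroup E] [NormedSpace ℝ E]
  [NormedAddCommGroup V] [NormedSpace ℝ V]
  (F : Type*) [TopologicalSpace F] [ChartedSpace V F] [IsManifold 𝓘(ℝ, V) ∞ F]

/-- The `r`-jets at the origin of maps from a vector space to a manifold `F`. -/
abbrev JetFiber : Type _ := {j : Jet E V E F r // j.source = 0}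

variable {r E V F}

theorem chartAt_jet_fst (j₀ j : Jet E V E F r) : (chartAt (JetModel r E V) j₀ j).1 = j.source := rfl

theorem source_chartAt_jet_symm (j₀ : Jet E V E F r) {z : JetModel r E V}
    (hz : z ∈ (chartAt (JetModel r E V) j₀).target) :
    ((chartAt (JetModel r E V) j₀).symm z).source = z.1 := by
  rw [← chartAt_jet_fst j₀, (chartAt (JetModel r E V) j₀).right_inv hz]

theorem chartAt_jetFiber_eq (j₀ : Jet E V E F r) (c : JetFiber r E V F) :
    chartAt (JetModel r E V) j₀ c.1 = (0, (chartAt (JetModel r E V) j₀ c.1).2) :=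
  Prod.ext ((chartAt_jet_fst j₀ c.1).trans c.2) rfl

open Classical in
/-- The chart of the space of jets at the origin obtained by restricting a chart of the space
of jets. -/
def jetFiberChart (c₀ : JetFiber r E V F) :
    OpenPartialHomeomorph (JetFiber r E V F) (JetCoeff r E V) where
  toFun c := (chartAt (JetModel r E V) c₀.1 c.1).2
  invFun d := if h : (0, d) ∈ (chartAt (JetModel r E V) c₀.1).target then
    ⟨(chartAt (JetModel r E V) c₀.1).symm (0, d), source_chartAt_jet_symm c₀.1 h⟩ else c₀
  source := {c | c.1 ∈ (chartAt (JetModel r E V) c₀.1).source}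
  target := {d | (0, d) ∈ (chartAt (JetModel r E V) c₀.1).target}
  map_source' c hc := by
    rw [mem_ofPred_eq, ← chartAt_jetFiber_eq]
    exact (chartAt (JetModel r E V) c₀.1).map_source hc
  map_target' d hd := by
    have h : (0, d) ∈ (chartAt (JetModel r E V) c₀.1).target := hd
    rw [dif_pos h]
    exact (chartAt (JetModel r E V) c₀.1).map_target h
  left_inv' c hc := by
    have h : (0, (chartAt (JetModel r E V) c₀.1 c.1).2) ∈
        (chartAt (JetModel r E V) c₀.1).target := by
      rw [← chartAt_jetFiber_eq]
      exact (chartAt (JetModel r E V) c₀.1).map_source hc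
    rw [dif_pos h]
    apply Subtype.ext
    dsimp only
    rw [← chartAt_jetFiber_eq, (chartAt (JetModel r E V) c₀.1).left_inv hc]
  right_inv' d hd := by
    have h : (0, d) ∈ (chartAt (JetModel r E V) c₀.1).target := hd
    rw [dif_pos h]
    dsimp only
    rw [(chartAt (JetModel r E V) c₀.1).right_inv h]
  open_source := (chartAt (JetModel r E V) c₀.1).open_source.preimage continuous_subtype_val
  open_target := (chartAt (JetModel r E V) c₀.1).open_target.preimage
    (continuous_const.prodMk continuous_id)
  continuousOn_toFun := continuous_snd.comp_continuousOn
    ((chartAt (JetModel r E V) c₀.1).continuousOn.comp continuous_subtype_val.continuousOn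
      fun _ h => h)
  continuousOn_invFun := by
    refine Topology.IsInducing.subtypeVal.continuousOn_iff.2 ?_
    refine ContinuousOn.congr (f := fun d => (chartAt (JetModel r E V) c₀.1).symm (0, d)) ?_ ?_
    · exact (chartAt (JetModel r E V) c₀.1).continuousOn_symm.comp
        (continuous_const.prodMk continuous_id).continuousOn fun _ h => h
    · intro d hd
      exact congrArg Subtype.val (dif_pos hd)

instance : ChartedSpace (JetCoeff r E V) (JetFiber r E V F) where
  atlas := range jetFiberChart
  chartAt := jetFiberChart
  mem_chart_source c := mem_chart_source (JetModel r E V) c.1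
  chart_mem_atlas c := ⟨c, rfl⟩

theorem jetFiberChart_symm_val {c₀ : JetFiber r E V F} {d : JetCoeff r E V}
    (hd : d ∈ (jetFiberChart c₀).target) :
    ((jetFiberChart c₀).symm d).1 = (chartAt (JetModel r E V) c₀.1).symm (0, d) :=
  congrArg Subtype.val (dif_pos hd)

theorem smoothAround_chartAt_symm_inr (j₀ : Jet E V E F r) {d : JetCoeff r E V}
    (hd : (0, d) ∈ (chartAt (JetModel r E V) j₀).target) :
    SmoothAround 𝓘(ℝ, JetCoeff r E V) 𝓘(ℝ, JetModel r E V)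
      (fun d => (chartAt (JetModel r E V) j₀).symm (0, d)) d :=
  (smoothAround_chartAt_symm hd).comp_of_eq
    ((contDiff_const.prodMk contDiff_id).smoothAround d) rfl

instance : IsManifold 𝓘(ℝ, JetCoeff r E V) ∞ (JetFiber r E V F) := by
  apply isManifold_of_contDiffOn
  rintro _ _ ⟨c, rfl⟩ ⟨c', rfl⟩
  simp only [modelWithCornersSelf_coe, modelWithCornersSelf_coe_symm, range_id, inter_univ,
    preimage_id, Function.id_comp, Function.comp_id]
  intro d hd
  obtain ⟨h1, h2⟩ : d ∈ (jetFiberChart c).target ∧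
    ((jetFiberChart c).symm d).1 ∈ (chartAt (JetModel r E V) c'.1).source := hd
  rw [jetFiberChart_symm_val h1] at h2
  have h3 : SmoothAround 𝓘(ℝ, JetCoeff r E V) 𝓘(ℝ, JetCoeff r E V) (fun d =>
      (chartAt (JetModel r E V) c'.1 ((chartAt (JetModel r E V) c.1).symm (0, d))).2) d :=
    (contDiff_snd.smoothAround _).comp (f := fun d =>
      chartAt (JetModel r E V) c'.1 ((chartAt (JetModel r E V) c.1).symm (0, d)))
      ((smoothAround_chartAt h2).comp (f := fun d => (chartAt (JetModel r E V) c.1).symm (0, d))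
        (smoothAround_chartAt_symm_inr c.1 h1))
  refine (h3.contMDiffAt.contDiffAt.congr_of_eventuallyEq ?_).contDiffWithinAt
  filter_upwards [(jetFiberChart c).open_target.mem_nhds h1] with d hd
  change (chartAt (JetModel r E V) c'.1 ((jetFiberChart c).symm d).1).2 = _
  rw [jetFiberChart_symm_val hd]

theorem smoothAround_jetFiber_val (c₀ : JetFiber r E V F) :
    SmoothAround 𝓘(ℝ, JetCoeff r E V) 𝓘(ℝ, JetModel r E V)
      (fun c : JetFiber r E V F => (c.1 : Jet E V E F r)) c₀ := by
  have h1 : c₀ ∈ (chartAt (JetCoeff r E V) c₀).source := mem_chart_source _ c₀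
  refine ((smoothAround_chartAt_symm_inr c₀.1
    ((chartAt (JetCoeff r E V) c₀).map_source h1)).comp (smoothAround_chartAt h1)).congr ?_
  filter_upwards [(chartAt (JetCoeff r E V) c₀).open_source.mem_nhds h1] with c hc
  have h2 := (chartAt (JetCoeff r E V) c₀).left_inv hc
  have h3 := jetFiberChart_symm_val ((chartAt (JetCoeff r E V) c₀).map_source hc)
  exact (congrArg Subtype.val h2).symm.trans h3

/-- The space `JetFiber` has the subspace topology, and its charts are the charts of the jet space
with the source coordinate omitted. Smoothness of a map into it may therefore be tested in the
ambient jet space. -/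
theorem SmoothAround.jetFiber {EP HP P : Type*} [NormedAddCommGroup EP] [NormedSpace ℝ EP]
    [TopologicalSpace HP] {I : ModelWithCorners ℝ EP HP} [TopologicalSpace P]
    [ChartedSpace HP P] {h : P → JetFiber r E V F} {p : P}
    (hh : SmoothAround I 𝓘(ℝ, JetModel r E V) (fun p => ((h p).1 : Jet E V E F r)) p) :
    SmoothAround I 𝓘(ℝ, JetCoeff r E V) h p := by
  filter_upwards [hh.eventually] with p hh
  rw [contMDiffAt_iff_target]
  refine ⟨Topology.IsInducing.subtypeVal.continuousAt_iff.2 hh.continuousAt, ?_⟩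
  exact ((contDiff_snd.smoothAround _).comp
    (f := fun p' => chartAt (JetModel r E V) (h p).1 (h p').1)
    ((smoothAround_chartAt (mem_chart_source (JetModel r E V) (h p).1)).comp
      (f := fun p' => (h p').1) hh)).contMDiffAt

end JetFiber

/-! ### Local triviality of the jet bundle. -/

section JetBundle

set_option linter.unusedSectionVars false

section

variable {E EM V : Type*} [NormedAddCommGroup E] [NormedSpace ℝ E]
  [NormedAddCommGroup EM] [NormedSpace ℝ EM] [NormedAddCommGroup V] [NormedSpace ℝ V]
  {X M F : Type*} [TopologicalSpace X] [ChartedSpace E X] [IsManifold 𝓘(ℝ, E) ∞ X]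
  [TopologicalSpace M] [ChartedSpace EM M] [IsManifold 𝓘(ℝ, EM) ∞ M]
  [TopologicalSpace F] [ChartedSpace V F] [IsManifold 𝓘(ℝ, V) ∞ F] {r : ℕ}

theorem smoothNear_translation {x y : X} (hy : y ∈ (chartAt E x).source) :
    SmoothNear E E (fun v : E => (chartAt E x).symm (chartAt E x y + v)) (0 : E) :=
  (smoothAround_chartAt_symm ((chartAt E x).map_source hy)).comp_of_eq
    ((contDiff_const.add contDiff_id).smoothAround 0) (add_zero _)

theorem translation_zero {x y : X} (hy : y ∈ (chartAt E x).source) :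
    (chartAt E x).symm (chartAt E x y + 0) = y := by
  rw [add_zero, (chartAt E x).left_inv hy]

theorem smoothNear_coordinate_difference {x y : X} (hy : y ∈ (chartAt E x).source) :
    SmoothNear E E (fun z : X => chartAt E x z - chartAt E x y) y :=
  ((contDiff_id.sub contDiff_const).smoothAround _).comp (smoothAround_chartAt hy)

/-- The fibre component of the trivialization of `J_r(M)` induced by the fibre component `Φ` of a
trivialization of `M` and a chart of the base. -/
def jetTrivFst (x : X) (Φ : M → F) (j : Jet E EM X M r) : JetFiber r E V F :=
  ⟨jet E V r (fun v => Φ (j.rep.map ((chartAt E x).symm (chartAt E x j.source + v)))) 0,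
    source_jet _ _⟩

/-- The inverse of the trivialization of `J_r(M)` induced by the inverse `Ψ` of a trivialization
of `M` and a chart of the base. -/
def jetTrivInv (x : X) (Ψ : X × F → M) (w : X × JetFiber r E V F) : Jet E EM X M r :=
  jet E EM r (fun z => Ψ (z, w.2.1.rep.map (chartAt E x z - chartAt E x w.1))) w.1

/-- The representative `j.rep` is an arbitrary choice, with no control on its dependence on `j`. By
the chain rule any `f` with the same jet may replace it, in particular a member of a smooth family.
-/
theorem jetTrivFst_val {x : X} {Φ : M → F} {j : Jet E EM X M r} {f : X → M}
    (hx : j.source ∈ (chartAt E x).source) (hf : SmoothNear E EM f j.source)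
    (hΦ : SmoothAround 𝓘(ℝ, EM) 𝓘(ℝ, V) Φ j.target) (h : jet E EM r f j.source = j) :
    (jetTrivFst x Φ j).1 =
      jet E V r (fun v => Φ (f ((chartAt E x).symm (chartAt E x j.source + v)))) 0 := by
  have ht : f j.source = j.target := by
    conv_rhs => rw [← h, target_jet]
  have hs := smoothNear_rep j
  have e := Jet.rep_map j
  refine jet_comp_congr (f₁ := fun v : E => (chartAt E x).symm (chartAt E x j.source + v))
    (f₂ := fun v : E => (chartAt E x).symm (chartAt E x j.source + v))
    (g₁ := fun z => Φ (j.rep.map z)) (g₂ := fun z => Φ (f z))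
    (translation_zero hx) (SmoothAround.comp_of_eq hΦ hs e) (SmoothAround.comp_of_eq hΦ hf ht)
    (smoothNear_translation hx) (smoothNear_translation hx) ?_ rfl
  refine jet_comp_congr e hΦ hΦ hs hf rfl ?_
  rw [jet_rep, h]

/-- This is the analogous change of representative for the inverse. As `Ψ` involves the base point
`z` as well, the chain rule is needed for maps depending on `z`. -/
theorem jetTrivInv_eq {x y : X} {Ψ : X × F → M} {c : JetFiber r E V F} {f : E → F}
    (hy : y ∈ (chartAt E x).source) (hf : SmoothNear E V f 0) (h : jet E V r f 0 = c.1)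
    (hΨ : SmoothAround (𝓘(ℝ, E).prod 𝓘(ℝ, V)) 𝓘(ℝ, EM) Ψ (y, f 0)) :
    jetTrivInv x Ψ (y, c) = jet E EM r (fun z => Ψ (z, f (chartAt E x z - chartAt E x y))) y := by
  have hs : SmoothNear E V c.1.rep.map 0 := by
    have := smoothNear_rep c.1
    rwa [c.2] at this
  have hj : jet E V r c.1.rep.map 0 = c.1 := by
    have := jet_rep c.1
    rwa [c.2] at this
  have e : c.1.rep.map 0 = f 0 := target_eq_of_jet_eq (hj.trans h.symm)
  have hd := smoothNear_coordinate_difference hy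
  have s1 : SmoothNear E V (fun z => c.1.rep.map (chartAt E x z - chartAt E x y)) y :=
    SmoothAround.comp_of_eq (g := c.1.rep.map) hs hd (sub_self _)
  have s2 : SmoothNear E V (fun z => f (chartAt E x z - chartAt E x y)) y :=
    SmoothAround.comp_of_eq (g := f) hf hd (sub_self _)
  refine jet_family_congr_left (H := Ψ) s1 s2
    (jet_comp_congr (g₁ := c.1.rep.map) (sub_self _) hs hf hd hd (hj.trans h.symm) rfl) ?_
  rwa [sub_self, e]

theorem smoothAround_jetTrivFst {x : X} {Φ : M → F} {j₀ : Jet E EM X M r}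
    (hx : j₀.source ∈ (chartAt E x).source)
    (hΦ : SmoothAround 𝓘(ℝ, EM) 𝓘(ℝ, V) Φ j₀.target) :
    SmoothAround 𝓘(ℝ, JetModel r E EM) 𝓘(ℝ, JetCoeff r E V)
      (jetTrivFst x Φ : Jet E EM X M r → JetFiber r E V F) j₀ := by
  obtain ⟨G, hG, hGj⟩ := exists_smooth_representatives j₀
  refine SmoothAround.jetFiber ?_
  set φ := chartAt E x
  have s0 : SmoothAround (𝓘(ℝ, JetModel r E EM).prod 𝓘(ℝ, E)) 𝓘(ℝ, E)
      (fun w : Jet E EM X M r × E => φ w.1.source + w.2) (j₀, (0 : E)) :=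
    (contDiff_add.smoothAround _).comp (f := fun w : Jet E EM X M r × E => (φ w.1.source, w.2))
      (((smoothAround_chartAt hx).comp_of_eq ((smoothAround_source j₀).comp_of_eq
        (SmoothAround.fst _) rfl) rfl).prodMk_space (SmoothAround.snd _))
  have s1 : SmoothAround (𝓘(ℝ, JetModel r E EM).prod 𝓘(ℝ, E)) 𝓘(ℝ, E)
      (fun w : Jet E EM X M r × E => φ.symm (φ w.1.source + w.2)) (j₀, (0 : E)) :=
    (smoothAround_chartAt_symm (φ.map_source hx)).comp_of_eq s0 (add_zero _)
  have e0 : G j₀ j₀.source = j₀.target := by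
    rw [← target_jet (E := E) (E' := EM) (r := r) (G j₀) j₀.source, hGj.self_of_nhds.2]
  have s2 : SmoothAround (𝓘(ℝ, JetModel r E EM).prod 𝓘(ℝ, E)) 𝓘(ℝ, V)
      (fun w : Jet E EM X M r × E => Φ (G w.1 (φ.symm (φ w.1.source + w.2)))) (j₀, (0 : E)) := by
    refine hΦ.comp_of_eq (hG.comp_of_eq
      (f := fun w : Jet E EM X M r × E => (w.1, φ.symm (φ w.1.source + w.2)))
      ((SmoothAround.fst _).prodMk s1) ?_) ?_
    · rw [translation_zero hx]
    · dsimp only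
      rw [translation_zero hx, e0]
  have s3 := smoothAround_jet (r := r)
    (G := fun (j : Jet E EM X M r) (v : E) => Φ (G j (φ.symm (φ j.source + v))))
    (b := fun _ => (0 : E)) s2 (SmoothAround.const 0 j₀)
  refine s3.congr ?_
  filter_upwards [hGj, (smoothAround_source j₀).continuousAt.eventually_mem
    (φ.open_source.mem_nhds hx), (smoothAround_target j₀).continuousAt.eventually hΦ.eventually]
    with j h1 h2 h3
  exact jetTrivFst_val h2 h1.1 h3 h1.2

theorem smoothAround_jetTrivInv {x : X} {Ψ : X × F → M} {y₀ : X} {c₀ : JetFiber r E V F}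
    (hx : y₀ ∈ (chartAt E x).source)
    (hΨ : SmoothAround (𝓘(ℝ, E).prod 𝓘(ℝ, V)) 𝓘(ℝ, EM) Ψ (y₀, c₀.1.target)) :
    SmoothAround (𝓘(ℝ, E).prod 𝓘(ℝ, JetCoeff r E V)) 𝓘(ℝ, JetModel r E EM)
      (jetTrivInv x Ψ : X × JetFiber r E V F → Jet E EM X M r) (y₀, c₀) := by
  obtain ⟨G, hG, hGj⟩ := exists_smooth_representatives c₀.1
  set φ := chartAt E x
  let I := 𝓘(ℝ, E).prod 𝓘(ℝ, JetCoeff r E V)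
  have sc : SmoothAround I 𝓘(ℝ, JetModel r E V)
      (fun w : X × JetFiber r E V F => (w.2.1 : Jet E V E F r)) (y₀, c₀) :=
    (smoothAround_jetFiber_val c₀).comp_of_eq (SmoothAround.snd _) rfl
  have s0 : SmoothAround (I.prod 𝓘(ℝ, E)) 𝓘(ℝ, E)
      (fun w : (X × JetFiber r E V F) × X => φ w.2 - φ w.1.1) ((y₀, c₀), y₀) :=
    ((contDiff_fst.sub contDiff_snd).smoothAround _).comp (f := fun w : (X × JetFiber r E V F) × X => (φ w.2, φ w.1.1))
      (((smoothAround_chartAt hx).comp_of_eq (SmoothAround.snd _) rfl).prodMk_space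
        ((smoothAround_chartAt hx).comp_of_eq ((SmoothAround.fst _).comp_of_eq
          (SmoothAround.fst _) rfl) rfl))
  have s1 : SmoothAround (I.prod 𝓘(ℝ, E)) 𝓘(ℝ, V)
      (fun w : (X × JetFiber r E V F) × X => G w.1.2.1 (φ w.2 - φ w.1.1)) ((y₀, c₀), y₀) := by
    refine hG.comp_of_eq
      (f := fun w : (X × JetFiber r E V F) × X => ((w.1.2.1 : Jet E V E F r), φ w.2 - φ w.1.1))
      ((sc.comp_of_eq (SmoothAround.fst _) rfl).prodMk s0) ?_
    rw [sub_self, c₀.2]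
  have e0 : G c₀.1 0 = c₀.1.target := by
    have := target_jet (E := E) (E' := V) (r := r) (G c₀.1) c₀.1.source
    rw [hGj.self_of_nhds.2, c₀.2] at this
    exact this.symm
  have s2 : SmoothAround (I.prod 𝓘(ℝ, E)) 𝓘(ℝ, EM)
      (fun w : (X × JetFiber r E V F) × X => Ψ (w.2, G w.1.2.1 (φ w.2 - φ w.1.1)))
      ((y₀, c₀), y₀) :=
    hΨ.comp_of_eq ((SmoothAround.snd _).prodMk s1) (by rw [sub_self, e0])
  have s3 := smoothAround_jet (r := r) (p₀ := (y₀, c₀))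
    (G := fun (w : X × JetFiber r E V F) (z : X) => Ψ (z, G w.2.1 (φ z - φ w.1)))
    (b := fun w => w.1) s2 (SmoothAround.fst _)
  refine s3.congr ?_
  have ct : ContinuousAt (fun w : X × JetFiber r E V F => (w.1, (w.2.1 : Jet E V E F r).target))
      (y₀, c₀) :=
    continuousAt_fst.prodMk ((smoothAround_target c₀.1).comp_of_eq sc rfl).continuousAt
  filter_upwards [sc.continuousAt.eventually hGj,
    continuousAt_fst.eventually_mem (φ.open_source.mem_nhds hx), ct.eventually hΨ.eventually]
  rintro ⟨y, c⟩ ⟨h1, h1'⟩ h2 h3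
  dsimp only at h1 h1' h2 h3
  rw [c.2] at h1 h1'
  refine jetTrivInv_eq h2 h1 h1' ?_
  rwa [← target_jet (E := E) (E' := V) (r := r) (G c.1) 0, h1']

end

variable {E : Type} {EM : Type*} [NormedAddCommGroup E] [NormedSpace ℝ E] [FiniteDimensional ℝ E]
  [NormedAddCommGroup EM] [NormedSpace ℝ EM]
  {X M : Type u} [TopologicalSpace X] [ChartedSpace E X] [IsManifold 𝓘(ℝ, E) ∞ X]
  [TopologicalSpace M] [ChartedSpace EM M] [IsManifold 𝓘(ℝ, EM) ∞ M] {π : M → X}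

/-- The bundle of `r`-jets of sections of a smooth fibre bundle is a smooth fibre bundle. -/
theorem IsSmoothFiberBundle.jet_prolongation (h : IsSmoothFiberBundle E EM π univ) (r : ℕ) :
    IsSmoothFiberBundle E (JetModel r E EM) Jet.source
      (jetBundle r π univ : Set (Jet E EM X M r)) := by
  have hπ := h.continuous_proj
  refine ⟨fun j _ => (smoothAround_source j).contMDiffAt.contMDiffWithinAt, ?_⟩
  obtain ⟨V, _, _, _, F, _, _, _, htriv⟩ := h.locally_trivial
  refine ⟨JetCoeff r E V, inferInstance, inferInstance, finiteDimensional_jetCoeff r E V,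
    JetFiber r E V F, inferInstance, inferInstance, inferInstance, fun x => ?_⟩
  obtain ⟨U, hU, hxU, Φ, Ψ, hΦ, hΨ, hΨΦ, hΦΨ⟩ := htriv x
  set φ := chartAt E x with hφ
  have sΦ : ∀ m, π m ∈ U → SmoothAround 𝓘(ℝ, EM) 𝓘(ℝ, V) Φ m := fun m hm => by
    refine SmoothAround.of_contMDiffOn hΦ ?_
    rw [univ_inter]
    exact (hU.preimage hπ).mem_nhds hm
  have sΨ : ∀ y ∈ U, ∀ c, SmoothAround (𝓘(ℝ, E).prod 𝓘(ℝ, V)) 𝓘(ℝ, EM) Ψ (y, c) :=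
    fun y hy c => SmoothAround.of_contMDiffOn hΨ ((hU.prod isOpen_univ).mem_nhds ⟨hy, mem_univ _⟩)
  have tgt : ∀ j ∈ JetBundles.jetBundle (E := E) (EM := EM) r π univ, π j.target = j.source := by
    intro j hj
    obtain ⟨σ, -, hσ, hjσ⟩ := mem_jetBundle_iff.1 hj
    conv_lhs => rw [← hjσ, target_jet]
    exact hσ.self_of_nhds
  -- A jet of a section at `y` corresponds to `y` and the `r`-jet at `0` of the fibre component of
  -- the section, read in the chart `φ` translated so that `y` becomes the origin.
  refine ⟨U ∩ φ.source, hU.inter φ.open_source, ⟨hxU, mem_chart_source E x⟩, jetTrivFst x Φ,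
    jetTrivInv x Ψ, ?_, ?_, ?_, ?_⟩
  · rintro j ⟨hj, hjU, hjφ⟩
    exact (smoothAround_jetTrivFst hjφ (sΦ _ (by rw [tgt j hj]; exact hjU))
      ).contMDiffAt.contMDiffWithinAt
  · rintro ⟨y, c⟩ ⟨⟨hyU, hyφ⟩, -⟩
    exact (smoothAround_jetTrivInv hyφ (sΨ y hyU _)).contMDiffAt.contMDiffWithinAt
  · rintro y ⟨hyU, hyφ⟩ c
    have hs : SmoothNear E V c.1.rep.map 0 := by
      have := smoothNear_rep c.1
      rwa [c.2] at this
    have hj : jet E V r c.1.rep.map 0 = c.1 := by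
      have := jet_rep c.1
      rwa [c.2] at this
    have hd := smoothNear_coordinate_difference hyφ
    have sf : SmoothNear E EM (fun z => Ψ (z, c.1.rep.map (φ z - φ y))) y :=
      (sΨ y hyU (c.1.rep.map 0)).comp_of_eq ((SmoothAround.id y).prodMk
        (SmoothAround.comp_of_eq (g := c.1.rep.map) hs hd (sub_self _))) (by rw [sub_self])
    have hp : ∀ᶠ z in 𝓝 y, π (Ψ (z, c.1.rep.map (φ z - φ y))) = z := by
      filter_upwards [hU.mem_nhds hyU] with z hz using (hΨΦ z hz _).2.1
    have esrc : (jetTrivInv x Ψ (y, c) : Jet E EM X M r).source = y := source_jet _ _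
    have etgt : (jetTrivInv x Ψ (y, c) : Jet E EM X M r).target = Ψ (y, c.1.rep.map 0) := by
      rw [jetTrivInv, target_jet, sub_self]
    refine ⟨jet_mem_jetBundle sf hp, esrc, Subtype.ext ?_⟩
    rw [jetTrivFst_val (f := fun z => Ψ (z, c.1.rep.map (φ z - φ y))) (by rwa [esrc])
      (by rwa [esrc]) (by rw [etgt]; exact sΦ _ (by rw [(hΨΦ y hyU _).2.1]; exact hyU))
      (by rw [esrc]; rfl), esrc]
    -- The maps `Φ` and `Ψ` cancel, and so do the two translations in the chart.
    refine Eq.trans (jet_congr ?_) hj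
    have ht := (smoothNear_translation hyφ).self_of_nhds.continuousAt
    have hadd : ContinuousAt (fun v : E => φ y + v) 0 := by fun_prop
    filter_upwards [ht.eventually_mem (hU.mem_nhds (by rwa [translation_zero hyφ])),
      hadd.eventually_mem (φ.open_target.mem_nhds (by rw [add_zero]; exact φ.map_source hyφ))]
      with v h1 h2
    rw [(hΨΦ _ h1 _).2.2, φ.right_inv h2, add_sub_cancel_left]
  · rintro u hu ⟨huU, huφ⟩
    obtain ⟨σ, hσ, hπσ, huσ⟩ := mem_jetBundle_iff.1 hu
    have et : σ u.source = u.target := by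
      conv_rhs => rw [← huσ, target_jet]
    have hΦu := sΦ u.target (by rw [tgt u hu]; exact huU)
    have ec := (jetTrivFst_val (r := r) huφ hσ hΦu huσ).symm
    have sf : SmoothNear E V (fun v => Φ (σ (φ.symm (φ u.source + v)))) 0 := by
      refine SmoothAround.comp_of_eq hΦu (SmoothAround.comp_of_eq (g := σ) hσ
        (smoothNear_translation huφ) (translation_zero huφ)) ?_
      rw [translation_zero huφ, et]
    rw [jetTrivInv_eq huφ sf ec (sΨ _ huU _)]
    refine Eq.trans (jet_congr ?_) huσ
    filter_upwards [hπσ, hU.mem_nhds huU, φ.open_source.mem_nhds huφ] with z h1 h2 h3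
    rw [add_sub_cancel, φ.left_inv h3]
    have := hΦΨ (σ z) (mem_univ _) (by rwa [h1])
    rwa [h1] at this

theorem IsNaturalBundle.jet_prolongation {q r : ℕ} {act : M → Jet E E X X q → M}
    (hZ : IsNaturalBundle E EM q π univ act)
    {act' : Jet E EM X M r → Jet E E X X (q + r) → Jet E EM X M r}
    (hact : IsInducedAction r π act act') :
    IsNaturalBundle E (JetModel r E EM) (q + r) Jet.source (jetBundle r π univ) act' :=
  haveI := FiniteDimensional.complete ℝ E
  ⟨hZ.isSmoothFiberBundle.jet_prolongation r, hZ.isGroupoidAction_induced hact⟩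

end JetBundle

/-! ### The prolonged section, and the inclusion that needs no homogeneity. -/

section SymmetryGroupoid

set_option linter.unusedSectionVars false

variable {E EM : Type*} [NormedAddCommGroup E] [NormedSpace ℝ E] [CompleteSpace E]
  [NormedAddCommGroup EM] [NormedSpace ℝ EM]
  {X : Type*} {M : Type u} [TopologicalSpace X] [ChartedSpace E X] [IsManifold 𝓘(ℝ, E) ∞ X]
  [TopologicalSpace M] [ChartedSpace EM M] [IsManifold 𝓘(ℝ, EM) ∞ M]
  {π : M → X} {q r : ℕ} {act : M → Jet E E X X q → M} {ω₀ : X → M}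

theorem IsSmoothSection.smoothNear (hω : IsSmoothSection E EM π univ ω₀) (x : X) :
    SmoothNear E EM ω₀ x := SmoothAround.of_contMDiff hω.contMDiff x

theorem IsSmoothSection.jet_prolongation (hω : IsSmoothSection E EM π univ ω₀) (r : ℕ) :
    IsSmoothSection E (JetModel r E EM) Jet.source (jetBundle r π univ)
      (fun x => jet E EM r ω₀ x) where
  contMDiff x := (smoothNear_jet (hω.smoothNear x)).self_of_nhds
  mem _ := jet_mem_jetBundle (hω.smoothNear _) (Eventually.of_forall hω.proj)
  proj _ := source_jet _ _

theorem IsNaturalBundle.smoothAround_act_section (hZ : IsNaturalBundle E EM q π univ act)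
    (hω : IsSmoothSection E EM π univ ω₀) {h₀ : Jet E E X X q}
    (hh₀ : h₀ ∈ fullJetGroupoid E X q) :
    SmoothAround 𝓘(ℝ, JetModel q E E) 𝓘(ℝ, EM) (fun h => act (ω₀ h.target) h) h₀ := by
  refine SmoothAround.contMDiffOn_comp hZ.isGroupoidAction.contMDiffOn_act
    (f := fun h : Jet E E X X q => (ω₀ h.target, h))
    ((SmoothAround.comp (g := ω₀) (hω.smoothNear _) (smoothAround_target h₀)).prodMk
      (SmoothAround.id h₀)) ?_
  filter_upwards [isOpen_fullJetGroupoid.mem_nhds hh₀] with h hh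
  exact ⟨mem_univ _, hh, hω.proj _⟩

/-- The map `h ↦ ω₀(t(h)) h` is smooth near `j_x^q f`, so it preserves agreement to order `r`. It
sends `z ↦ j_z^q f` to the left-hand side and a section of the symmetry groupoid to `ω₀`. -/
theorem IsNaturalBundle.jet_act_section_eq (hZ : IsNaturalBundle E EM q π univ act)
    (hω : IsSmoothSection E EM π univ ω₀) {f : X → X} {x : X} (hf : SmoothNear E E f x)
    (hfx : jet E E q f x ∈ fullJetGroupoid E X q)
    (h : jet E (JetModel q E E) r (fun z => jet E E q f z) x ∈
      jetBundle r Jet.source (symmetryGroupoid act ω₀)) :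
    jet E EM r (fun z => act (ω₀ (f z)) (jet E E q f z)) x =
      jet E EM r ω₀ x := by
  obtain ⟨τ, x', hτ, hτm, he⟩ := h
  have hx := congrArg Jet.source he
  rw [source_jet, source_jet] at hx
  subst hx
  have h1 := jet_family_congr_left
    (H := fun w : X × Jet E E X X q => act (ω₀ w.2.target) w.2) (smoothNear_jet hf) hτ he
    ((hZ.smoothAround_act_section hω hfx).comp_of_eq (SmoothAround.snd _) rfl)
  simp only [target_jet] at h1
  rw [h1]
  refine jet_congr ?_
  filter_upwards [hτm] with z hz
  rw [hz.1.2, hz.2]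

/-- The value at `x` of the section of the symmetry groupoid is `j_x^q f`, an invertible jet. For `q
≥ 1` this makes `f` a local diffeomorphism, so its jets of all orders are invertible. -/
theorem prolongation_subset_fullJetGroupoid (hq : 1 ≤ q) :
    prolongation r (symmetryGroupoid act ω₀) ⊆ fullJetGroupoid E X (q + r) := by
  rintro g ⟨f, x, hf, rfl, τ, x', hτ, hτm, he⟩
  have hx := congrArg Jet.source he
  rw [source_jet, source_jet] at hx
  subst hx
  have h1 := target_eq_of_jet_eq he
  have h2 := hτm.self_of_nhds.1.1
  rw [← h1, jet_mem_fullJetGroupoid_iff hf hq] at h2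
  exact jet_mem_fullJetGroupoid h2

theorem IsNaturalBundle.prolongation_symmetryGroupoid_subset
    (hZ : IsNaturalBundle E EM q π univ act) (hω : IsSmoothSection E EM π univ ω₀)
    {act' : Jet E EM X M r → Jet E E X X (q + r) → Jet E EM X M r}
    (hact : IsInducedAction r π act act') :
    prolongation r (symmetryGroupoid act ω₀) ∩ fullJetGroupoid E X (q + r) ⊆
      symmetryGroupoid act' (fun x => jet E EM r ω₀ x) := by
  rintro g ⟨⟨f, x, hf, rfl, h⟩, hg⟩
  refine ⟨hg, ?_⟩
  rw [source_jet, target_jet, hact ω₀ f x hf hg (hω.smoothNear _) (Eventually.of_forall hω.proj)]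
  exact hZ.jet_act_section_eq hω hf (jet_mem_fullJetGroupoid_of_le (Nat.le_add_right q r) hf hg) h

end SymmetryGroupoid

/-! ### Solving equations with surjective partial derivative. -/

section Calculus

variable {A C V : Type*} [NormedAddCommGroup A] [NormedSpace ℝ A] [CompleteSpace A]
  [NormedAddCommGroup C] [NormedSpace ℝ C]
  [NormedAddCommGroup V] [NormedSpace ℝ V] [FiniteDimensional ℝ V]

/-- If the partial derivative of `G` with respect to the second variable is surjective, then the
equation `G(a, c) = t` has a smooth local solution `c = S(a, t)` with `S(a, G(a, c₀)) = c₀`. -/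
theorem exists_smooth_solution {G : A × C → V} {a₀ : A} {c₀ : C}
    (hG : SmoothAround 𝓘(ℝ, A × C) 𝓘(ℝ, V) G (a₀, c₀))
    (hs : (fderiv ℝ (fun c => G (a₀, c)) c₀).range = ⊤) :
    ∃ S : A × V → C, SmoothAround 𝓘(ℝ, A × V) 𝓘(ℝ, C) S (a₀, G (a₀, c₀)) ∧
      (∀ᶠ w in 𝓝 (a₀, G (a₀, c₀)), G (w.1, S w) = w.2) ∧
      ∀ᶠ a in 𝓝 a₀, S (a, G (a, c₀)) = c₀ := by
  have := FiniteDimensional.complete ℝ V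
  obtain ⟨ρ, hρ⟩ := ContinuousLinearMap.exists_rightInverse_of_surjective _ hs
  -- Along the affine slice `c₀ + ρ V`, with `ρ` a right inverse of the partial derivative, the
  -- equation has partial derivative `1`, so the inverse function theorem applies to `(a, v) ↦ (a,
  -- G(a, c₀ + ρ v))`. The slice passes through `c₀` for every `a`, which gives the normalization
  -- `S(a, G(a, c₀)) = c₀`.
  let i : A × V → A × C := fun v => (v.1, c₀ + ρ v.2)
  have hi : ContDiff ℝ ∞ i := by fun_prop
  have i0 : i (a₀, 0) = (a₀, c₀) := by simp [i]
  have sG : SmoothAround 𝓘(ℝ, A × V) 𝓘(ℝ, V) (fun v => G (i v)) (a₀, 0) :=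
    hG.comp_of_eq (hi.smoothAround _) i0
  have sF : SmoothAround 𝓘(ℝ, A × V) 𝓘(ℝ, A × V) (fun v => (v.1, G (i v))) (a₀, (0 : V)) :=
    (contDiff_fst.smoothAround _).prodMk_space sG
  have dG := (sG.contMDiffAt.contDiffAt.differentiableAt (by simp)).hasFDerivAt
  have dF := (hasFDerivAt_fst (𝕜 := ℝ) (E := A) (F := V) (p := (a₀, 0))).prodMk dG
  set L := fderiv ℝ (fun v => G (i v)) (a₀, 0)
  have hL : ∀ v, L (0, v) = v := by
    intro v
    have h1 : HasFDerivAt (fun c => G (a₀, c)) (fderiv ℝ (fun c => G (a₀, c)) c₀) c₀ := by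
      have h2 : ContDiffAt ℝ ∞ (fun c => G (a₀, c)) c₀ :=
        ContDiffAt.comp (f := fun c => (a₀, c)) c₀ hG.contMDiffAt.contDiffAt
          (contDiffAt_const.prodMk contDiffAt_id)
      exact (h2.differentiableAt (by simp)).hasFDerivAt
    have h3 : HasFDerivAt (fun v : V => c₀ + ρ v) ρ 0 := ρ.hasFDerivAt.const_add c₀
    have h4 : HasFDerivAt (fun v : V => G (a₀, c₀ + ρ v))
        ((fderiv ℝ (fun c => G (a₀, c)) c₀).comp ρ) 0 :=
      HasFDerivAt.comp (g := fun c => G (a₀, c)) (0 : V) (by simpa using h1) h3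
    rw [hρ] at h4
    have h5 : HasFDerivAt (fun v : V => G (a₀, c₀ + ρ v))
        (L.comp (ContinuousLinearMap.inr ℝ A V)) 0 :=
      HasFDerivAt.comp (g := fun v => G (i v)) (f := fun v : V => (a₀, v)) (0 : V) dG
        (hasFDerivAt_prodMk_right a₀ 0)
    exact DFunLike.congr_fun (h5.unique h4) v
  have hF' : fderiv ℝ (fun v : A × V => (v.1, G (i v))) (a₀, 0) ∈
      range ((↑) : ((A × V) ≃L[ℝ] (A × V)) → ((A × V) →L[ℝ] (A × V))) := by
    refine ⟨(ContinuousLinearEquiv.refl ℝ A).skewProd (ContinuousLinearEquiv.refl ℝ V)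
      (L.comp (ContinuousLinearMap.inl ℝ A V)), ?_⟩
    rw [dF.fderiv]
    refine ContinuousLinearMap.ext fun ⟨a, v⟩ => ?_
    refine Prod.ext rfl ?_
    change v + L (a, 0) = L (a, v)
    conv_lhs => rw [← hL v, ← map_add]
    simp
  obtain ⟨K, hK, h1, h2⟩ := exists_smooth_localInverse sF hF'
  have e0 : G (i (a₀, 0)) = G (a₀, c₀) := by rw [i0]
  rw [e0] at hK h2
  refine ⟨fun w => c₀ + ρ (K w).2, ?_, ?_, ?_⟩
  · exact SmoothAround.comp (g := fun v : A × V => c₀ + ρ v.2)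
      (ContDiff.smoothAround (by fun_prop) _) hK
  · filter_upwards [h2] with w hw
    have hw1 : (K w).1 = w.1 := (Prod.ext_iff.1 hw).1
    have hw2 : G (i (K w)) = w.2 := (Prod.ext_iff.1 hw).2
    rw [← hw1]
    exact hw2
  · have hc : ContinuousAt (fun a : A => (a, (0 : V))) a₀ := by fun_prop
    filter_upwards [hc.eventually h1] with a ha
    have : G (i (a, 0)) = G (a, c₀) := by simp [i]
    rw [← this, ha]
    simp

/-- The first derivative of the identity is constant, so its further derivatives are invariant under
translation. -/
theorem iteratedFDeriv_succ_id_eq (n : ℕ) (a b : C) :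
    iteratedFDeriv ℝ (n + 1) (fun v : C => v) a = iteratedFDeriv ℝ (n + 1) (fun v : C => v) b := by
  rw [iteratedFDeriv_succ_eq_comp_right, iteratedFDeriv_succ_eq_comp_right]
  simp only [Function.comp_apply, fderiv_fun_id]
  have h := iteratedFDeriv_comp_sub (𝕜 := ℝ) (f := fun _ : C => ContinuousLinearMap.id ℝ C) n
    (a - b) a
  rw [sub_sub_cancel] at h
  rw [h]

end Calculus

/-! ### Coordinates on the isotropy jets at points near `x`. -/

section IsotropyJets

variable {q : ℕ} {E : Type*} [NormedAddCommGroup E] [NormedSpace ℝ E]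

/-- The coefficients of positive degree of a polynomial map. -/
def IsotropyCoeff (q : ℕ) (E : Type*) [NormedAddCommGroup E] [NormedSpace ℝ E] : Type _ :=
  (i : Fin q) → SymMap ((i.succ : Fin (q + 1)) : ℕ) E E

instance : NormedAddCommGroup (IsotropyCoeff q E) :=
  inferInstanceAs (NormedAddCommGroup ((i : Fin q) → SymMap ((i.succ : Fin (q + 1)) : ℕ) E E))

instance : NormedSpace ℝ (IsotropyCoeff q E) := Pi.normedSpace

theorem contDiff_isotropyCoeff_apply (i : Fin q) :
    ContDiff ℝ ∞ (fun c : IsotropyCoeff q E => c i) :=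
  contDiff_pi.1 contDiff_id i

instance [FiniteDimensional ℝ E] : FiniteDimensional ℝ (IsotropyCoeff q E) := by
  have h : ∀ k : ℕ, FiniteDimensional ℝ (SymMap k E E) := fun k => finiteDimensional_symMap k E E
  exact inferInstanceAs
    (FiniteDimensional ℝ ((i : Fin q) → SymMap ((i.succ : Fin (q + 1)) : ℕ) E E))

theorem constMultilinear_mem (p : E) :
    (continuousMultilinearCurryFin0 ℝ E E).symm p ∈ SymMap 0 E E := fun _ _ => rfl

/-- The polynomial coefficients with constant term `p` and coefficients `c` of positive degree. -/
def isotropyCoeff (p : E) (c : IsotropyCoeff q E) : JetCoeff q E E :=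
  Fin.cons (α := fun k : Fin (q + 1) => SymMap (k : ℕ) E E)
    ⟨(continuousMultilinearCurryFin0 ℝ E E).symm p, constMultilinear_mem p⟩ c

/-- The coefficients of positive degree among the coefficients of a polynomial map. -/
def isotropyTail (c : JetCoeff q E E) : IsotropyCoeff q E := fun i => c i.succ

theorem contDiff_isotropyTail : ContDiff ℝ ∞ (isotropyTail : JetCoeff q E E → IsotropyCoeff q E) :=
  contDiff_pi.2 fun i => contDiff_jetCoeff_apply i.succ

theorem contDiff_isotropyCoeff :
    ContDiff ℝ ∞ (fun w : E × IsotropyCoeff q E => isotropyCoeff w.1 w.2) := by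
  refine contDiff_pi.2 fun k => ?_
  refine Fin.cases ?_ (fun i => ?_) k
  · have h : ContDiff ℝ ∞ (ContinuousLinearMap.codRestrict
      ((continuousMultilinearCurryFin0 ℝ E E).symm.toContinuousLinearEquiv :
        E →L[ℝ] (E [×0]→L[ℝ] E)) (SymMap 0 E E) constMultilinear_mem) :=
      ContinuousLinearMap.contDiff _
    exact h.comp contDiff_fst
  · exact (contDiff_isotropyCoeff_apply i).comp contDiff_snd

theorem taylorPoly_isotropyCoeff (p : E) (c : IsotropyCoeff q E) :
    taylorPoly (isotropyCoeff p c) 0 = p := by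
  rw [taylorPoly_zero]
  rfl

theorem isotropyCoeff_tail {p : E} {c : JetCoeff q E E} (h : taylorPoly c 0 = p) :
    isotropyCoeff p (isotropyTail c) = c := by
  funext k
  refine Fin.cases ?_ (fun i => rfl) k
  refine Subtype.ext (ContinuousMultilinearMap.ext fun v => ?_)
  rw [taylorPoly_zero] at h
  change p = (c 0).1 v
  rw [← h]
  exact congrArg (c 0).1 (funext fun i : Fin 0 => i.elim0)

set_option linter.unusedSectionVars false

variable {X : Type*} [TopologicalSpace X] [ChartedSpace E X] [IsManifold 𝓘(ℝ, E) ∞ X]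

/-- The map that fixes `z` and is polynomial in the chart around `x`. -/
def isotropyMap (x : X) (z : X) (c : IsotropyCoeff q E) : X → X :=
  polyMap (chartAt E x) (chartAt E x) (chartAt E x z, isotropyCoeff (chartAt E x z) c)

/-- The jet at `z` of the map that fixes `z` and is polynomial in the chart around `x`. -/
def isotropyJet (x : X) (z : X) (c : IsotropyCoeff q E) : Jet E E X X q :=
  jet E E q (isotropyMap x z c) z

/-- The coefficients of positive degree of a jet, in the chart around `x`. -/
def isotropyCoord (x : X) (h : Jet E E X X q) : IsotropyCoeff q E :=
  isotropyTail (jetCoord (chartAt E x) (chartAt E x) h).2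

variable {x z : X} {c : IsotropyCoeff q E}

theorem mem_jetTarget_isotropy (hz : z ∈ (chartAt E x).source) :
    ((chartAt E x z, isotropyCoeff (chartAt E x z) c) : JetModel q E E) ∈
      jetTarget q (chartAt E x) (chartAt E x) := by
  refine ⟨(chartAt E x).map_source hz, ?_⟩
  rw [taylorPoly_isotropyCoeff]
  exact (chartAt E x).map_source hz

theorem isotropyMap_self (hz : z ∈ (chartAt E x).source) : isotropyMap x z c z = z := by
  have h := polyMap_apply (mem_jetTarget_isotropy (c := c) hz)
  rwa [(chartAt E x).left_inv hz, taylorPoly_isotropyCoeff, (chartAt E x).left_inv hz] at h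

theorem smoothAround_isotropyMap (hz : z ∈ (chartAt E x).source) :
    SmoothAround ((𝓘(ℝ, E).prod 𝓘(ℝ, IsotropyCoeff q E)).prod 𝓘(ℝ, E)) 𝓘(ℝ, E)
      (fun w : (X × IsotropyCoeff q E) × X => isotropyMap x w.1.1 w.1.2 w.2) ((z, c), z) := by
  set φ := chartAt E x
  let I := (𝓘(ℝ, E).prod 𝓘(ℝ, IsotropyCoeff q E)).prod 𝓘(ℝ, E)
  have s1 : SmoothAround I 𝓘(ℝ, E) (fun w : (X × IsotropyCoeff q E) × X => φ w.1.1)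
      ((z, c), z) :=
    (smoothAround_chartAt hz).comp_of_eq ((SmoothAround.fst _).comp_of_eq (SmoothAround.fst _) rfl)
      rfl
  have s2 : SmoothAround I 𝓘(ℝ, E) (fun w : (X × IsotropyCoeff q E) × X => φ w.2)
      ((z, c), z) := (smoothAround_chartAt hz).comp_of_eq (SmoothAround.snd _) rfl
  have s3 : SmoothAround I 𝓘(ℝ, IsotropyCoeff q E)
      (fun w : (X × IsotropyCoeff q E) × X => w.1.2) ((z, c), z) :=
    (SmoothAround.snd _).comp_of_eq (SmoothAround.fst _) rfl
  have hp : ContDiff ℝ ∞ (fun w : (E × IsotropyCoeff q E) × E =>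
      taylorPoly (isotropyCoeff w.1.1 w.1.2) (w.2 - w.1.1)) :=
    contDiff_taylorPoly.comp ((contDiff_isotropyCoeff.comp contDiff_fst).prodMk
      (contDiff_snd.sub contDiff_fst.fst))
  refine SmoothAround.comp_of_eq (g := φ.symm) (f := fun w : (X × IsotropyCoeff q E) × X =>
    taylorPoly (isotropyCoeff (φ w.1.1) w.1.2) (φ w.2 - φ w.1.1))
    (smoothAround_chartAt_symm (φ.map_source hz)) (SmoothAround.comp (g := fun w : (E × IsotropyCoeff q E) × E =>
      taylorPoly (isotropyCoeff w.1.1 w.1.2) (w.2 - w.1.1))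
      (f := fun w : (X × IsotropyCoeff q E) × X => ((φ w.1.1, w.1.2), φ w.2)) (hp.smoothAround _)
      ((s1.prodMk_space s3).prodMk_space s2)) ?_
  dsimp only
  rw [sub_self, taylorPoly_isotropyCoeff]

theorem smoothNear_isotropyMap (hz : z ∈ (chartAt E x).source) :
    SmoothNear E E (isotropyMap x z c) z :=
  SmoothAround.comp_of_eq
    (g := fun w : (X × IsotropyCoeff q E) × X => isotropyMap x w.1.1 w.1.2 w.2)
    (f := fun w : X => ((z, c), w)) (smoothAround_isotropyMap hz)
    ((SmoothAround.const (z, c) z).prodMk (SmoothAround.id z)) rfl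

theorem smoothAround_isotropyJet (hz : z ∈ (chartAt E x).source) :
    SmoothAround (𝓘(ℝ, E).prod 𝓘(ℝ, IsotropyCoeff q E)) 𝓘(ℝ, JetModel q E E)
      (fun w : X × IsotropyCoeff q E => isotropyJet x w.1 w.2) (z, c) :=
  smoothAround_jet (p₀ := (z, c)) (G := fun w : X × IsotropyCoeff q E => isotropyMap x w.1 w.2)
    (b := fun w => w.1) (smoothAround_isotropyMap hz) (SmoothAround.fst _)

@[simp] theorem source_isotropyJet : (isotropyJet x z c).source = z := source_jet _ _

theorem target_isotropyJet (hz : z ∈ (chartAt E x).source) : (isotropyJet x z c).target = z := by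
  rw [isotropyJet, target_jet, isotropyMap_self hz]

theorem isotropyCoord_isotropyJet (hz : z ∈ (chartAt E x).source) :
    isotropyCoord x (isotropyJet x z c) = c := by
  rw [isotropyCoord, isotropyJet, jetCoord_jet (chart_mem_atlas E x) (chart_mem_atlas E x)
    (smoothNear_isotropyMap hz) hz (by rwa [isotropyMap_self hz])]
  funext i
  have h := iteratedFDeriv_polyMap (mem_jetTarget_isotropy (c := c) hz) i.succ
  refine Subtype.ext ?_
  change (symmetrize _ (iteratedFDeriv ℝ (i.succ : Fin (q + 1))
    (localRep (chartAt E x) (chartAt E x) (isotropyMap x z c)) (chartAt E x z))).1 = _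
  rw [isotropyMap, h, symmetrize_of_mem (SetLike.coe_mem _)]
  rfl

theorem isotropyJet_isotropyCoord (hz : z ∈ (chartAt E x).source) {h : Jet E E X X q}
    (hs : h.source = z) (ht : h.target = z) : isotropyJet x z (isotropyCoord x h) = h := by
  subst hs
  have h1 := taylorPoly_jetCoord (chart_mem_atlas E x) (chart_mem_atlas E x) hz
    (j := h) (by rwa [ht])
  rw [ht] at h1
  have h2 := jet_polyMap (chart_mem_atlas E x) (chart_mem_atlas E x) hz (j := h) (by rwa [ht])
  rw [isotropyJet, isotropyMap, isotropyCoord, isotropyCoeff_tail h1]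
  exact h2

/-- The chart expression of the identity is the identity of `E`, whose derivatives of positive order
are the same at all points. Hence a single parameter value describes the identity jets at all points
of the chart. -/
theorem isotropyCoord_jet_id (hz : z ∈ (chartAt E x).source) :
    isotropyCoord x (jet E E q id z) = isotropyCoord x (jet E E q id x) := by
  have h : ∀ z ∈ (chartAt E x).source, isotropyCoord x (jet E E q id z) =
      fun i : Fin q => symmetrize _ (iteratedFDeriv ℝ (i.succ : Fin (q + 1)) (fun v : E => v)
        (chartAt E x z)) := by
    intro z hz
    rw [isotropyCoord, jetCoord_jet (f := id) (chart_mem_atlas E x) (chart_mem_atlas E x)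
      (SmoothAround.id z) hz hz]
    funext i
    have h1 : localRep (chartAt E x) (chartAt E x) id =ᶠ[𝓝 (chartAt E x z)] fun v => v := by
      filter_upwards [(chartAt E x).open_target.mem_nhds ((chartAt E x).map_source hz)] with v hv
      exact (chartAt E x).right_inv hv
    change symmetrize _ (iteratedFDeriv ℝ (i.succ : Fin (q + 1))
      (localRep (chartAt E x) (chartAt E x) id) (chartAt E x z)) = _
    rw [(h1.iteratedFDeriv ℝ _).eq_of_nhds]
  rw [h z hz, h x (mem_chart_source E x)]
  funext i
  exact congrArg _ (iteratedFDeriv_succ_id_eq i _ _)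

theorem isotropyJet_id (hz : z ∈ (chartAt E x).source) :
    isotropyJet x z (isotropyCoord x (jet E E q id x)) = jet E E q id z := by
  rw [← isotropyCoord_jet_id hz]
  exact isotropyJet_isotropyCoord hz (source_jet _ _) (target_jet _ _)

theorem smoothAround_isotropyCoord {h : Jet E E X X q} (hs : h.source ∈ (chartAt E x).source)
    (ht : h.target ∈ (chartAt E x).source) :
    SmoothAround 𝓘(ℝ, JetModel q E E) 𝓘(ℝ, IsotropyCoeff q E) (isotropyCoord x) h := by
  -- The chart of the jet space around the jet of the identity at `x` uses the chart around `x` for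
  -- both source and target.
  have h1 : h ∈ (chartAt (JetModel q E E) (jet E E q id x)).source := by
    rw [mem_chartAt_jet_source, source_jet, target_jet]
    exact ⟨hs, ht⟩
  refine (SmoothAround.comp (g := fun w : JetModel q E E => isotropyTail w.2)
    ((contDiff_isotropyTail.comp contDiff_snd).smoothAround _) (smoothAround_chartAt h1)).congr ?_
  refine Eventually.of_forall fun j => ?_
  change _ = isotropyTail (chartAt (JetModel q E E) (jet E E q id x) j).2
  rw [chartAt_jet_apply, source_jet, target_jet]
  rfl

end IsotropyJets

-- By the chain rule for `f = T ∘ f ∘ R` near `a`, the derivative of `f` at `a` factors through its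
-- derivative at `b`. For an orbit map, `R` is a translation of the group and `T` the action of the
-- inverse element.
open Module in
theorem finrank_range_fderiv_le {C V : Type*} [NormedAddCommGroup C] [NormedSpace ℝ C]
    [FiniteDimensional ℝ C] [NormedAddCommGroup V] [NormedSpace ℝ V]
    {f : C → V} {T : V → V} {R : C → C} {a b : C} (hR : DifferentiableAt ℝ R a) (hRa : R a = b)
    (hf : DifferentiableAt ℝ f b) (hT : DifferentiableAt ℝ T (f b))
    (h : f =ᶠ[𝓝 a] fun c => T (f (R c))) :
    finrank ℝ (fderiv ℝ f a).range ≤ finrank ℝ (fderiv ℝ f b).range := by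
  subst hRa
  have h1 : fderiv ℝ f a =
      (fderiv ℝ T (f (R a))).comp ((fderiv ℝ f (R a)).comp (fderiv ℝ R a)) := by
    rw [h.fderiv_eq]
    exact (hT.hasFDerivAt.comp (f := fun c => f (R c)) a
      (hf.hasFDerivAt.comp a hR.hasFDerivAt)).fderiv
  rw [h1]
  refine le_trans (Submodule.finrank_mono (t := (fderiv ℝ f (R a)).range.map
    (fderiv ℝ T (f (R a))).toLinearMap) ?_) (Submodule.finrank_map_le _ _)
  rintro _ ⟨v, rfl⟩
  exact ⟨_, ⟨_, rfl⟩, rfl⟩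

/-! ### Local trivializations in terms of germs. -/

section LocalTrivialization

set_option linter.unusedSectionVars false

variable {E EM V : Type*} [NormedAddCommGroup E] [NormedSpace ℝ E]
  [NormedAddCommGroup EM] [NormedSpace ℝ EM] [NormedAddCommGroup V] [NormedSpace ℝ V]
  {X M F : Type*} [TopologicalSpace X] [ChartedSpace E X]
  [TopologicalSpace M] [ChartedSpace EM M] [TopologicalSpace F] [ChartedSpace V F]

variable (E EM V) in
/-- `Φ` and `Ψ` are the fibre component and the inverse of a smooth trivialization of `π` over the
open set `U`. -/
structure IsLocalTrivialization (π : M → X) (U : Set X) (Φ : M → F) (Ψ : X × F → M) : Prop where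
  isOpen : IsOpen U
  smoothAround_fst : ∀ m, π m ∈ U → SmoothAround 𝓘(ℝ, EM) 𝓘(ℝ, V) Φ m
  smoothAround_symm : ∀ y ∈ U, ∀ c, SmoothAround (𝓘(ℝ, E).prod 𝓘(ℝ, V)) 𝓘(ℝ, EM) Ψ (y, c)
  proj_symm : ∀ y ∈ U, ∀ c, π (Ψ (y, c)) = y
  fst_symm : ∀ y ∈ U, ∀ c, Φ (Ψ (y, c)) = c
  symm_apply : ∀ m, π m ∈ U → Ψ (π m, Φ m) = m

theorem IsSmoothFiberBundle.exists_isLocalTrivialization {X M : Type u} [TopologicalSpace X]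
    [ChartedSpace E X] [TopologicalSpace M] [ChartedSpace EM M] {π : M → X}
    (h : IsSmoothFiberBundle E EM π univ) (x : X) :
    ∃ (V : Type) (_ : NormedAddCommGroup V) (_ : NormedSpace ℝ V)
    (_ : FiniteDimensional ℝ V) (F : Type u) (_ : TopologicalSpace F) (_ : ChartedSpace V F)
    (_ : IsManifold 𝓘(ℝ, V) ∞ F) (U : Set X) (Φ : M → F) (Ψ : X × F → M),
    x ∈ U ∧ IsLocalTrivialization E EM V π U Φ Ψ := by
  have hπ : Continuous π := continuousOn_univ.1 h.contMDiffOn_proj.continuousOn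
  obtain ⟨V, _, _, _, F, _, _, _, htriv⟩ := h.locally_trivial
  obtain ⟨U, hU, hxU, Φ, Ψ, hΦ, hΨ, hΨΦ, hΦΨ⟩ := htriv x
  refine ⟨V, inferInstance, inferInstance, inferInstance, F, inferInstance, inferInstance,
    inferInstance, U, Φ, Ψ, hxU, hU, fun m hm => ?_, fun y hy c => ?_, fun y hy c => ?_,
    fun y hy c => ?_, fun m hm => hΦΨ m (mem_univ _) hm⟩
  · refine SmoothAround.of_contMDiffOn hΦ ?_
    rw [univ_inter]
    exact (hU.preimage hπ).mem_nhds hm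
  · exact SmoothAround.of_contMDiffOn hΨ ((hU.prod isOpen_univ).mem_nhds ⟨hy, mem_univ _⟩)
  · exact (hΨΦ y hy c).2.1
  · exact (hΨΦ y hy c).2.2

end LocalTrivialization

/-! ### The orbit map of the isotropy group is a submersion. -/

section Orbit

set_option linter.unusedSectionVars false

variable {E EM V : Type*} [NormedAddCommGroup E] [NormedSpace ℝ E] [FiniteDimensional ℝ E]
  [NormedAddCommGroup EM] [NormedSpace ℝ EM]
  [NormedAddCommGroup V] [NormedSpace ℝ V] [FiniteDimensional ℝ V]
  {X F : Type*} {M : Type u} [TopologicalSpace X] [ChartedSpace E X] [IsManifold 𝓘(ℝ, E) ∞ X]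
  [TopologicalSpace M] [ChartedSpace EM M] [IsManifold 𝓘(ℝ, EM) ∞ M]
  [TopologicalSpace F] [ChartedSpace V F] [IsManifold 𝓘(ℝ, V) ∞ F]
  {π : M → X} {q r : ℕ} {act : M → Jet E E X X q → M}
  {U : Set X} {Φ : M → F} {Ψ : X × F → M} {x : X} {u₀ : M}

theorem IsNaturalBundle.smoothAround_act {EP HP P : Type*} [NormedAddCommGroup EP]
    [NormedSpace ℝ EP] [TopologicalSpace HP] {I : ModelWithCorners ℝ EP HP} [TopologicalSpace P]
    [ChartedSpace HP P] (hZ : IsNaturalBundle E EM q π univ act) {v : P → M}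
    {g : P → Jet E E X X q} {p : P} (hv : SmoothAround I 𝓘(ℝ, EM) v p)
    (hg : SmoothAround I 𝓘(ℝ, JetModel q E E) g p) (hp : g p ∈ fullJetGroupoid E X q)
    (h : ∀ᶠ p' in 𝓝 p, π (v p') = (g p').target) :
    SmoothAround I 𝓘(ℝ, EM) (fun p => act (v p) (g p)) p := by
  have := FiniteDimensional.complete ℝ E
  refine SmoothAround.contMDiffOn_comp hZ.isGroupoidAction.contMDiffOn_act
    (f := fun p => (v p, g p)) (hv.prodMk hg) ?_
  filter_upwards [h, hg.continuousAt.eventually_mem (isOpen_fullJetGroupoid.mem_nhds hp)]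
    with p h1 h2
  exact ⟨mem_univ _, h2, h1⟩

theorem IsGroupoidAction.act_act_act (h : IsGroupoidAction E EM q π univ act) {u : M}
    {a b d : Jet E E X X q} (ha : a ∈ fullJetGroupoid E X q) (hb : b ∈ fullJetGroupoid E X q)
    (hd : d ∈ fullJetGroupoid E X q) (hu : π u = a.target) (hab : a.source = b.target)
    (hbd : b.source = d.target) (he : b.comp d = jet E E q id a.source) :
    act (act u (a.comp b)) d = act u a := by
  have h1 := h.act_mem u (mem_univ _) a ha hu
  rw [h.act_comp u (mem_univ _) a ha b hb hu hab,
    ← h.act_comp _ (mem_univ _) b hb d hd (h1.2.trans hab) hbd, he, ← h1.2,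
    h.act_one _ (mem_univ _)]

theorem smoothAround_isotropyJet_self (c : IsotropyCoeff q E) :
    SmoothAround 𝓘(ℝ, IsotropyCoeff q E) 𝓘(ℝ, JetModel q E E)
      (fun c : IsotropyCoeff q E => isotropyJet x x c) c :=
  SmoothAround.comp_of_eq (g := fun w : X × IsotropyCoeff q E => isotropyJet x w.1 w.2)
    (f := fun c : IsotropyCoeff q E => (x, c)) (smoothAround_isotropyJet (mem_chart_source E x))
    ((SmoothAround.const x c).prodMk (SmoothAround.id c)) rfl

/-- If `b` is the jet of `β`, the product is the jet at `x` of `isotropyMap x x c ∘ β`, a family of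
maps that is smooth in `c`. -/
theorem smoothAround_isotropyJet_comp {b : Jet E E X X q} (hb : b ∈ fullJetGroupoid E X q)
    (hs : b.source = x) (ht : b.target = x) (c : IsotropyCoeff q E) :
    SmoothAround 𝓘(ℝ, IsotropyCoeff q E) 𝓘(ℝ, JetModel q E E)
      (fun c : IsotropyCoeff q E => (isotropyJet x x c).comp b) c := by
  have mx := mem_chart_source E x
  obtain ⟨β, hβ, hβx, hβb⟩ := exists_localDiffeomorph_of_mem hb
  rw [ht, hs] at hβx
  rw [hs] at hβ hβb
  have sβ := smoothNear_of_isLocalDiffeomorphAt hβ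
  have e : ∀ c : IsotropyCoeff q E, (isotropyJet x x c).comp b =
      jet E E q (fun y => isotropyMap x x c (β y)) x := by
    intro c
    have h := Jet.comp_jet (r := q) (g := isotropyMap x x c) (f := β) (x := x)
      (by rw [hβx]; exact smoothNear_isotropyMap mx) sβ
    rw [hβx, ← hβb] at h
    exact h
  simp only [e]
  refine smoothAround_jet (G := fun (c : IsotropyCoeff q E) (y : X) => isotropyMap x x c (β y))
    (b := fun _ => x) ?_ (SmoothAround.const x c)
  refine SmoothAround.comp_of_eq
    (g := fun w : (X × IsotropyCoeff q E) × X => isotropyMap x w.1.1 w.1.2 w.2)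
    (f := fun w : IsotropyCoeff q E × X => ((x, w.1), β w.2)) (smoothAround_isotropyMap (c := c) mx)
    (((SmoothAround.const x _).prodMk (SmoothAround.fst _)).prodMk
      (SmoothAround.comp_of_eq (g := β) sβ (SmoothAround.snd _) rfl)) ?_
  dsimp only
  rw [hβx]

variable (V) in
/-- The orbit map of `u₀` under the isotropy group at `x`, in coordinates. -/
def orbitMap (act : M → Jet E E X X q → M) (Φ : M → F) (x : X) (u₀ : M)
    (c : IsotropyCoeff q E) : V :=
  chartAt V (Φ u₀) (Φ (act u₀ (isotropyJet x x c)))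

variable (V) in
/-- The domain of the orbit map. -/
def orbitDomain (act : M → Jet E E X X q → M) (Φ : M → F) (x : X) (u₀ : M) :
    Set (IsotropyCoeff q E) :=
  {c | isotropyJet x x c ∈ fullJetGroupoid E X q ∧
    Φ (act u₀ (isotropyJet x x c)) ∈ (chartAt V (Φ u₀)).source}

theorem smoothAround_orbit
    (hZ : IsNaturalBundle E EM q π univ act) (hT : IsLocalTrivialization E EM V π U Φ Ψ)
    (hx : x ∈ U) (hu : π u₀ = x) {c : IsotropyCoeff q E}
    (hc : isotropyJet x x c ∈ fullJetGroupoid E X q) :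
    SmoothAround 𝓘(ℝ, IsotropyCoeff q E) 𝓘(ℝ, V)
      (fun c : IsotropyCoeff q E => Φ (act u₀ (isotropyJet x x c))) c := by
  have ht : ∀ c : IsotropyCoeff q E, π u₀ = (isotropyJet x x c).target := fun c => by
    rw [hu, target_isotropyJet (mem_chart_source E x)]
  have h1 := hZ.smoothAround_act (SmoothAround.const u₀ c) (smoothAround_isotropyJet_self c) hc
    (Eventually.of_forall ht)
  refine SmoothAround.comp (g := Φ) (hT.smoothAround_fst _ ?_) h1
  rwa [(hZ.isGroupoidAction.act_mem _ (mem_univ _) _ hc (ht c)).2, source_isotropyJet]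

theorem isOpen_orbitDomain
    (hZ : IsNaturalBundle E EM q π univ act) (hT : IsLocalTrivialization E EM V π U Φ Ψ)
    (hx : x ∈ U) (hu : π u₀ = x) : IsOpen (orbitDomain V act Φ x u₀) := by
  have := FiniteDimensional.complete ℝ E
  rw [isOpen_iff_mem_nhds]
  intro c hc
  filter_upwards [(smoothAround_isotropyJet_self c).continuousAt.eventually_mem
    (isOpen_fullJetGroupoid.mem_nhds hc.1),
    (smoothAround_orbit hZ hT hx hu hc.1).continuousAt.eventually_mem
    ((chartAt V (Φ u₀)).open_source.mem_nhds hc.2)] with c h1 h2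
  exact ⟨h1, h2⟩

theorem smoothAround_orbitMap
    (hZ : IsNaturalBundle E EM q π univ act) (hT : IsLocalTrivialization E EM V π U Φ Ψ)
    (hx : x ∈ U) (hu : π u₀ = x) {c : IsotropyCoeff q E} (hc : c ∈ orbitDomain V act Φ x u₀) :
    SmoothAround 𝓘(ℝ, IsotropyCoeff q E) 𝓘(ℝ, V) (orbitMap V act Φ x u₀) c :=
  SmoothAround.comp (g := chartAt V (Φ u₀)) (smoothAround_chartAt hc.2)
    (smoothAround_orbit hZ hT hx hu hc.1)

/-- By transitivity every point of the fibre is `u₀ g` for an isotropy jet `g`, and `g` is recovered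
from its coordinates. This provides the interior point of the image that excludes a smaller rank. -/
theorem target_subset_image_orbitMap
    (hT : IsLocalTrivialization E EM V π U Φ Ψ)
    (hx : x ∈ U) (hu : π u₀ = x) (hh : HasHomogeneousFibers π univ act) :
    (chartAt V (Φ u₀)).target ⊆ orbitMap V act Φ x u₀ '' orbitDomain V act Φ x u₀ := by
  intro t ht
  obtain ⟨g, hg, hs, ht', hga⟩ := hh u₀ (mem_univ _) (Ψ (x, (chartAt V (Φ u₀)).symm t))
    (mem_univ _) (by rw [hu, hT.proj_symm x hx])
  rw [hu] at hs ht'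
  have e := isotropyJet_isotropyCoord (mem_chart_source E x) hs ht'
  refine ⟨isotropyCoord x g, ⟨?_, ?_⟩, ?_⟩
  · rwa [e]
  · rw [e, hga, hT.fst_symm x hx]
    exact (chartAt V (Φ u₀)).map_target ht
  · rw [orbitMap, e, hga, hT.fst_symm x hx, (chartAt V (Φ u₀)).right_inv ht]

-- The orbit map is equivariant. Choose `k` with `a k = b` and inverse `d`: since `u₀ c = (u₀ (c k))
-- d`, the orbit map is, near `a`, the composite of right translation by `k`, the orbit map near
-- `b`, and the action of `d` on the fibre. As `a` and `b` are arbitrary, the rank is constant.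
open Module in
theorem finrank_range_fderiv_orbitMap_le
    (hZ : IsNaturalBundle E EM q π univ act) (hT : IsLocalTrivialization E EM V π U Φ Ψ)
    (hx : x ∈ U) (hu : π u₀ = x)
    {a b : IsotropyCoeff q E}
    (ha : a ∈ orbitDomain V act Φ x u₀) (hb : b ∈ orbitDomain V act Φ x u₀) :
    finrank ℝ (fderiv ℝ (orbitMap V act Φ x u₀) a).range ≤
      finrank ℝ (fderiv ℝ (orbitMap V act Φ x u₀) b).range := by
  have mx := mem_chart_source E x
  have A := hZ.isGroupoidAction
  obtain ⟨k, hk, d, hd, hks, hkt, hds, hdt, hak, hkd⟩ := exists_comp_eq ha.1 hb.1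
    (by simp) (by rw [target_isotropyJet mx, target_isotropyJet mx])
  rw [source_isotropyJet] at hks hkt hds hdt hkd
  set ψ := chartAt V (Φ u₀) with hψ
  have ht : ∀ c : IsotropyCoeff q E, (isotropyJet x x c).target = x := fun c =>
    target_isotropyJet mx
  have back : ∀ c : IsotropyCoeff q E, isotropyJet x x c ∈ fullJetGroupoid E X q →
      act (act u₀ ((isotropyJet x x c).comp k)) d = act u₀ (isotropyJet x x c) := fun c hc =>
    A.act_act_act hc hk hd (by rw [hu, ht]) (by rw [source_isotropyJet, hkt]) (by rw [hks, hdt])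
      (by rw [hkd, source_isotropyJet])
  let R : IsotropyCoeff q E → IsotropyCoeff q E := fun c =>
    isotropyCoord x ((isotropyJet x x c).comp k)
  have hRk : ∀ c, isotropyJet x x (R c) = (isotropyJet x x c).comp k := fun c =>
    isotropyJet_isotropyCoord mx (by rw [Jet.source_comp, hks])
      (by rw [Jet.target_comp (by rw [source_isotropyJet, hkt]), ht])
  have hRa : R a = b := by
    change isotropyCoord x ((isotropyJet x x a).comp k) = b
    rw [hak, isotropyCoord_isotropyJet mx]
  have sR : SmoothAround 𝓘(ℝ, IsotropyCoeff q E) 𝓘(ℝ, IsotropyCoeff q E) R a := by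
    refine SmoothAround.comp (g := isotropyCoord x) (smoothAround_isotropyCoord ?_ ?_)
      (smoothAround_isotropyJet_comp hk hks hkt a)
    · rwa [Jet.source_comp, hks]
    · rwa [Jet.target_comp (by rw [source_isotropyJet, hkt]), ht]
  -- Over `x` the fibre coordinate determines the point, which turns the action of `d` on the fibre
  -- into a map `T` of coordinates.
  have symm_act : ∀ v, π v = x → Ψ (x, Φ v) = v := fun v hv => by
    have := hT.symm_apply v (by rwa [hv])
    rwa [hv] at this
  have hπ : ∀ c : IsotropyCoeff q E, isotropyJet x x c ∈ fullJetGroupoid E X q →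
      π (act u₀ (isotropyJet x x c)) = x := fun c hc => by
    rw [(A.act_mem _ (mem_univ _) _ hc (by rw [hu, ht])).2, source_isotropyJet]
  let T : V → V := fun s => ψ (Φ (act (Ψ (x, ψ.symm s)) d))
  have eT : ∀ c ∈ orbitDomain V act Φ x u₀,
      Ψ (x, ψ.symm (orbitMap V act Φ x u₀ c)) = act u₀ (isotropyJet x x c) := fun c hc => by
    rw [orbitMap, ψ.left_inv hc.2, symm_act _ (hπ c hc.1)]
  have sT : SmoothAround 𝓘(ℝ, V) 𝓘(ℝ, V) T (orbitMap V act Φ x u₀ b) := by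
    have h1 : SmoothAround 𝓘(ℝ, V) 𝓘(ℝ, EM) (fun s => Ψ (x, ψ.symm s))
        (orbitMap V act Φ x u₀ b) :=
      SmoothAround.comp (g := Ψ) (f := fun s => (x, ψ.symm s)) (hT.smoothAround_symm x hx _)
        ((SmoothAround.const x _).prodMk (smoothAround_chartAt_symm (ψ.map_source hb.2)))
    have h2 : SmoothAround 𝓘(ℝ, V) 𝓘(ℝ, EM) (fun s => act (Ψ (x, ψ.symm s)) d)
        (orbitMap V act Φ x u₀ b) :=
      hZ.smoothAround_act h1 (SmoothAround.const d _) hd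
        (Eventually.of_forall fun s => by rw [hT.proj_symm x hx, hdt])
    have e0 : act (Ψ (x, ψ.symm (orbitMap V act Φ x u₀ b))) d = act u₀ (isotropyJet x x a) := by
      rw [eT b hb, ← hak, back a ha.1]
    have h3 : SmoothAround 𝓘(ℝ, V) 𝓘(ℝ, V) (fun s => Φ (act (Ψ (x, ψ.symm s)) d))
        (orbitMap V act Φ x u₀ b) :=
      SmoothAround.comp (g := Φ) (hT.smoothAround_fst _ (by rwa [e0, hπ a ha.1])) h2
    refine SmoothAround.comp (g := ψ) (smoothAround_chartAt ?_) h3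
    rw [e0]
    exact ha.2
  have hO := isOpen_orbitDomain hZ hT hx hu
  refine finrank_range_fderiv_le (sR.contMDiffAt.contDiffAt.differentiableAt (by simp)) hRa
    ((smoothAround_orbitMap hZ hT hx hu hb).contMDiffAt.contDiffAt.differentiableAt (by simp))
    (sT.contMDiffAt.contDiffAt.differentiableAt (by simp)) ?_
  filter_upwards [hO.mem_nhds ha, sR.continuousAt.eventually_mem (hO.mem_nhds (by rwa [hRa]))]
    with c h1 h2
  change _ = ψ (Φ (act (Ψ (x, ψ.symm (orbitMap V act Φ x u₀ (R c)))) d))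
  rw [eT _ h2, hRk, back c h1.1]
  rfl

/-- The orbit map of a transitive action is a submersion. -/
theorem range_fderiv_orbitMap
    (hZ : IsNaturalBundle E EM q π univ act) (hT : IsLocalTrivialization E EM V π U Φ Ψ)
    (hx : x ∈ U) (hu : π u₀ = x) (hh : HasHomogeneousFibers π univ act) :
    (fderiv ℝ (orbitMap V act Φ x u₀) (isotropyCoord x (jet E E q id x))).range = ⊤ := by
  have mx := mem_chart_source E x
  refine range_fderiv_eq_top_of_constant_rank (isOpen_orbitDomain hZ hT hx hu)
    (fun c hc => (smoothAround_orbitMap hZ hT hx hu hc).contMDiffAt.contDiffAt)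
    (fun a ha b hb => finrank_range_fderiv_orbitMap_le hZ hT hx hu ha hb)
    ⟨chartAt V (Φ u₀) (Φ u₀), ?_⟩ ⟨?_, ?_⟩
  · exact interior_mono (target_subset_image_orbitMap hT hx hu hh)
      (by rw [(chartAt V (Φ u₀)).open_target.interior_eq]; exact mem_chart_target V (Φ u₀))
  · rw [isotropyJet_id mx]
    exact jet_id_mem_fullJetGroupoid x
  · rw [isotropyJet_id mx, ← hu, hZ.isGroupoidAction.act_one _ (mem_univ _)]
    exact mem_chart_source V (Φ u₀)

end Orbit

/-! ### Smooth choice of isotropy jets between nearby points of a fibre. -/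

section HomogeneousFibers

set_option linter.unusedSectionVars false

variable {E EM V : Type*} [NormedAddCommGroup E] [NormedSpace ℝ E] [FiniteDimensional ℝ E]
  [NormedAddCommGroup EM] [NormedSpace ℝ EM]
  [NormedAddCommGroup V] [NormedSpace ℝ V] [FiniteDimensional ℝ V]
  {X F : Type*} {M : Type u} [TopologicalSpace X] [ChartedSpace E X] [IsManifold 𝓘(ℝ, E) ∞ X]
  [TopologicalSpace M] [ChartedSpace EM M] [IsManifold 𝓘(ℝ, EM) ∞ M]
  [TopologicalSpace F] [ChartedSpace V F] [IsManifold 𝓘(ℝ, V) ∞ F]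
  {π : M → X} {q r : ℕ} {act : M → Jet E E X X q → M}
  {U : Set X} {Φ : M → F} {Ψ : X × F → M} {x : X} {u₀ : M}

theorem SmoothAround.isotropyJet {EP HP P : Type*} [NormedAddCommGroup EP] [NormedSpace ℝ EP]
    [TopologicalSpace HP] {I : ModelWithCorners ℝ EP HP} [TopologicalSpace P] [ChartedSpace HP P]
    {z : P → X} {c : P → IsotropyCoeff q E} {p : P} (hz : SmoothAround I 𝓘(ℝ, E) z p)
    (hc : SmoothAround I 𝓘(ℝ, IsotropyCoeff q E) c p) (hp : z p ∈ (chartAt E x).source) :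
    SmoothAround I 𝓘(ℝ, JetModel q E E)
      (fun p => JetBundles.isotropyJet x (z p) (c p)) p :=
  SmoothAround.comp (g := fun w : X × IsotropyCoeff q E => JetBundles.isotropyJet x w.1 w.2)
    (f := fun p => (z p, c p)) (smoothAround_isotropyJet hp) (hz.prodMk hc)

/-- If the fibres are homogeneous, two points `u` and `v` of the fibre over `z` that are close to
each other are related by an isotropy jet at `z` that depends smoothly on `(z, u, v)` and is the
identity for `u = v`. -/
theorem exists_smooth_isotropy (hZ : IsNaturalBundle E EM q π univ act)
    (hT : IsLocalTrivialization E EM V π U Φ Ψ) (hx : x ∈ U) (hu : π u₀ = x)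
    (hh : HasHomogeneousFibers π univ act) :
    ∃ c : X × M × M → IsotropyCoeff q E,
      SmoothAround (𝓘(ℝ, E).prod (𝓘(ℝ, EM).prod 𝓘(ℝ, EM))) 𝓘(ℝ, IsotropyCoeff q E) c
        (x, u₀, u₀) ∧
      (∀ᶠ w in 𝓝 (x, u₀, u₀), π w.2.1 = w.1 → π w.2.2 = w.1 →
        isotropyJet x w.1 (c w) ∈ fullJetGroupoid E X q ∧
          act w.2.1 (isotropyJet x w.1 (c w)) = w.2.2) ∧
      ∀ᶠ w in 𝓝 (x, u₀), π w.2 = w.1 →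
        c (w.1, w.2, w.2) = isotropyCoord x (jet E E q id x) := by
  have := FiniteDimensional.complete ℝ E
  have := FiniteDimensional.complete ℝ V
  have mx := mem_chart_source E x
  have mu := mem_chart_source V (Φ u₀)
  have A := hZ.isGroupoidAction
  have hRange := range_fderiv_orbitMap hZ hT hx hu hh
  set φ := chartAt E x with hφ
  set ψ := chartAt V (Φ u₀) with hψ
  obtain ⟨e, he⟩ : ∃ e : IsotropyCoeff q E, e = isotropyCoord x (jet E E q id x) := ⟨_, rfl⟩
  rw [← he] at hRange ⊢
  have hue : Ψ (x, Φ u₀) = u₀ := by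
    have := hT.symm_apply u₀ (by rwa [hu])
    rwa [hu] at this
  have act_id : ∀ v z, z ∈ φ.source → π v = z → act v (isotropyJet x z e) = v := by
    rintro v z hz rfl
    rw [he, isotropyJet_id hz, A.act_one _ (mem_univ _)]
  let a₀ : E × V := (φ x, ψ (Φ u₀))
  have ex : φ.symm (φ x) = x := φ.left_inv mx
  have eu : ψ.symm (ψ (Φ u₀)) = Φ u₀ := ψ.left_inv mu
  let I := 𝓘(ℝ, (E × V) × IsotropyCoeff q E)
  have s1 : SmoothAround I 𝓘(ℝ, E) (fun v : (E × V) × IsotropyCoeff q E => φ.symm v.1.1)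
      (a₀, e) :=
    SmoothAround.comp (g := φ.symm) (smoothAround_chartAt_symm (φ.map_source mx))
      (contDiff_fst.fst.smoothAround (a₀, e))
  have s2 : SmoothAround I 𝓘(ℝ, V) (fun v : (E × V) × IsotropyCoeff q E => ψ.symm v.1.2)
      (a₀, e) :=
    SmoothAround.comp (g := ψ.symm) (smoothAround_chartAt_symm (ψ.map_source mu))
      (contDiff_fst.snd.smoothAround (a₀, e))
  have s3 : SmoothAround I 𝓘(ℝ, EM)
      (fun v : (E × V) × IsotropyCoeff q E => Ψ (φ.symm v.1.1, ψ.symm v.1.2)) (a₀, e) :=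
    SmoothAround.comp (g := Ψ) (hT.smoothAround_symm _ (by change φ.symm (φ x) ∈ U; rwa [ex]) _)
      (s1.prodMk s2)
  have s4 : SmoothAround I 𝓘(ℝ, JetModel q E E)
      (fun v : (E × V) × IsotropyCoeff q E => isotropyJet x (φ.symm v.1.1) v.2) (a₀, e) :=
    SmoothAround.isotropyJet s1 (contDiff_snd.smoothAround (a₀, e))
      (by change φ.symm (φ x) ∈ φ.source; rwa [ex])
  have m4 : isotropyJet x (φ.symm a₀.1) e ∈ fullJetGroupoid E X q := by
    change isotropyJet x (φ.symm (φ x)) e ∈ _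
    rw [ex, he, isotropyJet_id mx]
    exact jet_id_mem_fullJetGroupoid x
  -- A pair in `E × V` gives the base and fibre coordinates of a point `u`, and `G'` is the fibre
  -- component of `u` multiplied by the isotropy jet with coefficients `c`.
  let G' : (E × V) × IsotropyCoeff q E → F := fun v =>
    Φ (act (Ψ (φ.symm v.1.1, ψ.symm v.1.2)) (isotropyJet x (φ.symm v.1.1) v.2))
  have s5 : SmoothAround I 𝓘(ℝ, EM) (fun v : (E × V) × IsotropyCoeff q E =>
      act (Ψ (φ.symm v.1.1, ψ.symm v.1.2)) (isotropyJet x (φ.symm v.1.1) v.2)) (a₀, e) := by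
    refine hZ.smoothAround_act s3 s4 m4 ?_
    filter_upwards [s1.continuousAt.eventually_mem
      ((hT.isOpen.inter φ.open_source).mem_nhds (by
        change φ.symm (φ x) ∈ _
        rw [ex]
        exact ⟨hx, mx⟩))] with v hv
    rw [hT.proj_symm _ hv.1, target_isotropyJet hv.2]
  have e5 : act (Ψ (φ.symm a₀.1, ψ.symm a₀.2)) (isotropyJet x (φ.symm a₀.1) e) = u₀ := by
    change act (Ψ (φ.symm (φ x), ψ.symm (ψ (Φ u₀)))) (isotropyJet x (φ.symm (φ x)) e) = u₀
    rw [ex, eu, hue, act_id u₀ x mx hu]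
  have s6 : SmoothAround I 𝓘(ℝ, V) G' (a₀, e) :=
    SmoothAround.comp_of_eq (g := Φ) (hT.smoothAround_fst u₀ (by rwa [hu])) s5 e5
  have e6 : G' (a₀, e) = Φ u₀ := congrArg Φ e5
  have s7 : SmoothAround I 𝓘(ℝ, V) (fun v => ψ (G' v)) (a₀, e) :=
    SmoothAround.comp_of_eq (g := ψ) (smoothAround_chartAt mu) s6 e6
  -- At the point `u₀` the dependence on `c` is the orbit map, a submersion at the identity. Hence
  -- the equation that `u c` has a given fibre coordinate can be solved smoothly for `c`.
  have e7 : (fun c : IsotropyCoeff q E => ψ (G' (a₀, c))) = orbitMap V act Φ x u₀ := by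
    funext c
    change ψ (Φ (act (Ψ (φ.symm (φ x), ψ.symm (ψ (Φ u₀)))) (isotropyJet x (φ.symm (φ x)) c))) = _
    rw [ex, eu, hue]
    rfl
  obtain ⟨S, hS, hS1, hS2⟩ := exists_smooth_solution (G := fun v => ψ (G' v)) s7
    (by rw [e7]; exact hRange)
  rw [e6] at hS hS1
  have sa : ∀ w : X × M, w = (x, u₀) → SmoothAround (𝓘(ℝ, E).prod 𝓘(ℝ, EM)) 𝓘(ℝ, E × V)
      (fun w : X × M => (φ w.1, ψ (Φ w.2))) w := by
    rintro _ rfl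
    exact (SmoothAround.comp_of_eq (g := φ) (smoothAround_chartAt mx) (SmoothAround.fst _)
      rfl).prodMk_space (SmoothAround.comp_of_eq (g := ψ) (smoothAround_chartAt mu)
      (SmoothAround.comp_of_eq (g := Φ) (hT.smoothAround_fst u₀ (by rwa [hu]))
        (SmoothAround.snd _) rfl) rfl)
  let J := 𝓘(ℝ, E).prod (𝓘(ℝ, EM).prod 𝓘(ℝ, EM))
  have t1 : SmoothAround J 𝓘(ℝ, E × V) (fun w : X × M × M => (φ w.1, ψ (Φ w.2.1)))
      (x, u₀, u₀) :=
    SmoothAround.comp (g := fun w : X × M => (φ w.1, ψ (Φ w.2)))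
      (f := fun w : X × M × M => (w.1, w.2.1)) (sa _ rfl)
      ((SmoothAround.fst _).prodMk ((SmoothAround.fst _).comp_of_eq (SmoothAround.snd _) rfl))
  have t2 : SmoothAround J 𝓘(ℝ, V) (fun w : X × M × M => ψ (Φ w.2.2)) (x, u₀, u₀) :=
    SmoothAround.comp_of_eq (g := ψ) (smoothAround_chartAt mu)
      (SmoothAround.comp_of_eq (g := Φ) (hT.smoothAround_fst u₀ (by rwa [hu]))
        ((SmoothAround.snd _).comp_of_eq (SmoothAround.snd _) rfl) rfl) rfl
  have t3 := t1.prodMk_space t2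
  have t4 : SmoothAround J 𝓘(ℝ, IsotropyCoeff q E)
      (fun w : X × M × M => S ((φ w.1, ψ (Φ w.2.1)), ψ (Φ w.2.2))) (x, u₀, u₀) :=
    SmoothAround.comp (g := S) hS t3
  have e4 : S ((φ x, ψ (Φ u₀)), ψ (Φ u₀)) = e := by
    have := hS2.self_of_nhds
    rwa [e6] at this
  refine ⟨fun w => S ((φ w.1, ψ (Φ w.2.1)), ψ (Φ w.2.2)), t4, ?_, ?_⟩
  · have t5 : ContinuousAt (fun w : X × M × M =>
        ((φ w.1, ψ (Φ w.2.1)), S ((φ w.1, ψ (Φ w.2.1)), ψ (Φ w.2.2)))) (x, u₀, u₀) :=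
      t1.continuousAt.prodMk t4.continuousAt
    have n1 : ∀ᶠ v in 𝓝 (a₀, e), G' v ∈ ψ.source :=
      s6.continuousAt.eventually_mem (ψ.open_source.mem_nhds (by rwa [e6]))
    have n2 : ∀ᶠ v in 𝓝 (a₀, e),
        isotropyJet x (φ.symm v.1.1) v.2 ∈ fullJetGroupoid E X q :=
      s4.continuousAt.eventually_mem (isOpen_fullJetGroupoid.mem_nhds m4)
    have n3 := t5.eventually (p := fun v => G' v ∈ ψ.source) (by dsimp only; rw [e4]; exact n1)
    have n4 := t5.eventually (p := fun v =>
      isotropyJet x (φ.symm v.1.1) v.2 ∈ fullJetGroupoid E X q) (by dsimp only; rw [e4]; exact n2)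
    have cΦ := (hT.smoothAround_fst u₀ (by rwa [hu])).continuousAt
    have c1 : ContinuousAt (fun w : X × M × M => w.1) (x, u₀, u₀) := continuousAt_fst
    have c2 : ContinuousAt (fun w : X × M × M => Φ w.2.1) (x, u₀, u₀) :=
      ContinuousAt.comp_of_eq (g := Φ) (f := fun w : X × M × M => w.2.1) cΦ (by fun_prop) rfl
    have c3 : ContinuousAt (fun w : X × M × M => Φ w.2.2) (x, u₀, u₀) :=
      ContinuousAt.comp_of_eq (g := Φ) (f := fun w : X × M × M => w.2.2) cΦ (by fun_prop) rfl
    filter_upwards [n3, n4, t3.continuousAt.eventually hS1,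
      c1.eventually_mem ((hT.isOpen.inter φ.open_source).mem_nhds ⟨hx, mx⟩),
      c2.eventually_mem (ψ.open_source.mem_nhds mu),
      c3.eventually_mem (ψ.open_source.mem_nhds mu)]
    rintro ⟨z, u, v⟩ h1 h2 h3 h4 h5 h6 hu hv
    dsimp only at h1 h2 h3 h4 h5 h6 hu hv ⊢
    have e1 := hT.symm_apply u (by rw [hu]; exact h4.1)
    rw [hu] at e1
    simp only [G', φ.left_inv h4.2, ψ.left_inv h5, e1] at h1 h2 h3
    refine ⟨h2, ?_⟩
    -- The points `u c` and `v` have the same fibre coordinate and lie over the same `z`, so they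
    -- are equal.
    have h7 := ψ.injOn h1 h6 h3
    have h8 := (A.act_mem u (mem_univ _) _ h2 (by rw [hu, target_isotropyJet h4.2])).2
    rw [source_isotropyJet] at h8
    have e2 := hT.symm_apply _ (by rw [h8]; exact h4.1)
    have e3 := hT.symm_apply v (by rw [hv]; exact h4.1)
    rw [h8, h7] at e2
    rw [hv] at e3
    exact e2.symm.trans e3
  · have cΦ := (hT.smoothAround_fst u₀ (by rwa [hu])).continuousAt
    have c1 : ContinuousAt (fun w : X × M => w.1) (x, u₀) := continuousAt_fst
    have c2 : ContinuousAt (fun w : X × M => Φ w.2) (x, u₀) :=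
      ContinuousAt.comp_of_eq (g := Φ) (f := fun w : X × M => w.2) cΦ (by fun_prop) rfl
    filter_upwards [(sa _ rfl).continuousAt.eventually hS2,
      c1.eventually_mem ((hT.isOpen.inter φ.open_source).mem_nhds ⟨hx, mx⟩),
      c2.eventually_mem (ψ.open_source.mem_nhds mu)]
    rintro ⟨z, u⟩ h1 h2 h3 hu
    dsimp only at h1 h2 h3 hu ⊢
    have e1 := hT.symm_apply u (by rw [hu]; exact h2.1)
    rw [hu] at e1
    simpa only [G', φ.left_inv h2.2, ψ.left_inv h3, e1, act_id u z h2.2 hu] using h1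

end HomogeneousFibers

/-! ### Correcting a jet field to a section of the symmetry groupoid. -/

section Prolongation

variable {E : Type*} {EM : Type*} [NormedAddCommGroup E] [NormedSpace ℝ E]
  [FiniteDimensional ℝ E] [NormedAddCommGroup EM] [NormedSpace ℝ EM]
  {X M : Type u} [TopologicalSpace X] [ChartedSpace E X] [IsManifold 𝓘(ℝ, E) ∞ X]
  [TopologicalSpace M] [ChartedSpace EM M] [IsManifold 𝓘(ℝ, EM) ∞ M]
  {π : M → X} {q r : ℕ} {act : M → Jet E E X X q → M} {ω₀ : X → M}

/-- A jet that preserves the `r`-jet of a section `ω₀` of a bundle with homogeneous fibres comes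
from a local section of the symmetry groupoid of `ω₀`. -/
theorem IsNaturalBundle.jet_mem_jetBundle_symmetryGroupoid
    (hZ : IsNaturalBundle E EM q π univ act) (hω : IsSmoothSection E EM π univ ω₀)
    (hh : HasHomogeneousFibers π univ act) {f : X → X} {x : X} (hf : SmoothNear E E f x)
    (hfx : jet E E q f x ∈ fullJetGroupoid E X q)
    (h : jet E EM r (fun z => act (ω₀ (f z)) (jet E E q f z)) x = jet E EM r ω₀ x) :
    jet E (JetModel q E E) r (fun z => jet E E q f z) x ∈
      jetBundle r Jet.source (symmetryGroupoid act ω₀) := by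
  have := FiniteDimensional.complete ℝ E
  have mx := mem_chart_source E x
  obtain ⟨V, _, _, _, F, _, _, _, U, Φ, Ψ, hxU, hT⟩ :=
    hZ.isSmoothFiberBundle.exists_isLocalTrivialization x
  obtain ⟨c, hc, hc1, hc2⟩ := exists_smooth_isotropy hZ hT hxU (hω.proj x) hh
  obtain ⟨hβ, hπβ⟩ := hZ.smoothNear_act hf hfx (hω.smoothNear (f x))
    (Eventually.of_forall hω.proj)
  set β : X → M := fun z => act (ω₀ (f z)) (jet E E q f z)
  have hβx : β x = ω₀ x := target_eq_of_jet_eq h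
  have hωx := hω.smoothNear x
  -- `H (z, u, v)` is the product of `j_z^q f` and the isotropy jet `c(z, u, v)`. Written as the jet
  -- of a composite map, it is smooth as the jet of a smooth family.
  let H : X × M × M → Jet E E X X q := fun w =>
    jet E E q (fun y => f (isotropyMap x w.1 (c w) y)) w.1
  have H_eq : ∀ w : X × M × M, w.1 ∈ (chartAt E x).source → SmoothNear E E f w.1 →
      H w = (jet E E q f w.1).comp (isotropyJet x w.1 (c w)) := by
    intro w hw hfw
    have e := isotropyMap_self (c := c w) hw
    have h := Jet.comp_jet (r := q) (g := f) (f := isotropyMap x w.1 (c w)) (x := w.1)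
      (by rwa [e]) (smoothNear_isotropyMap hw)
    rw [e] at h
    exact h.symm
  have sH : SmoothAround (𝓘(ℝ, E).prod (𝓘(ℝ, EM).prod 𝓘(ℝ, EM))) 𝓘(ℝ, JetModel q E E) H
      (x, ω₀ x, ω₀ x) := by
    refine smoothAround_jet
      (G := fun (w : X × M × M) (y : X) => f (isotropyMap x w.1 (c w) y)) (b := fun w => w.1)
      ?_ (SmoothAround.fst _)
    refine SmoothAround.comp_of_eq (g := f) hf (SmoothAround.comp
      (g := fun w : (X × IsotropyCoeff q E) × X => isotropyMap x w.1.1 w.1.2 w.2)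
      (f := fun w : (X × M × M) × X => ((w.1.1, c w.1), w.2)) (smoothAround_isotropyMap mx)
      ((((SmoothAround.fst _).comp_of_eq (SmoothAround.fst _) rfl).prodMk
        (SmoothAround.comp_of_eq (g := c) hc (SmoothAround.fst _) rfl)).prodMk
          (SmoothAround.snd _))) ?_
    exact isotropyMap_self mx
  have hnear : ∀ᶠ z in 𝓝 x, z ∈ (chartAt E x).source ∧ SmoothNear E E f z :=
    ((chartAt E x).open_source.eventually_mem mx).and hf.eventually_nhds
  have cω : ContinuousAt (fun z => (z, ω₀ z)) x :=
    continuousAt_id.prodMk hωx.self_of_nhds.continuousAt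
  have e0 : (x, β x, ω₀ x) = (x, ω₀ x, ω₀ x) := by rw [hβx]
  have tβ : Tendsto (fun z => (z, β z, ω₀ z)) (𝓝 x) (𝓝 (x, ω₀ x, ω₀ x)) := by
    rw [← e0]
    exact tendsto_id.prodMk_nhds
      (hβ.self_of_nhds.continuousAt.tendsto.prodMk_nhds hωx.self_of_nhds.continuousAt.tendsto)
  -- This section lies in the symmetry groupoid, because `ω₀(f(z)) (j_z^q f) = β(z)` and `c(z, β(z),
  -- ω₀(z))` carries `β(z)` to `ω₀(z)`.
  refine ⟨fun z => H (z, β z, ω₀ z), x, ?_, ?_, ?_⟩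
  · exact SmoothAround.comp_of_eq (g := H) sH ((SmoothAround.id x).prodMk
      (SmoothAround.prodMk hβ hωx)) e0
  · filter_upwards [hnear, hπβ, eventually_jet_mem_fullJetGroupoid hf hfx,
      tβ.eventually hc1] with z h1 h2 h3 h4
    obtain ⟨h5, h6⟩ := h4 h2 (hω.proj z)
    have e1 := H_eq (z, β z, ω₀ z) h1.1 h1.2
    have e2 : (jet E E q f z).source = (isotropyJet x z (c (z, β z, ω₀ z))).target := by
      rw [source_jet, target_isotropyJet h1.1]
    dsimp only at e1
    rw [e1]
    refine ⟨⟨Jet.comp_mem h3 h5 e2, ?_⟩, ?_⟩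
    · rw [Jet.target_comp e2, target_jet, Jet.source_comp, source_isotropyJet,
        hZ.isGroupoidAction.act_comp _ (mem_univ _) _ h3 _ h5 (by rw [hω.proj, target_jet]) e2]
      exact h6
    · rw [Jet.source_comp, source_isotropyJet]
  -- As `β` and `ω₀` have the same `r`-jet at `x`, replacing `β` by `ω₀` does not change the `r`-jet
  -- of the section; after this replacement the isotropy jet is the identity.
  · have e3 := jet_family_congr (H := H) hβ hωx hωx hωx h rfl (by rw [hβx]; exact sH)
    rw [e3]
    refine jet_congr ?_
    filter_upwards [hnear, cω.eventually hc2] with z h1 h2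
    rw [H_eq _ h1.1 h1.2, h2 (hω.proj z), isotropyJet_id h1.1]
    have e4 := Jet.comp_jet (r := q) (g := f) (f := id) (x := z) h1.2 (SmoothAround.id z)
    exact e4.symm

theorem IsNaturalBundle.prolongation_symmetryGroupoid
    (hZ : IsNaturalBundle E EM q π univ act) (hω : IsSmoothSection E EM π univ ω₀)
    (hh : HasHomogeneousFibers π univ act)
    {act' : Jet E EM X M r → Jet E E X X (q + r) → Jet E EM X M r}
    (hact : IsInducedAction r π act act') :
    prolongation r (symmetryGroupoid act ω₀) ∩ fullJetGroupoid E X (q + r) =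
      symmetryGroupoid act' (fun x => jet E EM r ω₀ x) := by
  have := FiniteDimensional.complete ℝ E
  refine Subset.antisymm (hZ.prolongation_symmetryGroupoid_subset hω hact) ?_
  rintro g ⟨hg, h⟩
  refine ⟨?_, hg⟩
  obtain ⟨f, x, hfd, rfl⟩ := hg
  have hf := smoothNear_of_isLocalDiffeomorphAt hfd
  rw [source_jet, target_jet, hact ω₀ f x hf (jet_mem_fullJetGroupoid hfd) (hω.smoothNear _)
    (Eventually.of_forall hω.proj)] at h
  exact ⟨f, x, hf, rfl,
    hZ.jet_mem_jetBundle_symmetryGroupoid hω hh hf (jet_mem_fullJetGroupoid hfd) h⟩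

end Prolongation

end JetBundles

end

/-! ### The theorem. -/

theorem mainTheorem3
    {E EZ : Type} [NormedAddCommGroup E] [NormedSpace ℝ E] [FiniteDimensional ℝ E]
    [NormedAddCommGroup EZ] [NormedSpace ℝ EZ] [FiniteDimensional ℝ EZ]
    {X : Type u} [TopologicalSpace X] [ChartedSpace E X] [IsManifold 𝓘(ℝ, E) ∞ X]
    {Z : Type u} [TopologicalSpace Z] [ChartedSpace EZ Z] [IsManifold 𝓘(ℝ, EZ) ∞ Z]
    (π : Z → X) (q : ℕ) (act : Z → JetBundles.Jet E E X X q → Z)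
    (hZ : JetBundles.IsNaturalBundle E EZ q π Set.univ act) (r : ℕ) :
    ∃ act' : JetBundles.Jet E EZ X Z r → JetBundles.Jet E E X X (q + r) →
        JetBundles.Jet E EZ X Z r,
      JetBundles.IsInducedAction r π act act' ∧
      JetBundles.IsNaturalBundle E (JetBundles.JetModel r E EZ) (q + r)
        JetBundles.Jet.source (JetBundles.jetBundle r π Set.univ) act' ∧
      ∀ ω₀ : X → Z, JetBundles.IsSmoothSection E EZ π Set.univ ω₀ →
        JetBundles.IsSmoothSection E (JetBundles.JetModel r E EZ) JetBundles.Jet.source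
          (JetBundles.jetBundle r π Set.univ) (fun x => JetBundles.jet E EZ r ω₀ x) ∧
        (JetBundles.HasHomogeneousFibers π Set.univ act →
          JetBundles.prolongation r (JetBundles.symmetryGroupoid act ω₀) ∩
              JetBundles.fullJetGroupoid E X (q + r) =
            JetBundles.symmetryGroupoid act' (fun x => JetBundles.jet E EZ r ω₀ x) ∧
          (1 ≤ q → JetBundles.prolongation r (JetBundles.symmetryGroupoid act ω₀) ⊆
            JetBundles.fullJetGroupoid E X (q + r))) := by
  have := FiniteDimensional.complete ℝ E
  refine ⟨JetBundles.inducedAct π r act, hZ.isInducedAction_inducedAct,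
    hZ.jet_prolongation hZ.isInducedAction_inducedAct, fun ω₀ hω => ⟨hω.jet_prolongation r,
      fun hh => ⟨hZ.prolongation_symmetryGroupoid hω hh hZ.isInducedAction_inducedAct,
        fun hq => JetBundles.prolongation_subset_fullJetGroupoid hq⟩⟩⟩
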